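/- **Restricted Strip Cover (RSC).** An instance consists of $n\ge 1$ sensors $s_1,\dots,s_n$; sensor $s$ has an interval $R(s)=[\ell(s),r(s))\subset\mathbb R$ with integer endpoints $\ell(s)<r(s)$ and a positive integer duration $d(s)$. Let $U=\bigcup_s R(s)$, $d_{\max}=\max_s d(s)$, and let $L=\min_{x\in U}\sum_{s:\,x\in R(s)}d(s)$ be the load. A schedule of duration $T\ge 0$ assigns to each sensor $s$ a start time $t(s)\ge 0$ such that for all $x\in U$ and all real $0\le y<T$ there is a sensor $s$ with $x\in R(s)$ and $t(s)\le y<t(s)+d(s)$. **Theorem.** There are constants $\varepsilon_0>0$, $C$ and $K$ and a single algorithm such that, for every real $0<\varepsilon\le\varepsilon_0$ and every RSC instance with $n$ sensors, the algorithm halts after at most $K\,(n+1/\varepsilon)^{K}$ (that is, $\mathrm{poly}(n,1/\varepsilon)$) steps and outputs the start times of a schedule whose duration is at least $$\frac{L}{1+\varepsilon}\;-\;C\cdot d_{\max}\,\log n\cdot\frac1{\varepsilon^{4}} .$$ Here an algorithm is a program of a deterministic random access machine with integer registers and integer arrays (with indirect addressing), in which each constant, read, write, addition, subtraction and test for positivity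 takes one step. It receives the instance (the numbers $n,\ell(s),r(s),d(s)$) and the parameter $\varepsilon$ in the form of natural numbers $a,b$ with $b>0$ and $\varepsilon/2\le a/b\le\varepsilon$ (any such pair; if $\varepsilon$ is rational one can take $a/b=\varepsilon$). -/

import Mathlib

/-! ### Restricted Strip Cover -/

/-- An instance of Restricted Strip Cover with `n` sensors. Sensor `s` is live on the half-open
interval `[left s, right s)` and can be active for `dur s` units of time. -/
structure RSC (n : ℕ) where
  left : Fin n → ℤ
  right : Fin n → ℤ
  dur : Fin n → ℕ
  left_lt_right : ∀ s, left s < right s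
  dur_pos : ∀ s, 0 < dur s

namespace RSC

variable {n : ℕ} (I : RSC n)

/-- The region `R(s) = [ℓ(s), r(s))` of the real line covered by sensor `s`. -/
def region (s : Fin n) : Set ℝ := Set.Ico (I.left s : ℝ) (I.right s : ℝ)

/-- The region to be covered, `U = ⋃ R(s)`. -/
def target : Set ℝ := ⋃ s, I.region s

open Classical in
/-- The load at `x`: the total duration of the sensors that are live at `x`. -/
noncomputable def loadAt (x : ℝ) : ℕ := ∑ s with x ∈ I.region s, I.dur s

/-- The load `L = min_{x ∈ U} L(x)`. -/
noncomputable def load : ℕ := sInf (I.loadAt '' I.target)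

/-- The maximum duration of a sensor. -/
def dmax : ℕ := Finset.univ.sup I.dur

/-- `t` is a schedule of duration `T`: the start times are nonnegative, and every point of the
target region is covered by an active sensor at all times `0 ≤ y < T`. -/
def IsSchedule (t : Fin n → ℝ) (T : ℝ) : Prop :=
  (∀ s, 0 ≤ t s) ∧
    ∀ x ∈ I.target, ∀ y : ℝ, 0 ≤ y → y < T →
      ∃ s, x ∈ I.region s ∧ t s ≤ y ∧ y < t s + I.dur s

end RSC

/-! ### A random access machine

Programs work on integer registers and integer arrays, with indirect addressing. The arithmetic is
addition and subtraction only, and each operation takes one unit of time, whatever the size of its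
operands. (There is no multiplication, so `T` steps can raise the bit length of the numbers by
at most `O(T)`.) A program is a finite object that names finitely many registers and arrays, and it
does not depend on its input. -/

namespace RAM

/-- A memory: register number `x` holds `reg x`, and cell `i` of array number `A` holds
`arr A i`. -/
structure Memory where
  reg : ℕ → ℤ
  arr : ℕ → ℤ → ℤ

/-- Arithmetic expressions. `get A e` reads the cell of array `A` whose index is the value
of `e`. -/
inductive Expr where
  | const (c : ℤ)
  | reg (x : ℕ)
  | get (A : ℕ) (e : Expr)
  | add (e₁ e₂ : Expr)
  | sub (e₁ e₂ : Expr)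

namespace Expr

/-- The value of an expression. -/
def eval (m : Memory) : Expr → ℤ
  | const c => c
  | reg x => m.reg x
  | get A e => m.arr A (eval m e)
  | add e₁ e₂ => eval m e₁ + eval m e₂
  | sub e₁ e₂ => eval m e₁ - eval m e₂

/-- The time it takes to evaluate an expression: one step for each constant, register access,
array access, addition and subtraction. -/
def cost : Expr → ℕ
  | const _ => 1
  | reg _ => 1
  | get _ e => cost e + 1
  | add e₁ e₂ => cost e₁ + cost e₂ + 1
  | sub e₁ e₂ => cost e₁ + cost e₂ + 1

end Expr

/-- Programs. -/
inductive Prog where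
  /-- do nothing -/
  | skip
  /-- write the value of `e` into register `x` -/
  | assign (x : ℕ) (e : Expr)
  /-- write the value of `e` into the cell of array `A` whose index is the value of `i` -/
  | store (A : ℕ) (i e : Expr)
  /-- run `p`, then `q` -/
  | seq (p q : Prog)
  /-- run `p` if the value of `e` is positive, and `q` otherwise -/
  | ifPos (e : Expr) (p q : Prog)
  /-- run `p` again and again as long as the value of `e` is positive -/
  | whilePos (e : Expr) (p : Prog)

/-- The memory after writing `v` into register `x`. -/
def Memory.setReg (m : Memory) (x : ℕ) (v : ℤ) : Memory :=
  { m with reg := Function.update m.reg x v }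

/-- The memory after writing `v` into cell `i` of array `A`. -/
def Memory.setArr (m : Memory) (A : ℕ) (i v : ℤ) : Memory :=
  { m with arr := Function.update m.arr A (Function.update (m.arr A) i v) }

/-- `Runs p m m' T`: started in memory `m`, the program `p` halts after exactly `T` steps, and
leaves memory `m'`. -/
inductive Runs : Prog → Memory → Memory → ℕ → Prop where
  | skip (m : Memory) : Runs .skip m m 1
  | assign (x : ℕ) (e : Expr) (m : Memory) :
      Runs (.assign x e) m (m.setReg x (e.eval m)) (e.cost + 1)
  | store (A : ℕ) (i e : Expr) (m : Memory) :
      Runs (.store A i e) m (m.setArr A (i.eval m) (e.eval m)) (i.cost + e.cost + 1)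
  | seq {p q : Prog} {m₁ m₂ m₃ : Memory} {T₁ T₂ : ℕ} :
      Runs p m₁ m₂ T₁ → Runs q m₂ m₃ T₂ → Runs (.seq p q) m₁ m₃ (T₁ + T₂)
  | ifPos_pos {e : Expr} {p : Prog} (q : Prog) {m m' : Memory} {T : ℕ} :
      0 < e.eval m → Runs p m m' T → Runs (.ifPos e p q) m m' (e.cost + 1 + T)
  | ifPos_nonpos {e : Expr} (p : Prog) {q : Prog} {m m' : Memory} {T : ℕ} :
      e.eval m ≤ 0 → Runs q m m' T → Runs (.ifPos e p q) m m' (e.cost + 1 + T)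
  | whilePos_pos {e : Expr} {p : Prog} {m₁ m₂ m₃ : Memory} {T₁ T₂ : ℕ} :
      0 < e.eval m₁ → Runs p m₁ m₂ T₁ → Runs (.whilePos e p) m₂ m₃ T₂ →
        Runs (.whilePos e p) m₁ m₃ (e.cost + 1 + T₁ + T₂)
  | whilePos_nonpos {e : Expr} (p : Prog) {m : Memory} :
      e.eval m ≤ 0 → Runs (.whilePos e p) m m (e.cost + 1)

end RAM

namespace RSC

variable {n : ℕ} (I : RSC n)

/-- The array that holds `f 0, …, f (n - 1)` in its cells `0, …, n - 1`, and `0` elsewhere. -/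
def listed (f : Fin n → ℤ) (i : ℤ) : ℤ :=
  if h : 0 ≤ i ∧ i.toNat < n then f ⟨i.toNat, h.2⟩ else 0

/-- The initial memory of a computation on the instance `I` and the fraction `a / b`: registers
0, 1, 2 hold `n`, `a`, `b`; arrays 0, 1, 2 hold the left endpoints, the right endpoints and the
durations; everything else is zero. -/
def input (a b : ℕ) : RAM.Memory where
  reg x := if x = 0 then n else if x = 1 then a else if x = 2 then b else 0
  arr A := if A = 0 then listed I.left else if A = 1 then listed I.right
    else if A = 2 then listed (fun s => (I.dur s : ℤ)) else fun _ => 0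

end RSC

/-- The start times that a halted computation has left in cells `0, …, n - 1` of array 3. -/
def RAM.Memory.startTimes (m : RAM.Memory) {n : ℕ} (s : Fin n) : ℝ :=
  (m.arr 3 ((s : ℕ) : ℤ) : ℝ)

/-! ### Total correctness with time bounds -/

namespace RAM

/-! Write `d` for the largest duration and set `D = q d`, `S = q D` with `q` of order `1/ε`. Sensors
are stacked into boxes of height `D`: a box is the common interval of its sensors, and a closed box
uses total duration less than `D + d`. Equal heights make the rest easy. If every point of the
target lies in at least `kk` boxes, the boxes can be distributed to `kk` consecutive time slots of
length `D` so that every slot covers the target (`Greedy.push`, `Greedy.covers`). This gives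
duration `kk * D`. It remains to show that boxing loses little: at every `x`, the weight `W` of the
sensors live at `x` is at most about `D` times the number `b` of boxes at `x`.

For sensors that all cross one line `v`, a layer takes weight about `S` with the leftmost left ends
and stacks it by decreasing right end, then takes weight about `S` with the rightmost right ends and
stacks it by increasing left end. If stacking meets the sensors live at `x` before the others, at
most one box per group is wasted at `x` (`ChunkAt.push`). Let `x` be left of `v`. If the first group
is live at `x` as a whole, its weight `S` pays for both wasted boxes, which costs only a factor `1 +
O(1/q)`. If some sensor of it is not live at `x`, no remaining sensor is live there either. The
other side is symmetric, with the second group (`layer_dichotomy`). So at each `x` a line has at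
most one layer that cannot be charged, which costs `2 (S + d)` (`LineAt.step`).

The lines are the sorted left ends, processed dyadically: multiples of `2 ^ j` for decreasing `j`.
Two sensors that share `x` but cross different lines of one level would straddle a line of an
earlier level, so one of them would already be boxed (`Lines.cross`). Each `x` therefore pays for
one line per level, and there are at most `log₂ n + 1` levels (`ens_level`, `ens_levels`). In total
`(q - 3) W ≤ q (D + d) b + G * 2 q (S + d)`, and `duration_bound` inserts `7 ≤ q ε ≤ 15`.

Array 6 holds the state of a sensor: 0 untouched, 1 crossing the current line, 2 taken for stacking,
3 placed. Arrays 7 and 8 hold its box and its height in the box; arrays 9 and 10 the ends of the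
boxes; arrays 11 and 12 the frontiers and the starts of the slots; array 15 the start times of the
boxes. Register 14 counts the closed boxes and register 13 is the running weight. -/

@[simp] theorem Memory.setReg_reg (m : Memory) (x : ℕ) (v : ℤ) (y : ℕ) :
    (m.setReg x v).reg y = if y = x then v else m.reg y := by
  simp [Memory.setReg, Function.update_apply]

@[simp] theorem Memory.setReg_arr (m : Memory) (x : ℕ) (v : ℤ) : (m.setReg x v).arr = m.arr := rfl

@[simp] theorem Memory.setArr_reg (m : Memory) (A : ℕ) (i v : ℤ) :
    (m.setArr A i v).reg = m.reg := rfl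

@[simp] theorem Memory.setArr_arr (m : Memory) (A : ℕ) (i v : ℤ) (B : ℕ) :
    (m.setArr A i v).arr B = if B = A then Function.update (m.arr A) i v else m.arr B := by
  by_cases h : B = A
  · subst h; simp [Memory.setArr]
  · simp [Memory.setArr, h]

/-- Started in `m`, the program `p` halts within `t` steps in a memory that satisfies `Q`. -/
def Ens (p : Prog) (m : Memory) (t : ℕ) (Q : Memory → Prop) : Prop :=
  ∃ m' T, Runs p m m' T ∧ T ≤ t ∧ Q m'

theorem Ens.mono {p : Prog} {m : Memory} {t t' : ℕ} {Q Q' : Memory → Prop} (h : Ens p m t Q)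
    (ht : t ≤ t') (hQ : ∀ m', Q m' → Q' m') : Ens p m t' Q' := by
  obtain ⟨m', T, h1, h2, h3⟩ := h
  exact ⟨m', T, h1, h2.trans ht, hQ _ h3⟩

theorem Ens.skip {m : Memory} {Q : Memory → Prop} (h : Q m) : Ens .skip m 1 Q :=
  ⟨m, 1, .skip m, le_rfl, h⟩

theorem Ens.assign {m : Memory} {Q : Memory → Prop} {x : ℕ} {e : Expr}
    (h : Q (m.setReg x (e.eval m))) : Ens (.assign x e) m (e.cost + 1) Q :=
  ⟨_, _, .assign x e m, le_rfl, h⟩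

theorem Ens.seq {p q : Prog} {m : Memory} {t₁ t₂ : ℕ} {Q R : Memory → Prop}
    (hp : Ens p m t₁ R) (hq : ∀ m', R m' → Ens q m' t₂ Q) : Ens (.seq p q) m (t₁ + t₂) Q := by
  obtain ⟨m', T, h1, h2, h3⟩ := hp
  obtain ⟨m'', T', h1', h2', h3'⟩ := hq m' h3
  exact ⟨m'', T + T', .seq h1 h1', by omega, h3'⟩

theorem Ens.ifPos {e : Expr} {p q : Prog} {m : Memory} {t : ℕ} {Q : Memory → Prop}
    (hp : 0 < e.eval m → Ens p m t Q) (hq : e.eval m ≤ 0 → Ens q m t Q) :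
    Ens (.ifPos e p q) m (e.cost + 1 + t) Q := by
  rcases lt_or_ge 0 (e.eval m) with h | h
  · obtain ⟨m', T, h1, h2, h3⟩ := hp h
    exact ⟨m', _, .ifPos_pos q h h1, by omega, h3⟩
  · obtain ⟨m', T, h1, h2, h3⟩ := hq h
    exact ⟨m', _, .ifPos_nonpos p h h1, by omega, h3⟩

/-- Total correctness from an invariant `J` and a measure `μ`: at most `N` rounds of the body, plus
the last test that fails. -/
theorem Ens.whilePos {e : Expr} {p : Prog} {t : ℕ} (J : Memory → Prop) (μ : Memory → ℕ)
    (hb : ∀ m, J m → 0 < e.eval m → Ens p m t (fun m' => J m' ∧ μ m' < μ m)) {N : ℕ}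
    {m : Memory} (hm : J m) (hN : μ m ≤ N) :
    Ens (.whilePos e p) m ((N + 1) * (e.cost + 1 + t)) (fun m' => J m' ∧ e.eval m' ≤ 0) := by
  induction N generalizing m with
  | zero =>
    rcases lt_or_ge 0 (e.eval m) with h | h
    · obtain ⟨m', T, h1, h2, h3, h4⟩ := hb m hm h
      omega
    · exact ⟨m, _, .whilePos_nonpos p h, by simp, hm, h⟩
  | succ N ih =>
    rcases lt_or_ge 0 (e.eval m) with h | h
    · obtain ⟨m', T, h1, h2, h3, h4⟩ := hb m hm h
      obtain ⟨m'', T', h1', h2', h3'⟩ := ih h3 (by omega)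
      exact ⟨m'', _, .whilePos_pos h h1 h1', by nlinarith, h3'⟩
    · exact ⟨m, _, .whilePos_nonpos p h, by nlinarith [Nat.zero_le N], hm, h⟩

/-- The effect of a program without loops. -/
def Prog.exec : Prog → Memory → Memory
  | .skip, m => m
  | .assign x e, m => m.setReg x (e.eval m)
  | .store A i e, m => m.setArr A (i.eval m) (e.eval m)
  | .seq p q, m => q.exec (p.exec m)
  | .ifPos e p q, m => if 0 < e.eval m then p.exec m else q.exec m
  | .whilePos _ _, m => m

/-- The largest number of steps of a program without loops. -/
def Prog.cost : Prog → ℕ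
  | .skip => 1
  | .assign _ e => e.cost + 1
  | .store _ i e => i.cost + e.cost + 1
  | .seq p q => p.cost + q.cost
  | .ifPos e p q => e.cost + 1 + max p.cost q.cost
  | .whilePos _ _ => 0

/-- The program has no loops. -/
def Prog.LoopFree : Prog → Prop
  | .seq p q => p.LoopFree ∧ q.LoopFree
  | .ifPos _ p q => p.LoopFree ∧ q.LoopFree
  | .whilePos _ _ => False
  | _ => True

/-- Straight-line code can be evaluated symbolically, so that `simp` computes its effect and its
cost; only loops need invariants. -/
theorem Prog.LoopFree.ens_exec {p : Prog} (hp : p.LoopFree) (m : Memory) :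
    Ens p m p.cost (fun m' => m' = p.exec m) := by
  induction p generalizing m with
  | skip => exact .skip rfl
  | assign x e => exact .assign rfl
  | store A i e => exact ⟨_, _, .store A i e m, le_rfl, rfl⟩
  | seq p q ihp ihq =>
    refine (ihp hp.1 m).seq fun m' hm' => ?_
    subst hm'
    exact ihq hp.2 _
  | ifPos e p q ihp ihq =>
    refine Ens.ifPos (fun h => ?_) (fun h => ?_)
    · exact (ihp hp.1 m).mono (le_max_left _ _) fun m' hm' => by simp [Prog.exec, h, hm']
    · exact (ihq hp.2 m).mono (le_max_right _ _) fun m' hm' => by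
        simp [Prog.exec, not_lt.mpr h, hm']
  | whilePos e p => exact hp.elim

theorem Prog.LoopFree.ens {p : Prog} (hp : p.LoopFree) {m : Memory} {t : ℕ} {Q : Memory → Prop}
    (ht : p.cost ≤ t) (h : Q (p.exec m)) : Ens p m t Q :=
  (hp.ens_exec m).mono ht fun _ hm' => hm' ▸ h

/-! ### Counting loops -/

/-- Run `body` with register `v` set to `0, 1, …, N - 1` in turn. -/
def forLt (v N : ℕ) (body : Prog) : Prog :=
  .seq (.assign v (.const 0)) <|
  .whilePos (.sub (.reg N) (.reg v)) <| .seq body (.assign v (.add (.reg v) (.const 1)))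

/-- The invariant for `k + 1` is demanded of the memory in which the counter has already been
raised, because the increment comes after the body. -/
theorem ens_forLt {v N : ℕ} {body : Prog} (J : ℕ → Memory → Prop) {n t : ℕ} (hv : N ≠ v)
    (hb : ∀ k m, k < n → J k m → m.reg v = k → m.reg N = n → Ens body m t
      (fun m' => m'.reg v = k ∧ m'.reg N = n ∧ J (k + 1) (m'.setReg v (k + 1))))
    {m : Memory} (h0 : J 0 (m.setReg v 0)) (hN : m.reg N = n) :
    Ens (forLt v N body) m (2 + (n + 1) * (t + 8)) (fun m' => J n m' ∧ m'.reg N = n) := by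
  refine Ens.seq (Ens.assign (x := v) (e := .const 0) rfl) ?_
  rintro m1 rfl
  refine (Ens.whilePos (t := t + 4) (N := n)
    (fun m' => m'.reg N = n ∧ ∃ k : ℕ, k ≤ n ∧ m'.reg v = k ∧ J k m')
    (fun m' => (n - m'.reg v).toNat) ?_ ?_ ?_).mono ?_ ?_
  · rintro m1 ⟨hn, k, hk, hvk, hJ⟩ hpos
    simp only [Expr.eval, hn, hvk] at hpos
    refine (hb k m1 (by omega) hJ hvk hn).seq (Q := _) ?_
    rintro m2 ⟨h1, h2, h3⟩
    refine Ens.assign ⟨⟨by simp [hv, h2], k + 1, by omega, by simp [Expr.eval, h1], ?_⟩, ?_⟩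
    · simpa [Expr.eval, h1] using h3
    · simp [Expr.eval, h1, hvk]; omega
  · exact ⟨by simp [hv, hN], 0, by omega, by simp [Expr.eval], h0⟩
  · simp [Expr.eval]
  · simp only [Expr.cost]; exact Nat.mul_le_mul_left _ (by omega)
  · rintro m' ⟨⟨hn, k, hk, hvk, hJ⟩, hpos⟩
    simp only [Expr.eval, hn, hvk] at hpos
    obtain rfl : k = n := by omega
    exact ⟨hJ, hn⟩

/-! ### Selection of the least key -/

/-- Set register `out` to the index `i < N` with least key among those with state `f`, and to `-1`
if there is none. -/
def select (st : ℕ) (f : ℤ) (key N out : ℕ) : Prog :=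
  .seq (.assign out (.const (-1))) <| forLt 8 N <|
    .ifPos (.sub (.get st (.reg 8)) (.const f)) .skip <|
    .ifPos (.sub (.const f) (.get st (.reg 8))) .skip <|
    .ifPos (.add (.reg out) (.const 1))
      (.ifPos (.sub (.get key (.reg out)) (.get key (.reg 8))) (.assign out (.reg 8)) .skip)
      (.assign out (.reg 8))

/-- `m'` differs from `m` at most in the registers `8` and `out`. -/
def Agree (out : ℕ) (m m' : Memory) : Prop :=
  m'.arr = m.arr ∧ ∀ y, y ≠ 8 → y ≠ out → m'.reg y = m.reg y

theorem Agree.setReg {out : ℕ} {m m' : Memory} (h : Agree out m m') {x : ℕ} (hx : x = 8 ∨ x = out)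
    (v : ℤ) : Agree out m (m'.setReg x v) :=
  ⟨h.1, fun y h8 ho => by
    rw [Memory.setReg_reg, if_neg (by rintro rfl; tauto), h.2 y h8 ho]⟩

/-- The index `i` has the least key among the indices below `N` with state `f`. -/
def IsSel (st : ℤ → ℤ) (f : ℤ) (key : ℤ → ℤ) (N : ℕ) (i : ℕ) : Prop :=
  i < N ∧ st i = f ∧ ∀ j : ℕ, j < N → st j = f → key i ≤ key j

/-- The value `r` is the index of the least key with state `f`, or `-1` if there is none. -/
def SelVal (st : ℤ → ℤ) (f : ℤ) (key : ℤ → ℤ) (N : ℕ) (r : ℤ) : Prop :=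
  (r = -1 ∧ ∀ j : ℕ, j < N → st j ≠ f) ∨ ∃ i : ℕ, r = i ∧ IsSel st f key N i

theorem SelVal.succ_of_ne {st : ℤ → ℤ} {f : ℤ} {key : ℤ → ℤ} {N : ℕ} {r : ℤ}
    (h : SelVal st f key N r) (hne : st N ≠ f) : SelVal st f key (N + 1) r := by
  rcases h with ⟨h1, h2⟩ | ⟨i, h1, h2, h3, h4⟩
  · refine .inl ⟨h1, fun j hj => ?_⟩
    rcases Nat.lt_succ_iff_lt_or_eq.mp hj with h | rfl
    exacts [h2 j h, hne]
  · refine .inr ⟨i, h1, by omega, h3, fun j hj hjf => ?_⟩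
    rcases Nat.lt_succ_iff_lt_or_eq.mp hj with h | rfl
    exacts [h4 j h hjf, absurd hjf hne]

theorem SelVal.succ_new {st : ℤ → ℤ} {f : ℤ} {key : ℤ → ℤ} {N : ℕ} {r : ℤ}
    (h : SelVal st f key N r) (he : st N = f) (hr : 0 ≤ r → key N ≤ key r) :
    SelVal st f key (N + 1) N := by
  refine .inr ⟨N, rfl, by omega, he, fun j hj hjf => ?_⟩
  rcases Nat.lt_succ_iff_lt_or_eq.mp hj with hj | rfl
  · rcases h with ⟨h1, h2⟩ | ⟨i, rfl, h2, h3, h4⟩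
    · exact absurd hjf (h2 j hj)
    · exact (hr (by omega)).trans (h4 j hj hjf)
  · exact le_rfl

theorem SelVal.succ_old {st : ℤ → ℤ} {f : ℤ} {key : ℤ → ℤ} {N : ℕ} {r : ℤ}
    (h : SelVal st f key N r) (h0 : 0 ≤ r) (hr : key r ≤ key N) :
    SelVal st f key (N + 1) r := by
  rcases h with ⟨h1, h2⟩ | ⟨i, rfl, h2, h3, h4⟩
  · omega
  refine .inr ⟨i, rfl, by omega, h3, fun j hj hjf => ?_⟩
  rcases Nat.lt_succ_iff_lt_or_eq.mp hj with hj | rfl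
  exacts [h4 j hj hjf, hr]

/-- A linear scan whose invariant is `SelVal` for the prefix read so far. -/
theorem ens_select {st : ℕ} {f : ℤ} {key N out : ℕ} {m : Memory} {n : ℕ} (hN : m.reg N = n)
    (h8 : out ≠ 8) (hN8 : N ≠ 8) (hNo : N ≠ out) :
    Ens (select st f key N out) m (60 * (n + 1)) (fun m' => Agree out m m' ∧
      SelVal (m.arr st) f (m.arr key) n (m'.reg out)) := by
  refine (Ens.seq (Ens.assign (x := out) (e := .const (-1)) rfl) (t₂ := 2 + (n + 1) * (30 + 8))
    (Q := fun m' => Agree out m m' ∧ SelVal (m.arr st) f (m.arr key) n (m'.reg out)) ?_).mono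
    (by simp [Expr.cost]; omega) fun m' hm' => hm'
  rintro m1 rfl
  refine (ens_forLt (fun k m' => Agree out m m' ∧ SelVal (m.arr st) f (m.arr key) k (m'.reg out))
    hN8 ?_ ?_ ?_).mono le_rfl fun m' hm' => hm'.1
  · rintro k m1 hk ⟨hA, hs⟩ h1 h2
    refine Prog.LoopFree.ens (by simp [Prog.LoopFree]) (by simp [Prog.cost, Expr.cost]) ?_
    have old : SelVal (m.arr st) f (m.arr key) (k + 1) (m1.reg out) →
        m1.reg 8 = k ∧ m1.reg N = n ∧ Agree out m (m1.setReg 8 (k + 1)) ∧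
          SelVal (m.arr st) f (m.arr key) (k + 1) ((m1.setReg 8 (k + 1)).reg out) :=
      fun h => ⟨h1, h2, hA.setReg (.inl rfl) _, by simpa [h8] using h⟩
    have new : SelVal (m.arr st) f (m.arr key) (k + 1) k →
        (m1.setReg out k).reg 8 = k ∧ (m1.setReg out k).reg N = n ∧
          Agree out m ((m1.setReg out k).setReg 8 (k + 1)) ∧
          SelVal (m.arr st) f (m.arr key) (k + 1) (((m1.setReg out k).setReg 8 (k + 1)).reg out) :=
      fun h => ⟨by simp [h8.symm, h1], by simp [hNo, h2],
        (hA.setReg (.inr rfl) _).setReg (.inl rfl) _, by simpa [h8] using h⟩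
    simp only [Prog.exec, Expr.eval, h1, hA.1]
    split_ifs with c1 c2 c3 c4
    · exact old (hs.succ_of_ne (by omega))
    · exact old (hs.succ_of_ne (by omega))
    · exact new (hs.succ_new (by omega) fun _ => by omega)
    · exact old (hs.succ_old (by omega) (by omega))
    · exact new (hs.succ_new (by omega) fun _ => by omega)
  · exact ⟨⟨rfl, fun y hy hy' => by simp [hy, hy']⟩, .inl ⟨by simp [h8, Expr.eval], by omega⟩⟩
  · simp [hNo, hN]

/-- As long as `cond` is positive and there is an index below `N` with state `f`, run `body` with
the index of least key in register 9. -/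
def forSel (st : ℕ) (f : ℤ) (key N : ℕ) (cond : Expr) (body : Prog) : Prog :=
  .seq (select st f key N 9) <|
  .whilePos (.add (.reg 9) (.const 1)) <|
    .seq body (.ifPos cond (select st f key N 9) (.assign 9 (.const (-1))))

/-- The number of indices below `N` with state `f`. -/
def numState (st : ℤ → ℤ) (f : ℤ) (N : ℕ) : ℕ := ((Finset.range N).filter (fun i : ℕ => st i = f)).card

theorem numState_le (st : ℤ → ℤ) (f : ℤ) (N : ℕ) : numState st f N ≤ N :=
  (Finset.card_filter_le _ _).trans (by simp)

theorem numState_update {st : ℤ → ℤ} {f v : ℤ} {N i : ℕ} (hi : i < N) (hf : st i = f)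
    (hv : v ≠ f) : numState (Function.update st i v) f N + 1 = numState st f N := by
  unfold numState
  have : (Finset.range N).filter (fun j : ℕ => Function.update st i v j = f) =
      ((Finset.range N).filter (fun j : ℕ => st j = f)).erase i := by
    ext j
    by_cases h : j = i
    · subst h; simp [hv]
    · simp [h]
  rw [this, Finset.card_erase_add_one]
  simp [hi, hf]

/-- Each round changes the state of the selected index away from `f`, so `numState` decreases and
there are at most `n` rounds. The hypotheses `hJ` and `hc` say that the invariant and the condition
do not depend on the scratch registers 8 and 9. -/
theorem ens_forSel {st : ℕ} {f : ℤ} {key N : ℕ} {cond : Expr} {body : Prog} (J : Memory → Prop)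
    {n t : ℕ} (hJN : ∀ m, J m → m.reg N = n) (hN8 : N ≠ 8) (hN9 : N ≠ 9)
    (hJ : ∀ m m', Agree 9 m m' → J m → J m')
    (hc : ∀ m m', Agree 9 m m' → cond.eval m' = cond.eval m)
    (hb : ∀ (m : Memory) (i : ℕ), J m → 0 < cond.eval m → m.reg 9 = i →
      IsSel (m.arr st) f (m.arr key) n i →
      Ens body m t (fun m' => J m' ∧ ∃ v, v ≠ f ∧ m'.arr st = Function.update (m.arr st) i v))
    {m : Memory} (hm : J m) (hm0 : 0 < cond.eval m) :
    Ens (forSel st f key N cond body) m (60 * (n + 1) + (n + 1) * (t + cond.cost + 5 + 60 * (n + 1)))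
      (fun m' => J m' ∧ (cond.eval m' ≤ 0 ∨ ∀ j : ℕ, j < n → m'.arr st j ≠ f)) := by
  -- Register 9 is `-1` exactly when the loop is over, and then a reason for stopping is recorded;
  -- otherwise it holds the next selection.
  let J' : Memory → Prop := fun m' => J m' ∧
    ((m'.reg 9 = -1 ∧ (cond.eval m' ≤ 0 ∨ ∀ j : ℕ, j < n → m'.arr st j ≠ f)) ∨
      (0 < cond.eval m' ∧ ∃ i : ℕ, m'.reg 9 = i ∧ IsSel (m'.arr st) f (m'.arr key) n i))
  have sel : ∀ m1, J m1 → 0 < cond.eval m1 →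
      Ens (select st f key N 9) m1 (60 * (n + 1)) (fun m' => J' m' ∧ m'.arr st = m1.arr st) := by
    intro m1 h1 h1c
    refine (ens_select (hJN m1 h1) (by decide) hN8 hN9).mono le_rfl ?_
    rintro m' ⟨hA, hs⟩
    refine ⟨⟨hJ _ _ hA h1, ?_⟩, by rw [hA.1]⟩
    rcases hs with ⟨h2, h3⟩ | ⟨i, h2, h3⟩
    · exact .inl ⟨h2, .inr (by rwa [hA.1])⟩
    · exact .inr ⟨by rwa [hc _ _ hA], i, h2, by rwa [hA.1]⟩
  refine Ens.seq (sel m hm hm0) ?_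
  rintro m1 ⟨hm1, -⟩
  refine (Ens.whilePos (t := t + (cond.cost + 1 + 60 * (n + 1))) J' (fun m' => numState (m'.arr st) f n) ?_ hm1
    (numState_le _ _ _)).mono ?_ ?_
  · rintro m2 ⟨h2, h2'⟩ hpos
    simp only [Expr.eval] at hpos
    rcases h2' with ⟨h3, -⟩ | ⟨h3, i, h4, h5⟩
    · omega
    refine (hb m2 i h2 h3 h4 h5).seq ?_
    rintro m3 ⟨h6, v, h7, h8⟩
    have hlt : numState (m3.arr st) f n < numState (m2.arr st) f n := by
      rw [h8]; have := numState_update h5.1 h5.2.1 h7; omega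
    refine Ens.ifPos (fun h => ?_) (fun h => ?_)
    · exact (sel m3 h6 h).mono le_rfl fun m' hm' => ⟨hm'.1, by rw [hm'.2]; exact hlt⟩
    · refine (Ens.assign ?_).mono (t := 2) (by omega) fun m' hm' => hm'
      have hA : Agree 9 m3 (m3.setReg 9 (Expr.eval m3 (.const (-1)))) :=
        ⟨rfl, fun y hy hy' => by simp [hy']⟩
      exact ⟨⟨hJ _ _ hA h6, .inl ⟨by simp [Expr.eval], .inl (by rwa [hc _ _ hA])⟩⟩, hlt⟩
  · apply le_of_eq; simp only [Expr.cost]; ring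
  · rintro m' ⟨⟨h1, h2⟩, hneg⟩
    simp only [Expr.eval] at hneg
    rcases h2 with ⟨h3, h4⟩ | ⟨h3, i, h4, h5⟩
    · exact ⟨h1, h4⟩
    · omega

end RAM

/-! ### Loads and stacks -/

namespace RSC

variable {n : ℕ} (I : RSC n)

/-- Sensor `s` is live at the integer point `x`. -/
def Live (s : Fin n) (x : ℤ) : Prop := I.left s ≤ x ∧ x < I.right s

instance (s : Fin n) (x : ℤ) : Decidable (I.Live s x) := inferInstanceAs (Decidable (_ ∧ _))

/-- The total duration of the sensors with state `f` that are live at `x`. -/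
def wt (st : ℤ → ℤ) (f x : ℤ) : ℤ := ∑ s : Fin n, if st s = f ∧ I.Live s x then (I.dur s : ℤ) else 0

/-- The total duration of the sensors with state `f`. -/
def tw (st : ℤ → ℤ) (f : ℤ) : ℤ := ∑ s : Fin n, if st s = f then (I.dur s : ℤ) else 0

theorem update_fin (st : ℤ → ℤ) (s : Fin n) (v : ℤ) (s' : Fin n) :
    Function.update st (s : ℤ) v (s' : ℤ) = if s' = s then v else st s' := by
  by_cases h : s' = s
  · subst h; simp
  · have : ((s' : ℕ) : ℤ) ≠ (s : ℕ) := by exact_mod_cast fun h' => h (Fin.ext h')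
    simp [h, Function.update_of_ne this]

theorem sum_update (F : Fin n → ℤ → ℤ) (st : ℤ → ℤ) (s : Fin n) (v : ℤ) :
    ∑ s', F s' (Function.update st (s : ℤ) v s') = ∑ s', F s' (st s') + F s v - F s (st s) := by
  rw [← Finset.add_sum_erase _ _ (Finset.mem_univ s),
    ← Finset.add_sum_erase _ (fun s' : Fin n => F s' (st s')) (Finset.mem_univ s)]
  have : ∑ s' ∈ Finset.univ.erase s, F s' (Function.update st (s : ℤ) v s') =
      ∑ s' ∈ Finset.univ.erase s, F s' (st s') :=
    Finset.sum_congr rfl fun s' hs' => by rw [update_fin, if_neg (Finset.ne_of_mem_erase hs')]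
  rw [this]
  simp
  ring

theorem wt_update (st : ℤ → ℤ) (s : Fin n) (v f x : ℤ) :
    I.wt (Function.update st (s : ℤ) v) f x = I.wt st f x +
      (if v = f ∧ I.Live s x then (I.dur s : ℤ) else 0) -
      (if st s = f ∧ I.Live s x then (I.dur s : ℤ) else 0) :=
  sum_update (fun s' w => if w = f ∧ I.Live s' x then (I.dur s' : ℤ) else 0) st s v

theorem tw_update (st : ℤ → ℤ) (s : Fin n) (v f : ℤ) :
    I.tw (Function.update st (s : ℤ) v) f = I.tw st f +
      (if v = f then (I.dur s : ℤ) else 0) - (if st s = f then (I.dur s : ℤ) else 0) :=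
  sum_update (fun s' w => if w = f then (I.dur s' : ℤ) else 0) st s v

theorem wt_le_tw (st : ℤ → ℤ) (f x : ℤ) : I.wt st f x ≤ I.tw st f := by
  refine Finset.sum_le_sum fun s _ => ?_
  split_ifs with h1 h2 h2
  exacts [le_rfl, absurd h1.1 h2, by positivity, le_rfl]

theorem wt_eq_tw {st : ℤ → ℤ} {f x : ℤ} (h : ∀ s : Fin n, st s = f → I.Live s x) :
    I.wt st f x = I.tw st f := by
  refine Finset.sum_congr rfl fun s _ => ?_
  by_cases hs : st s = f
  · simp [hs, h s hs]
  · simp [hs]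

theorem dur_le_dmax (s : Fin n) : I.dur s ≤ I.dmax := Finset.le_sup (Finset.mem_univ s)

/-- The number of boxes `k < N` with `lo k ≤ x < hi k`. -/
def cnt (lo hi : ℤ → ℤ) (N : ℕ) (x : ℤ) : ℕ :=
  ((Finset.range N).filter fun k : ℕ => lo k ≤ x ∧ x < hi k).card

theorem cnt_succ (lo hi : ℤ → ℤ) (N : ℕ) (x : ℤ) :
    cnt lo hi (N + 1) x = cnt lo hi N x + if lo N ≤ x ∧ x < hi N then 1 else 0 := by
  unfold cnt
  rw [Finset.range_add_one, Finset.filter_insert]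
  split_ifs <;> simp

theorem cnt_congr {lo hi lo' hi' : ℤ → ℤ} {N : ℕ} (h1 : ∀ k : ℕ, k < N → lo' k = lo k)
    (h2 : ∀ k : ℕ, k < N → hi' k = hi k) (x : ℤ) : cnt lo' hi' N x = cnt lo hi N x := by
  unfold cnt
  congr 1
  refine Finset.filter_congr fun k hk => ?_
  rw [h1 k (Finset.mem_range.mp hk), h2 k (Finset.mem_range.mp hk)]

theorem cnt_mono (lo hi : ℤ → ℤ) {N N' : ℕ} (h : N ≤ N') (x : ℤ) : cnt lo hi N x ≤ cnt lo hi N' x :=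
  Finset.card_le_card (Finset.filter_subset_filter _ (Finset.range_subset_range.mpr h))

/-- The box under construction has index `N`, and only closed boxes are counted, so adjusting its
ends does not affect the count. -/
theorem cnt_update (lo hi : ℤ → ℤ) (N : ℕ) (l r x : ℤ) :
    cnt (Function.update lo N l) (Function.update hi N r) N x = cnt lo hi N x :=
  cnt_congr (fun k hk => Function.update_of_ne (by omega) _ _)
    (fun k hk => Function.update_of_ne (by omega) _ _) x

/-- The sensors of box `k` that have been placed cover the box up to height `w`. -/
def Full (st bx off BL BR : ℤ → ℤ) (k : ℕ) (w : ℤ) : Prop :=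
  ∀ x y, BL k ≤ x → x < BR k → 0 ≤ y → y < w →
    ∃ s : Fin n, st s = 3 ∧ bx s = k ∧ off s ≤ y ∧ y < off s + I.dur s ∧ I.Live s x

/-- Boxes `0, …, nb - 1` have been filled up to height `D`, and box `nb` up to height `w`. -/
structure Stacks (D : ℤ) (st bx off BL BR : ℤ → ℤ) (nb : ℕ) (w : ℤ) : Prop where
  full : ∀ k < nb, I.Full st bx off BL BR k D
  left_end : ∀ k < nb, ∃ s, BL k = I.left s
  right_end : ∀ k < nb, ∃ s, BR k = I.right s
  part : I.Full st bx off BL BR nb w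
  left_part : 0 < w → ∃ s, BL nb = I.left s
  right_part : 0 < w → ∃ s, BR nb = I.right s
  used : ∀ k < nb, ∃ s : Fin n, st s = 3 ∧ bx s = k
  used_part : 0 < w → ∃ s : Fin n, st s = 3 ∧ bx s = nb
  off_nonneg : ∀ s : Fin n, 0 ≤ off s
  w_nonneg : 0 ≤ w

variable {I}

theorem Stacks.zero {D w : ℤ} {st bx off BL BR : ℤ → ℤ} {nb : ℕ}
    (h : I.Stacks D st bx off BL BR nb w) : I.Stacks D st bx off BL BR nb 0 where
  full := h.full
  left_end := h.left_end
  right_end := h.right_end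
  part := fun x y _ _ h1 h2 => by omega
  left_part := fun h => by omega
  right_part := fun h => by omega
  used := h.used
  used_part := fun h => by omega
  off_nonneg := h.off_nonneg
  w_nonneg := le_rfl

theorem Stacks.congr_state {D w : ℤ} {st st' bx off BL BR : ℤ → ℤ} {nb : ℕ}
    (h : I.Stacks D st bx off BL BR nb w) (h3 : ∀ s : Fin n, st s = 3 → st' s = 3) :
    I.Stacks D st' bx off BL BR nb w where
  full := fun k hk x y h1 h2 hy h4 =>
    let ⟨s, hs, h⟩ := h.full k hk x y h1 h2 hy h4
    ⟨s, h3 s hs, h⟩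
  left_end := h.left_end
  right_end := h.right_end
  part := fun x y h1 h2 hy h4 =>
    let ⟨s, hs, h⟩ := h.part x y h1 h2 hy h4
    ⟨s, h3 s hs, h⟩
  left_part := h.left_part
  right_part := h.right_part
  used := fun k hk => let ⟨s, hs, h⟩ := h.used k hk; ⟨s, h3 s hs, h⟩
  used_part := fun hw => let ⟨s, hs, h⟩ := h.used_part hw; ⟨s, h3 s hs, h⟩
  off_nonneg := h.off_nonneg
  w_nonneg := h.w_nonneg

/-- The left end of the current box after sensor `s` has been put into it. -/
def newLeft (I : RSC n) (BL : ℤ → ℤ) (nb : ℕ) (w : ℤ) (s : Fin n) : ℤ :=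
  if 0 < w then max (BL nb) (I.left s) else I.left s

/-- The right end of the current box after sensor `s` has been put into it. -/
def newRight (I : RSC n) (BR : ℤ → ℤ) (nb : ℕ) (w : ℤ) (s : Fin n) : ℤ :=
  if 0 < w then min (BR nb) (I.right s) else I.right s

/-- The current box shrinks to its intersection with the new sensor, which covers the heights from
`w` to `w + dur`. Durations are positive, so `w = 0` signals an empty box, whose ends are then set
rather than intersected. -/
theorem Stacks.push {D w : ℤ} {st bx off BL BR : ℤ → ℤ} {nb : ℕ}
    (h : I.Stacks D st bx off BL BR nb w) {s : Fin n} (hs : st s ≠ 3) :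
    I.Stacks D (Function.update st s 3) (Function.update bx s nb) (Function.update off s w)
      (Function.update BL nb (I.newLeft BL nb w s)) (Function.update BR nb (I.newRight BR nb w s))
      nb (w + I.dur s) := by
  have hw := h.w_nonneg
  have hle : ∃ s', I.newLeft BL nb w s = I.left s' := by
    unfold newLeft
    split_ifs with h0
    · rcases max_choice (BL nb) (I.left s) with h1 | h1
      · rw [h1]; exact h.left_part h0
      · exact ⟨s, h1⟩
    · exact ⟨s, rfl⟩
  have hre : ∃ s', I.newRight BR nb w s = I.right s' := by
    unfold newRight
    split_ifs with h0
    · rcases min_choice (BR nb) (I.right s) with h1 | h1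
      · rw [h1]; exact h.right_part h0
      · exact ⟨s, h1⟩
    · exact ⟨s, rfl⟩
  have ne : ∀ k < nb, ((k : ℕ) : ℤ) ≠ (nb : ℤ) := fun k hk => by omega
  have old : ∀ s' : Fin n, st s' = 3 → s' ≠ s := fun s' h' he => hs (he ▸ h')
  constructor
  · intro k hk x y h1 h2 hy h4
    rw [Function.update_of_ne (ne k hk)] at h1 h2
    obtain ⟨s', a, b, c, d, e⟩ := h.full k hk x y h1 h2 hy h4
    exact ⟨s', by simp [update_fin, a], by simp [update_fin, old s' a, b],
      by simp [update_fin, old s' a, c], by simp [update_fin, old s' a, d], e⟩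
  · intro k hk; rw [Function.update_of_ne (ne k hk)]; exact h.left_end k hk
  · intro k hk; rw [Function.update_of_ne (ne k hk)]; exact h.right_end k hk
  · intro x y h1 h2 hy h4
    rw [Function.update_self] at h1 h2
    rcases lt_or_ge y w with hyw | hyw
    · have h0 : 0 < w := by omega
      rw [newLeft, if_pos h0] at h1
      rw [newRight, if_pos h0] at h2
      obtain ⟨s', a, b, c, d, e⟩ := h.part x y (le_of_max_le_left h1) (lt_of_lt_of_le h2 (min_le_left _ _)) hy hyw
      exact ⟨s', by simp [update_fin, a], by simp [update_fin, old s' a, b],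
        by simp [update_fin, old s' a, c], by simp [update_fin, old s' a, d], e⟩
    · refine ⟨s, by simp, by simp, by simpa using hyw, by simpa using h4, ?_, ?_⟩
      · refine le_trans ?_ h1
        unfold newLeft; split_ifs; exacts [le_max_right _ _, le_rfl]
      · refine lt_of_lt_of_le h2 ?_
        unfold newRight; split_ifs; exacts [min_le_right _ _, le_rfl]
  · intro _; rw [Function.update_self]; exact hle
  · intro _; rw [Function.update_self]; exact hre
  · intro k hk
    obtain ⟨s', a, b⟩ := h.used k hk
    exact ⟨s', by simp [update_fin, a], by simp [update_fin, old s' a, b]⟩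
  · exact fun _ => ⟨s, by simp, by simp⟩
  · intro s'
    rw [update_fin]; split_ifs; exacts [hw, h.off_nonneg s']
  · positivity

theorem Stacks.close {D w : ℤ} {st bx off BL BR : ℤ → ℤ} {nb : ℕ}
    (h : I.Stacks D st bx off BL BR nb w) (hw : D ≤ w) (hD : 0 < D) :
    I.Stacks D st bx off BL BR (nb + 1) 0 where
  full := by
    intro k hk
    rcases Nat.lt_succ_iff_lt_or_eq.mp hk with hk | rfl
    · exact h.full k hk
    · exact fun x y h1 h2 hy h4 => h.part x y h1 h2 hy (by omega)
  left_end := by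
    intro k hk
    rcases Nat.lt_succ_iff_lt_or_eq.mp hk with hk | rfl
    exacts [h.left_end k hk, h.left_part (by omega)]
  right_end := by
    intro k hk
    rcases Nat.lt_succ_iff_lt_or_eq.mp hk with hk | rfl
    exacts [h.right_end k hk, h.right_part (by omega)]
  part := fun x y _ _ h1 h2 => by omega
  left_part := fun h => by omega
  right_part := fun h => by omega
  used := by
    intro k hk
    rcases Nat.lt_succ_iff_lt_or_eq.mp hk with hk | rfl
    exacts [h.used k hk, h.used_part (by omega)]
  used_part := fun h => by omega
  off_nonneg := h.off_nonneg
  w_nonneg := le_rfl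

/-- Every closed box owns a sensor, and a sensor stores only one box number. -/
theorem Stacks.nb_le {D w : ℤ} {st bx off BL BR : ℤ → ℤ} {nb : ℕ}
    (h : I.Stacks D st bx off BL BR nb w) : nb ≤ n := by
  choose f hf using fun k : Fin nb => h.used k k.2
  have : Function.Injective f := fun i j hij => by
    have := (hf i).2
    rw [hij, (hf j).2] at this
    exact Fin.ext (by exact_mod_cast this.symm)
  simpa using Fintype.card_le_of_injective f this

/-- While the sensors that have state `2` in `st₀` are put into boxes, the boxes that contain `x`
account for the sensors that are live at `x`. -/
def ChunkAt (I : RSC n) (D : ℤ) (st₀ st BL BR : ℤ → ℤ) (nb : ℕ) (w : ℤ) (c₀ : ℕ) (x : ℤ) : Prop :=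
  ((∀ s : Fin n, st₀ s = 2 → st s = 3 → I.Live s x) ∧ (0 < w → BL nb ≤ x ∧ x < BR nb) ∧
      I.wt st 3 x - I.wt st₀ 3 x ≤ (D + I.dmax) * (cnt BL BR nb x - c₀) + w) ∨
    ((∀ s : Fin n, st s = 2 → ¬ I.Live s x) ∧
      I.wt st 3 x - I.wt st₀ 3 x ≤ (D + I.dmax) * (cnt BL BR nb x - c₀) + (D + I.dmax))

theorem ChunkAt.init (D : ℤ) (st BL BR : ℤ → ℤ) (nb : ℕ) (x : ℤ) :
    I.ChunkAt D st st BL BR nb 0 (cnt BL BR nb x) x :=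
  .inl ⟨fun s h h' => by omega, fun h => by omega, by simp⟩

theorem ChunkAt.final {D : ℤ} {st₀ st BL BR : ℤ → ℤ} {nb : ℕ} {w : ℤ} {c₀ : ℕ} {x : ℤ}
    (h : I.ChunkAt D st₀ st BL BR nb w c₀ x) (hw : w ≤ D) :
    I.wt st 3 x - I.wt st₀ 3 x ≤ (D + I.dmax) * (cnt BL BR nb x - c₀) + (D + I.dmax) := by
  rcases h with ⟨-, -, h⟩ | ⟨-, h⟩
  · have : (0 : ℤ) ≤ I.dmax := by positivity
    linarith
  · exact h

/-- `key` orders the sensors of state `2` such that those live at `x` come first. -/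
def LiveFirst (I : RSC n) (st key : ℤ → ℤ) (x : ℤ) : Prop :=
  ∀ s s' : Fin n, st s = 2 → st s' = 2 → key s ≤ key s' → I.Live s' x → I.Live s x

/-- Live sensors come first. As long as only live ones have been placed, the current box contains
`x` and nothing is lost; a box closes with height at most `D + d`, because it was below `D` before
its last sensor. From the first sensor that is not live at `x` on, no live one follows, and the box
then open is the only loss. -/
theorem ChunkAt.push {D : ℤ} {st₀ st BL BR : ℤ → ℤ} {nb : ℕ} {w : ℤ} {c₀ : ℕ} {x : ℤ}
    (h : I.ChunkAt D st₀ st BL BR nb w c₀ x) (hw0 : 0 ≤ w) (hwD : w < D) {key : ℤ → ℤ}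
    (hx : I.LiveFirst st₀ key x) (hst : ∀ s : Fin n, st s = 2 → st₀ s = 2) {s : Fin n}
    (hs : st s = 2) (hmin : ∀ s' : Fin n, st s' = 2 → key s ≤ key s') {w' : ℤ} {nb' : ℕ}
    (hw' : (w' = w + I.dur s ∧ nb' = nb) ∨ (D ≤ w + I.dur s ∧ w' = 0 ∧ nb' = nb + 1)) :
    I.ChunkAt D st₀ (Function.update st s 3) (Function.update BL nb (I.newLeft BL nb w s))
      (Function.update BR nb (I.newRight BR nb w s)) nb' w' c₀ x := by
  have hd : (I.dur s : ℤ) ≤ I.dmax := by exact_mod_cast I.dur_le_dmax s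
  have hwt : I.wt (Function.update st s 3) 3 x = I.wt st 3 x + if I.Live s x then (I.dur s : ℤ) else 0 := by
    rw [wt_update]; simp [hs]
  have hcnt : (cnt BL BR nb x : ℤ) ≤ cnt (Function.update BL nb (I.newLeft BL nb w s))
      (Function.update BR nb (I.newRight BR nb w s)) nb' x := by
    rw [← cnt_update BL BR nb (I.newLeft BL nb w s) (I.newRight BR nb w s) x]
    exact_mod_cast cnt_mono _ _ (by omega) x
  have hstep : ∀ s' : Fin n, Function.update st s 3 (s' : ℤ) = 2 → st s' = 2 := by
    intro s' h'
    rw [update_fin] at h'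
    split_ifs at h' with e
    · omega
    · exact h'
  have hdead : ¬ I.Live s x → ∀ s' : Fin n, Function.update st s 3 (s' : ℤ) = 2 → ¬ I.Live s' x :=
    fun hn s' h' hl => hn (hx s s' (hst s hs) (hst s' (hstep s' h')) (hmin s' (hstep s' h')) hl)
  have hmul := mul_le_mul_of_nonneg_left hcnt (show 0 ≤ D + I.dmax by linarith [Int.natCast_nonneg I.dmax])
  rcases h with ⟨h1, h2, h3⟩ | ⟨h1, h2⟩
  -- So far only live sensors have been placed; the new sensor either continues this phase or ends
  -- it.
  · by_cases hl : I.Live s x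
    · have hin : I.newLeft BL nb w s ≤ x ∧ x < I.newRight BR nb w s := by
        unfold newLeft newRight
        split_ifs with h0
        · exact ⟨max_le (h2 h0).1 hl.1, lt_min (h2 h0).2 hl.2⟩
        · exact hl
      refine .inl ⟨fun s' ha hb => ?_, fun h0 => ?_, ?_⟩
      · rw [update_fin] at hb
        split_ifs at hb with e
        · exact e ▸ hl
        · exact h1 s' ha hb
      · rcases hw' with ⟨rfl, rfl⟩ | ⟨-, rfl, -⟩
        · simpa using hin
        · omega
      · rw [hwt, if_pos hl]
        rcases hw' with ⟨rfl, rfl⟩ | ⟨h5, rfl, rfl⟩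
        · rw [cnt_update]; linarith
        · rw [cnt_succ, cnt_update, if_pos (by simpa using hin)]
          push_cast
          linarith
    · refine .inr ⟨hdead hl, ?_⟩
      rw [hwt, if_neg hl]
      linarith
  · have hl : ¬ I.Live s x := h1 s hs
    refine .inr ⟨fun s' h' => h1 s' (hstep s' h'), ?_⟩
    rw [hwt, if_neg hl]
    linarith

end RSC

/-! ### Taking sensors and putting them into boxes -/

namespace RAM

/-- The memory `m'` differs from `m` at most in the registers `rs` and the arrays `as`. -/
def Same (rs as : List ℕ) (m m' : Memory) : Prop :=
  (∀ y, y ∉ rs → m'.reg y = m.reg y) ∧ ∀ A, A ∉ as → m'.arr A = m.arr A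

theorem Same.refl (rs as : List ℕ) (m : Memory) : Same rs as m m :=
  ⟨fun _ _ => rfl, fun _ _ => rfl⟩

theorem Same.trans {rs as : List ℕ} {m m' m'' : Memory} (h : Same rs as m m')
    (h' : Same rs as m' m'') : Same rs as m m'' :=
  ⟨fun y hy => (h'.1 y hy).trans (h.1 y hy), fun A hA => (h'.2 A hA).trans (h.2 A hA)⟩

theorem Same.mono {rs as rs' as' : List ℕ} {m m' : Memory} (h : Same rs as m m')
    (h1 : rs ⊆ rs') (h2 : as ⊆ as') : Same rs' as' m m' :=
  ⟨fun y hy => h.1 y fun h => hy (h1 h), fun A hA => h.2 A fun h => hA (h2 h)⟩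

theorem Same.setReg {rs as : List ℕ} {m m' : Memory} (h : Same rs as m m') {x : ℕ} (hx : x ∈ rs)
    (v : ℤ) : Same rs as m (m'.setReg x v) :=
  ⟨fun y hy => by rw [Memory.setReg_reg, if_neg (by rintro rfl; exact hy hx), h.1 y hy], h.2⟩

theorem Same.setArr {rs as : List ℕ} {m m' : Memory} (h : Same rs as m m') {A : ℕ} (hA : A ∈ as)
    (i v : ℤ) : Same rs as m (m'.setArr A i v) :=
  ⟨h.1, fun B hB => by rw [Memory.setArr_arr, if_neg (by rintro rfl; exact hB hA), h.2 B hB]⟩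

theorem Agree.same {out : ℕ} {m m' : Memory} (h : Agree out m m') {rs as : List ℕ}
    (h8 : 8 ∈ rs) (ho : out ∈ rs) : Same rs as m m' :=
  ⟨fun y hy => h.2 y (by rintro rfl; exact hy h8) (by rintro rfl; exact hy ho),
    fun A _ => by rw [h.1]⟩

theorem Memory.setArr_self (m : Memory) (A : ℕ) (i : ℤ) : m.setArr A i (m.arr A i) = m := by
  simp [Memory.setArr]

end RAM

open RAM in
/-- The part of the memory that does not change while the boxes are built: the instance, and the
numbers `d = dmax`, `q`, `D = q d`, `S = q D`. -/
structure RSC.Base {n : ℕ} (I : RSC n) (q : ℕ) (m : Memory) : Prop where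
  n_eq : m.reg 0 = n
  d_eq : m.reg 3 = I.dmax
  q_eq : m.reg 4 = q
  D_eq : m.reg 5 = q * I.dmax
  S_eq : m.reg 6 = q * (q * I.dmax)
  left_eq : ∀ s : Fin n, m.arr 0 s = I.left s
  right_eq : ∀ s : Fin n, m.arr 1 s = I.right s
  dur_eq : ∀ s : Fin n, m.arr 2 s = I.dur s
  negRight_eq : ∀ s : Fin n, m.arr 4 s = -I.right s
  three_le : 3 ≤ q
  d_pos : 0 < I.dmax

namespace RSC

open RAM

variable {n : ℕ} {I : RSC n}

theorem Base.same {q : ℕ} {m m' : Memory} (h : I.Base q m) {rs as : List ℕ} (hs : Same rs as m m')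
    (h1 : ∀ y ∈ [0, 3, 4, 5, 6], y ∉ rs) (h2 : ∀ A ∈ [0, 1, 2, 4], A ∉ as) : I.Base q m' where
  n_eq := (hs.1 0 (h1 0 (by decide))).trans h.n_eq
  d_eq := (hs.1 3 (h1 3 (by decide))).trans h.d_eq
  q_eq := (hs.1 4 (h1 4 (by decide))).trans h.q_eq
  D_eq := (hs.1 5 (h1 5 (by decide))).trans h.D_eq
  S_eq := (hs.1 6 (h1 6 (by decide))).trans h.S_eq
  left_eq := fun s => by rw [hs.2 0 (h2 0 (by decide))]; exact h.left_eq s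
  right_eq := fun s => by rw [hs.2 1 (h2 1 (by decide))]; exact h.right_eq s
  dur_eq := fun s => by rw [hs.2 2 (h2 2 (by decide))]; exact h.dur_eq s
  negRight_eq := fun s => by rw [hs.2 4 (h2 4 (by decide))]; exact h.negRight_eq s
  three_le := h.three_le
  d_pos := h.d_pos

/-- Move sensors from state `1` to state `2`, in the order of `key`, until their total duration is
at least `S`. -/
def take (key : ℕ) : Prog :=
  .seq (.assign 13 (.const 0)) <|
  forSel 6 1 key 0 (.sub (.reg 6) (.reg 13)) <|
    .seq (.store 6 (.reg 9) (.const 2)) (.assign 13 (.add (.reg 13) (.get 2 (.reg 9))))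

/-- The states after some sensors have been moved from state `1` to state `2`. -/
structure Taking (I : RSC n) (S : ℤ) (key st st' : ℤ → ℤ) : Prop where
  other : ∀ s : Fin n, st s ≠ 1 → st' s = st s
  one : ∀ s : Fin n, st s = 1 → st' s = 1 ∨ st' s = 2
  first : ∀ s s' : Fin n, st' s = 2 → st' s' = 1 → key s ≤ key s'
  tw_le : I.tw st' 2 ≤ S + I.dmax

/-- The states after enough sensors have been moved from state `1` to state `2`. -/
structure Taken (I : RSC n) (S : ℤ) (key st st' : ℤ → ℤ) : Prop extends Taking I S key st st' where
  enough : S ≤ I.tw st' 2 ∨ ∀ s : Fin n, st' s ≠ 1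

theorem Base.q_pos {q : ℕ} {m : Memory} (h : I.Base q m) : 0 < q := by
  have := h.three_le; omega

theorem Base.S_pos {q : ℕ} {m : Memory} (h : I.Base q m) : (0 : ℤ) < q * (q * I.dmax) := by
  have := h.q_pos; have := h.d_pos; positivity

theorem Base.D_pos {q : ℕ} {m : Memory} (h : I.Base q m) : (0 : ℤ) < q * I.dmax := by
  have := h.q_pos; have := h.d_pos; positivity

/-- The loop stops once the total reaches `S`, and the last sensor overshoots by at most `dmax`. -/
theorem ens_take {q : ℕ} {m : Memory} {key : ℕ} (hk : key ≠ 6) (hB : I.Base q m)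
    (h2 : ∀ s : Fin n, m.arr 6 s ≠ 2) : Ens (take key) m (200 * (n + 1) ^ 2) (fun m' =>
      Same [8, 9, 13] [6] m m' ∧
        I.Taken (q * (q * I.dmax)) (m.arr key) (m.arr 6) (m'.arr 6)) := by
  refine (Ens.seq (Ens.assign (x := 13) (e := .const 0) rfl) (Q := fun m' =>
      Same [8, 9, 13] [6] m m' ∧
        I.Taken (q * (q * I.dmax)) (m.arr key) (m.arr 6) (m'.arr 6)) ?_).mono
    (t := 2 + (60 * (n + 1) + (n + 1) * (10 + 3 + 5 + 60 * (n + 1))))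
    (by nlinarith) fun m' hm' => hm'
  rintro m1 rfl
  refine (ens_forSel (t := 10) (n := n) (fun m' => Same [8, 9, 13] [6] m m' ∧
    I.Taking (q * (q * I.dmax)) (m.arr key) (m.arr 6) (m'.arr 6) ∧
      m'.reg 13 = I.tw (m'.arr 6) 2) ?_ (by decide) (by decide) ?_ ?_ ?_ ?_ ?_).mono le_rfl ?_
  · rintro m' ⟨h, -⟩
    rw [h.1 0 (by decide), hB.n_eq]
  · rintro m1 m2 hA ⟨h1, h3, h4⟩
    refine ⟨h1.trans (hA.same (by decide) (by decide)), ?_, ?_⟩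
    · rwa [hA.1]
    · rw [hA.1, hA.2 13 (by decide) (by decide), h4]
  · rintro m1 m2 hA
    simp only [Expr.eval]
    rw [hA.2 6 (by decide) (by decide), hA.2 13 (by decide) (by decide)]
  · rintro m1 i ⟨h1, h3, h4⟩ hpos hi ⟨hin, hi1, himin⟩
    obtain ⟨s, rfl⟩ : ∃ s : Fin n, (s : ℕ) = i := ⟨⟨i, hin⟩, rfl⟩
    have hB1 : I.Base q m1 := hB.same h1 (by decide) (by decide)
    refine Prog.LoopFree.ens (by simp [Prog.LoopFree]) (by simp [Prog.cost, Expr.cost]) ?_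
    have hd : (I.dur s : ℤ) ≤ I.dmax := by exact_mod_cast I.dur_le_dmax s
    simp only [Expr.eval, hB1.S_eq, h4] at hpos
    have htw : I.tw (Function.update (m1.arr 6) s 2) 2 = I.tw (m1.arr 6) 2 + I.dur s := by
      rw [tw_update]; simp [hi1]
    simp only [Prog.exec, Expr.eval, hi]
    refine ⟨⟨(h1.setArr (by decide) _ _).setReg (by decide) _, ?_, ?_⟩, 2, by decide, by simp⟩
    · simp only [Memory.setReg_arr, Memory.setArr_arr, if_true]
      refine ⟨fun s' h' => ?_, fun s' h' => ?_, fun s' s'' h' h'' => ?_, ?_⟩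
      · rw [update_fin, if_neg, h3.other s' h']
        rintro rfl
        exact absurd hi1 (by rw [h3.other _ h']; exact h')
      · rw [update_fin]
        split_ifs
        exacts [.inr rfl, h3.one s' h']
      · rw [update_fin] at h' h''
        split_ifs at h' h'' with e1 e2
        · omega
        · have := himin s'' s''.2 h''
          rw [e1]
          rwa [h1.2 key (by simpa using hk)] at this
        · omega
        · exact h3.first s' s'' h' h''
      · rw [htw]; linarith
    · simp [h4, htw, hi, hB1.dur_eq]
  · refine ⟨(Same.refl _ _ _).setReg (by decide) _, ?_, ?_⟩
    · refine ⟨fun _ _ => rfl, fun s h => .inl h, fun s s' h => absurd h (h2 s), ?_⟩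
      have : I.tw (m.arr 6) 2 = 0 := Finset.sum_eq_zero fun s _ => if_neg (h2 s)
      simp only [Memory.setReg_arr, this]
      positivity
    · have : I.tw (m.arr 6) 2 = 0 := Finset.sum_eq_zero fun s _ => if_neg (h2 s)
      simp [this, Expr.eval]
  · simpa [Expr.eval, hB.S_eq] using hB.S_pos
  · rintro m' ⟨⟨h1, h3, h4⟩, h5⟩
    have hB1 : I.Base q m' := hB.same h1 (by decide) (by decide)
    refine ⟨h1, h3, h5.imp (fun h => ?_) fun h s => h s s.2⟩
    simp only [Expr.eval, hB1.S_eq, h4] at h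
    linarith

/-- Adjust the ends of the current box to sensor number `reg 9`. -/
def boxEnds : Prog :=
  .ifPos (.reg 13)
    (.seq
      (.ifPos (.sub (.get 0 (.reg 9)) (.get 9 (.reg 14)))
        (.store 9 (.reg 14) (.get 0 (.reg 9))) .skip)
      (.ifPos (.sub (.get 10 (.reg 14)) (.get 1 (.reg 9)))
        (.store 10 (.reg 14) (.get 1 (.reg 9))) .skip))
    (.seq (.store 9 (.reg 14) (.get 0 (.reg 9))) (.store 10 (.reg 14) (.get 1 (.reg 9))))

/-- Writing an end only when it changes has the same effect as always writing the maximum or the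
minimum. -/
theorem exec_boxEnds {m : Memory} {nb : ℕ} {s : Fin n} (h0 : m.arr 0 s = I.left s)
    (h1 : m.arr 1 s = I.right s) (hnb : m.reg 14 = nb) (hs : m.reg 9 = (s : ℕ)) :
    boxEnds.exec m = (m.setArr 9 nb (I.newLeft (m.arr 9) nb (m.reg 13) s)).setArr 10 nb
      (I.newRight (m.arr 10) nb (m.reg 13) s) := by
  have e10 : ∀ v, (m.setArr 9 nb v).setArr 10 nb (m.arr 10 nb) = m.setArr 9 nb v := fun v => by
    conv_rhs => rw [← Memory.setArr_self (m.setArr 9 nb v) 10 nb]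
    simp
  simp only [boxEnds, Prog.exec, Expr.eval, hnb, hs, h0, newLeft, newRight]
  split_ifs with c1 c2 c3 c3 <;> simp [hnb, hs, h0, h1] at *
  · rw [max_eq_right c2.le, min_eq_right c3.le]
  · rw [max_eq_right c2.le, min_eq_left c3, e10]
  · rw [max_eq_left c2, min_eq_right c3.le, Memory.setArr_self]
  · rw [max_eq_left c2, min_eq_left c3, e10, Memory.setArr_self]

/-- Put the sensors with state `2` into boxes, in the order of `key`. -/
def chunk (key : ℕ) : Prog :=
  .seq (.assign 13 (.const 0)) <|
  forSel 6 2 key 0 (.const 1) <|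
    .seq boxEnds <| .seq (.store 7 (.reg 9) (.reg 14)) <| .seq (.store 8 (.reg 9) (.reg 13)) <|
    .seq (.store 6 (.reg 9) (.const 3)) <| .seq (.assign 13 (.add (.reg 13) (.get 2 (.reg 9)))) <|
    .ifPos (.sub (.reg 5) (.reg 13)) .skip <|
      .seq (.assign 14 (.add (.reg 14) (.const 1))) (.assign 13 (.const 0))

/-- The stacks that a memory describes. -/
def MStacks (I : RSC n) (q : ℕ) (m : Memory) (nb : ℕ) (w : ℤ) : Prop :=
  m.reg 14 = nb ∧
    I.Stacks (q * I.dmax) (m.arr 6) (m.arr 7) (m.arr 8) (m.arr 9) (m.arr 10) nb w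

/-- The number of boxes at `x` in a memory with `nb` boxes. -/
def boxes (m : Memory) (nb : ℕ) (x : ℤ) : ℕ := cnt (m.arr 9) (m.arr 10) nb x

/-- The loss of one box at `x` is claimed only for those `x` at which the stacking order puts live
sensors first. -/
theorem ens_chunk {q : ℕ} {m : Memory} {key nb : ℕ} (hk : key ∈ [0, 4]) (hB : I.Base q m)
    (hS : I.MStacks q m nb 0) : Ens (chunk key) m (200 * (n + 1) ^ 2) (fun m' =>
      Same [8, 9, 13, 14] [6, 7, 8, 9, 10] m m' ∧
      (∀ s : Fin n, m.arr 6 s ≠ 2 → m'.arr 6 s = m.arr 6 s) ∧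
      (∀ s : Fin n, m.arr 6 s = 2 → m'.arr 6 s = 3) ∧
      ∃ nb', I.MStacks q m' nb' 0 ∧ (∀ x, boxes m nb x ≤ boxes m' nb' x) ∧
        ∀ x, I.LiveFirst (m.arr 6) (m.arr key) x →
          I.wt (m'.arr 6) 3 x - I.wt (m.arr 6) 3 x ≤
            (q * I.dmax + I.dmax) * (boxes m' nb' x - boxes m nb x) + (q * I.dmax + I.dmax)) := by
  have hk' : key ∉ [6, 7, 8, 9, 10] := by
    simp only [List.mem_cons, List.not_mem_nil, or_false] at hk ⊢
    omega
  refine (Ens.seq (Ens.assign (x := 13) (e := .const 0) rfl)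
    (t₂ := 60 * (n + 1) + (n + 1) * (61 + 1 + 5 + 60 * (n + 1))) (Q := _) ?_).mono
    (by simp [Expr.cost]; nlinarith) fun m' hm' => hm'
  rintro m1 rfl
  refine (ens_forSel (t := 61) (n := n) (fun m' => Same [8, 9, 13, 14] [6, 7, 8, 9, 10] m m' ∧
    (∀ s : Fin n, m.arr 6 s ≠ 2 → m'.arr 6 s = m.arr 6 s) ∧
    (∀ s : Fin n, m.arr 6 s = 2 → m'.arr 6 s = 2 ∨ m'.arr 6 s = 3) ∧
    ∃ nb', I.MStacks q m' nb' (m'.reg 13) ∧ m'.reg 13 < q * I.dmax ∧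
      (∀ x, boxes m nb x ≤ boxes m' nb' x) ∧
      ∀ x, I.LiveFirst (m.arr 6) (m.arr key) x → I.ChunkAt (q * I.dmax) (m.arr 6) (m'.arr 6)
        (m'.arr 9) (m'.arr 10) nb' (m'.reg 13) (boxes m nb x) x)
    ?_ (by decide) (by decide) ?_ ?_ ?_ ?_ (by simp [Expr.eval])).mono le_rfl ?_
  · rintro m' ⟨h, -⟩
    rw [h.1 0 (by decide), hB.n_eq]
  · rintro m1 m2 hA ⟨h1, h3, h4, nb', h5, h6, h7, h8⟩
    have e13 := hA.2 13 (by decide) (by decide)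
    have e14 := hA.2 14 (by decide) (by decide)
    refine ⟨h1.trans (hA.same (by decide) (by decide)), by rwa [hA.1], by rwa [hA.1], nb', ?_,
      by rwa [e13], ?_, ?_⟩
    · unfold MStacks; rwa [e13, e14, hA.1]
    · unfold boxes; rwa [hA.1]
    · rwa [e13, hA.1]
  · rintro m1 m2 hA; rfl
  · rintro m1 i ⟨h1, h3, h4, nb', ⟨h5, h6⟩, h7, h8, h9⟩ - hi ⟨hin, hi1, himin⟩
    obtain ⟨s, rfl⟩ : ∃ s : Fin n, (s : ℕ) = i := ⟨⟨i, hin⟩, rfl⟩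
    have hB1 : I.Base q m1 := hB.same h1 (by decide) (by decide)
    refine Prog.LoopFree.ens (by simp [Prog.LoopFree, boxEnds])
      (by simp [Prog.cost, Expr.cost, boxEnds]) ?_
    simp only [Prog.exec, exec_boxEnds (hB1.left_eq s) (hB1.right_eq s) h5 hi]
    have hst2 : ∀ s : Fin n, m1.arr 6 s = 2 → m.arr 6 s = 2 := fun s' h' => by
      by_contra hne
      exact hne ((h3 s' hne).symm.trans h')
    have hkey : m1.arr key = m.arr key := h1.2 key hk'
    have hmin : ∀ s' : Fin n, m1.arr 6 s' = 2 → m.arr key s ≤ m.arr key s' := fun s' h' => by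
      rw [← hkey]; exact himin s' s'.2 h'
    have push := h6.push (s := s) (by omega)
    set w := m1.reg 13 with hw
    set m2 := (((((m1.setArr 9 nb' (I.newLeft (m1.arr 9) nb' w s)).setArr 10 nb'
      (I.newRight (m1.arr 10) nb' w s)).setArr 7 s nb').setArr 8 s w).setArr 6 s 3) with hm2
    have hSame : Same [8, 9, 13, 14] [6, 7, 8, 9, 10] m m2 := by
      refine (((((h1.setArr ?_ _ _).setArr ?_ _ _).setArr ?_ _ _).setArr ?_ _ _).setArr ?_ _ _) <;>
        decide
    have a6 : m2.arr 6 = Function.update (m1.arr 6) s 3 := by simp [hm2]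
    have a7 : m2.arr 7 = Function.update (m1.arr 7) s nb' := by simp [hm2]
    have a8 : m2.arr 8 = Function.update (m1.arr 8) s w := by simp [hm2]
    have a9 : m2.arr 9 = Function.update (m1.arr 9) nb' (I.newLeft (m1.arr 9) nb' w s) := by
      simp [hm2]
    have a10 : m2.arr 10 = Function.update (m1.arr 10) nb' (I.newRight (m1.arr 10) nb' w s) := by
      simp [hm2]
    -- The two outcomes of the closing test have the same arrays and differ only in the height and
    -- the number of the current box, so both are treated at once.
    have key1 : ∀ (m3 : Memory) (nb3 : ℕ), m3.arr = m2.arr →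
        Same [8, 9, 13, 14] [6, 7, 8, 9, 10] m2 m3 → m3.reg 14 = nb3 → 
        (m3.reg 13 = w + I.dur s ∧ nb3 = nb' ∧ w + I.dur s < q * I.dmax ∨
          (q * I.dmax : ℤ) ≤ w + I.dur s ∧ m3.reg 13 = 0 ∧ nb3 = nb' + 1) →
        (Same [8, 9, 13, 14] [6, 7, 8, 9, 10] m m3 ∧
          (∀ s : Fin n, m.arr 6 s ≠ 2 → m3.arr 6 s = m.arr 6 s) ∧
          (∀ s : Fin n, m.arr 6 s = 2 → m3.arr 6 s = 2 ∨ m3.arr 6 s = 3) ∧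
          ∃ nb', I.MStacks q m3 nb' (m3.reg 13) ∧ m3.reg 13 < q * I.dmax ∧
            (∀ x, boxes m nb x ≤ boxes m3 nb' x) ∧
            ∀ x, I.LiveFirst (m.arr 6) (m.arr key) x → I.ChunkAt (q * I.dmax) (m.arr 6) (m3.arr 6)
              (m3.arr 9) (m3.arr 10) nb' (m3.reg 13) (boxes m nb x) x) ∧
        ∃ v, v ≠ 2 ∧ m3.arr 6 = Function.update (m1.arr 6) s v := by
      intro m3 nb3 harr hS3 hr14 hr13
      refine ⟨⟨hSame.trans hS3, ?_, ?_, nb3, ⟨hr14, ?_⟩, ?_, ?_, ?_⟩, 3, by decide, by rw [harr, a6]⟩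
      · intro s' h'
        rw [harr, a6, update_fin, if_neg, h3 s' h']
        rintro rfl
        exact h' (hst2 _ hi1)
      · intro s' h'
        rw [harr, a6, update_fin]
        split_ifs
        exacts [.inr rfl, h4 s' h']
      · rw [harr, a6, a7, a8, a9, a10]
        rcases hr13 with ⟨ha, rfl, hb⟩ | ⟨ha, hb, rfl⟩
        · rw [ha]; exact push
        · rw [hb]; exact push.close ha hB.D_pos
      · rcases hr13 with ⟨ha, rfl, hb⟩ | ⟨ha, hb, rfl⟩
        · rw [ha]; exact hb
        · rw [hb]; exact hB.D_pos
      · intro x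
        refine (h8 x).trans ?_
        unfold boxes
        rw [harr, a9, a10, ← cnt_update (m1.arr 9) (m1.arr 10) nb' _ _ x]
        exact cnt_mono _ _ (by omega) x
      · intro x hx
        rw [harr, a6, a9, a10]
        exact (h9 x hx).push h6.w_nonneg h7 hx hst2 hi1 hmin (by tauto)
    have r14 : m2.reg 14 = nb' := by simp [hm2, h5]
    simp only [Expr.eval, Memory.setArr_reg, h5, hi, ← hw]
    rw [← hm2]
    have e2 : m2.arr 2 s = I.dur s := by simp [hm2, hB1.dur_eq]
    have er : m2.reg = m1.reg := by simp [hm2]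
    simp only [e2]
    have e5 : (m2.setReg 13 (w + I.dur s)).reg 5 = q * I.dmax := by simp [er, hB1.D_eq]
    have e13 : (m2.setReg 13 (w + I.dur s)).reg 13 = w + I.dur s := by simp
    rw [e5, e13]
    split_ifs with c
    · exact key1 _ nb' rfl ((Same.refl _ _ _).setReg (by decide) _) (by simp [r14])
        (.inl ⟨by simp, rfl, by omega⟩)
    · refine key1 _ (nb' + 1) rfl ((((Same.refl _ _ _).setReg (by decide) _).setReg
        (by decide) _).setReg (by decide) _) (by simp [r14]) (.inr ⟨by omega, by simp, rfl⟩)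
  · refine ⟨(Same.refl _ _ _).setReg (by decide) _, fun _ _ => rfl, fun s h => .inl h, nb,
      ⟨by simpa using hS.1, by simpa [Expr.eval] using hS.2⟩, by simpa [Expr.eval] using hB.D_pos,
      fun x => le_rfl, fun x hx => ?_⟩
    simp only [Expr.eval, Memory.setReg_arr, Memory.setReg_reg, if_true]
    exact ChunkAt.init _ _ _ _ _ _
  · rintro m' ⟨⟨h1, h3, h4, nb', h5, h6, h7, h8⟩, h9⟩
    have h9' : ∀ j : ℕ, j < n → m'.arr 6 j ≠ 2 := by simpa [Expr.eval] using h9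
    -- A last box that has not reached height `D` is abandoned. Its sensors stay placed and its
    -- number is used again; this is harmless, since `Full` only asks for the existence of covering
    -- sensors.
    exact ⟨h1, h3, fun s hs => (h4 s hs).resolve_left (h9' s s.2), nb', ⟨h5.1, h5.2.zero⟩, h7,
      fun x hx => (h8 x hx).final h6.le⟩

end RSC

/-! ### The sensors that cross a vertical line -/

namespace RSC

open RAM

variable {n : ℕ} {I : RSC n}

theorem wt_congr {st st' : ℤ → ℤ} {f x : ℤ}
    (h : ∀ s : Fin n, I.Live s x → (st' s = f ↔ st s = f)) : I.wt st' f x = I.wt st f x := by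
  refine Finset.sum_congr rfl fun s _ => ?_
  by_cases hl : I.Live s x
  · simp [hl, h s hl]
  · simp [hl]

/-- Stacking turns state 2 into state 3, so the gain in placed weight is the weight of the group
taken. -/
theorem wt_move {st st' : ℤ → ℤ} (h1 : ∀ s : Fin n, st s ≠ 2 → st' s = st s)
    (h2 : ∀ s : Fin n, st s = 2 → st' s = 3) (x : ℤ) :
    I.wt st' 3 x - I.wt st 3 x = I.wt st 2 x := by
  unfold wt
  rw [sub_eq_iff_eq_add, ← Finset.sum_add_distrib]
  refine Finset.sum_congr rfl fun s _ => ?_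
  by_cases hs : st s = 2
  · simp [hs, h2 s hs]
  · simp [hs, h1 s hs]

/-- Box sensors with extreme left ends and then sensors with extreme right ends. -/
def layer : Prog := .seq (take 0) (.seq (chunk 4) (.seq (take 4) (chunk 0)))

/-- Either all sensors of a layer that are live at `x` are accounted for by the new boxes, or there
is no sensor left that is live at `x`. -/
theorem layer_dichotomy {q d D S v x : ℤ} {l r : Fin n → ℤ} {st₁ st₃ kl kr : ℤ → ℤ}
    (hl : ∀ s, l s = I.left s) (hr : ∀ s, r s = -I.right s)
    (hkl : ∀ s : Fin n, kl s = l s) (hkr : ∀ s : Fin n, kr s = r s)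
    (hq : 3 ≤ q) (hd : 0 < d) (hD : D = q * d) (hS : S = q * D)
    (h₁ : ∀ s : Fin n, st₁ s = 1 ∨ st₁ s = 2 → I.Live s v)
    (h₃ : ∀ s : Fin n, st₃ s = 1 ∨ st₃ s = 2 → st₁ s = 1)
    (f₁ : ∀ s s' : Fin n, st₁ s = 2 → st₁ s' = 1 → kl s ≤ kl s')
    (f₃ : ∀ s s' : Fin n, st₃ s = 2 → st₃ s' = 1 → kr s ≤ kr s')
    (e₁ : S ≤ I.tw st₁ 2 ∨ ∀ s : Fin n, st₁ s ≠ 1)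
    (e₃ : S ≤ I.tw st₃ 2 ∨ ∀ s : Fin n, st₃ s ≠ 1) {b₁ b₃ : ℤ}
    (c₁ : I.LiveFirst st₁ kr x → I.wt st₁ 2 x ≤ (D + d) * b₁ + (D + d))
    (c₃ : I.LiveFirst st₃ kl x → I.wt st₃ 2 x ≤ (D + d) * b₃ + (D + d)) :
    (q - 3) * (I.wt st₁ 2 x + I.wt st₃ 2 x) ≤ q * (D + d) * (b₁ + b₃) ∨
      ∀ s : Fin n, st₃ s = 1 → ¬ I.Live s x := by
  have nonneg : ∀ st : ℤ → ℤ, 0 ≤ I.wt st 2 x := fun st =>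
    Finset.sum_nonneg fun s _ => by split_ifs <;> simp
  -- If the layer has weight at least `S` at `x`, the two wasted boxes are paid for: `2 q (D + d) ≤
  -- 3 S` is at most three times that weight, hence the factor `q - 3`.
  have fin : S ≤ I.wt st₁ 2 x + I.wt st₃ 2 x → I.LiveFirst st₁ kr x → I.LiveFirst st₃ kl x →
      (q - 3) * (I.wt st₁ 2 x + I.wt st₃ 2 x) ≤ q * (D + d) * (b₁ + b₃) := by
    intro hs hc1 hc3
    have h1 := mul_le_mul_of_nonneg_left (add_le_add (c₁ hc1) (c₃ hc3)) (show 0 ≤ q by omega)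
    have h2 : 2 * (q * (D + d)) ≤ 3 * S := by
      rw [hS, hD]
      nlinarith [mul_pos (show 0 < q by omega) hd]
    linarith
  -- All sensors concerned contain `v`. For `x ≤ v` being live means `left ≤ x`, and the first group
  -- decides; for `x > v` it means `x < right`, and the second group decides.
  rcases le_or_gt x v with hxv | hxv
  · by_cases hall : ∀ s : Fin n, st₁ s = 2 → I.Live s x
    · rcases e₁ with e | e
      -- The first group is live as a whole, so any order serves; the second is stacked by left end,
      -- which is the right order on this side of `v`.
      · refine .inl (fin ?_ (fun s _ hs _ _ _ => hall s hs) fun s s' hs hs' hle hlive => ?_)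
        · rw [wt_eq_tw I hall]; linarith [nonneg st₃]
        · have := (h₁ s (.inl (h₃ s (.inr hs)))).2
          rw [hkl, hkl, hl, hl] at hle
          exact ⟨hle.trans hlive.1, by omega⟩
      · exact .inr fun s hs => absurd (h₃ s (.inl hs)) (e s)
    · push Not at hall
      obtain ⟨s, hs, hdead⟩ := hall
      refine .inr fun s' hs' hlive => ?_
      -- A remaining sensor starts no further left than `s`, which already starts to the right of
      -- `x`.
      have h1 := f₁ s s' hs (h₃ s' (.inl hs'))
      have h2 := (h₁ s (.inr hs)).2
      rw [hkl, hkl, hl, hl] at h1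
      exact hdead ⟨h1.trans hlive.1, by omega⟩
  · by_cases hall : ∀ s : Fin n, st₃ s = 2 → I.Live s x
    · rcases e₃ with e | e
      · refine .inl (fin ?_ (fun s s' hs hs' hle hlive => ?_) fun s _ hs _ _ _ => hall s hs)
        · rw [wt_eq_tw I hall]; linarith [nonneg st₁]
        · have := (h₁ s (.inr hs)).1
          have := hlive.2
          rw [hkr, hkr, hr, hr] at hle
          exact ⟨by omega, by omega⟩
      · exact .inr fun s hs => absurd hs (e s)
    · push Not at hall
      obtain ⟨s, hs, hdead⟩ := hall
      refine .inr fun s' hs' hlive => ?_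
      have h1 := f₃ s s' hs hs'
      have h2 := (h₁ s (.inl (h₃ s (.inr hs)))).1
      have := hlive.2
      rw [hkr, hkr, hr, hr] at h1
      exact hdead ⟨by omega, by omega⟩

/-- What a layer, and a sequence of layers, does to the states of the sensors. -/
structure Moved (st st' : ℤ → ℤ) (n : ℕ) : Prop where
  other : ∀ s : Fin n, st s ≠ 1 → st' s = st s
  one : ∀ s : Fin n, st s = 1 → st' s = 1 ∨ st' s = 3

theorem Moved.trans {st st' st'' : ℤ → ℤ} (h : Moved st st' n) (h' : Moved st' st'' n) :
    Moved st st'' n where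
  other := fun s hs => by rw [h'.other s (by rwa [h.other s hs]), h.other s hs]
  one := fun s hs => by
    rcases h.one s hs with h1 | h1
    · exact h'.one s h1
    · exact .inr (by rw [h'.other s (by omega), h1])

theorem Moved.wt_eq {st st' : ℤ → ℤ} (h : Moved st st' n) {x : ℤ}
    (hx : ∀ s : Fin n, st s = 1 → ¬ I.Live s x) : I.wt st' 3 x = I.wt st 3 x := by
  refine wt_congr fun s hs => ?_
  rw [h.other s fun h1 => hx s h1 hs]

/-- Besides the dichotomy, two facts are needed by the loop over layers: a bound on the weight of a
layer, which is the price of a layer that cannot be charged, and strict progress for termination. -/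
theorem ens_layer {q : ℕ} {m : Memory} {nb : ℕ} {v : ℤ} (hB : I.Base q m)
    (hS : I.MStacks q m nb 0) (h2 : ∀ s : Fin n, m.arr 6 s ≠ 2)
    (h1 : ∀ s : Fin n, m.arr 6 s = 1 → I.Live s v) :
    Ens layer m (800 * (n + 1) ^ 2) (fun m' =>
      Same [8, 9, 13, 14] [6, 7, 8, 9, 10] m m' ∧ Moved (m.arr 6) (m'.arr 6) n ∧
      ((∃ s : Fin n, m.arr 6 s = 1) → ∃ s : Fin n, m.arr 6 s = 1 ∧ m'.arr 6 s = 3) ∧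
      ∃ nb', I.MStacks q m' nb' 0 ∧ (∀ x, boxes m nb x ≤ boxes m' nb' x) ∧
        ∀ x, I.wt (m'.arr 6) 3 x - I.wt (m.arr 6) 3 x ≤ 2 * (q * (q * I.dmax) + I.dmax) ∧
          ((q - 3) * (I.wt (m'.arr 6) 3 x - I.wt (m.arr 6) 3 x) ≤
            q * (q * I.dmax + I.dmax) * ((boxes m' nb' x : ℤ) - boxes m nb x) ∨
          ∀ s : Fin n, m'.arr 6 s = 1 → ¬ I.Live s x)) := by
  refine ((ens_take (by decide) hB h2).seq (t₂ := 600 * (n + 1) ^ 2) (Q := _) ?_).mono (by omega)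
    fun m' hm' => hm'
  rintro m₁ ⟨S1, T1⟩
  have hB1 : I.Base q m₁ := hB.same S1 (by decide) (by decide)
  have hS1 : I.MStacks q m₁ nb 0 := by
    refine ⟨by rw [S1.1 14 (by decide), hS.1], ?_⟩
    rw [S1.2 7 (by decide), S1.2 8 (by decide), S1.2 9 (by decide), S1.2 10 (by decide)]
    exact hS.2.congr_state fun s hs => by rw [T1.other s (by omega), hs]
  refine ((ens_chunk (by decide) hB1 hS1).seq (t₂ := 400 * (n + 1) ^ 2) (Q := _) ?_).mono
    (by omega) fun m' hm' => hm'
  rintro m₂ ⟨S2, C2, D2, nb2, hS2, mono2, F2⟩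
  have hB2 : I.Base q m₂ := hB1.same S2 (by decide) (by decide)
  have h2' : ∀ s : Fin n, m₂.arr 6 s ≠ 2 := fun s => by
    by_cases h : m₁.arr 6 s = 2
    · rw [D2 s h]; decide
    · rw [C2 s h]; exact h
  refine ((ens_take (by decide) hB2 h2').seq (t₂ := 200 * (n + 1) ^ 2) (Q := _) ?_).mono
    (by omega) fun m' hm' => hm'
  rintro m₃ ⟨S3, T3⟩
  have hB3 : I.Base q m₃ := hB2.same S3 (by decide) (by decide)
  have hS3 : I.MStacks q m₃ nb2 0 := by
    refine ⟨by rw [S3.1 14 (by decide), hS2.1], ?_⟩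
    rw [S3.2 7 (by decide), S3.2 8 (by decide), S3.2 9 (by decide), S3.2 10 (by decide)]
    exact hS2.2.congr_state fun s hs => by rw [T3.other s (by omega), hs]
  refine (ens_chunk (by decide) hB3 hS3).mono le_rfl ?_
  rintro m₄ ⟨S4, C4, D4, nb4, hS4, mono4, F4⟩
  have b3 : ∀ x, boxes m₃ nb2 x = boxes m₂ nb2 x := fun x => by
    unfold boxes; rw [S3.2 9 (by decide), S3.2 10 (by decide)]
  have b1 : ∀ x, boxes m₁ nb x = boxes m nb x := fun x => by
    unfold boxes; rw [S1.2 9 (by decide), S1.2 10 (by decide)]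
  -- the states
  have t0 : ∀ s : Fin n, m.arr 6 s ≠ 1 → m₁.arr 6 s ≠ 1 ∧ m₁.arr 6 s ≠ 2 := fun s hs => by
    rw [T1.other s hs]; exact ⟨hs, h2 s⟩
  have t1 : ∀ s : Fin n, m₁.arr 6 s = 1 ∨ m₁.arr 6 s = 2 → m.arr 6 s = 1 := fun s hs => by
    by_contra h; have := t0 s h; omega
  have t2 : ∀ s : Fin n, m₂.arr 6 s = 1 → m₁.arr 6 s = 1 := fun s hs => by
    by_cases h : m₁.arr 6 s = 2
    · have := D2 s h; omega
    · rw [← C2 s h, hs]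
  have t3 : ∀ s : Fin n, m₃.arr 6 s = 1 ∨ m₃.arr 6 s = 2 → m₁.arr 6 s = 1 := fun s hs => by
    by_cases h : m₂.arr 6 s = 1
    · exact t2 s h
    · have := T3.other s h; have := h2' s; omega
  have t4 : ∀ s : Fin n, m₄.arr 6 s = 1 → m₃.arr 6 s = 1 := fun s hs => by
    by_cases h : m₃.arr 6 s = 2
    · have := D4 s h; omega
    · rw [← C4 s h, hs]
  have w1 : ∀ x, I.wt (m₁.arr 6) 3 x = I.wt (m.arr 6) 3 x := fun x => wt_congr fun s _ => by
    by_cases h : m.arr 6 s = 1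
    · have := T1.one s h; omega
    · rw [T1.other s h]
  have w3 : ∀ x, I.wt (m₃.arr 6) 3 x = I.wt (m₂.arr 6) 3 x := fun x => wt_congr fun s _ => by
    by_cases h : m₂.arr 6 s = 1
    · have := T3.one s h; omega
    · rw [T3.other s h]
  have dw : ∀ x, I.wt (m₄.arr 6) 3 x - I.wt (m.arr 6) 3 x =
      I.wt (m₁.arr 6) 2 x + I.wt (m₃.arr 6) 2 x := fun x => by
    have e1 := wt_move (I := I) C2 D2 x
    have e2 := wt_move (I := I) C4 D4 x
    rw [w1] at e1
    rw [w3] at e2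
    linarith
  have hd : (0 : ℤ) < I.dmax := by exact_mod_cast hB.d_pos
  have hmoved : Moved (m.arr 6) (m₄.arr 6) n := by
    constructor
    · intro s hs
      have h := t0 s hs
      have e2 : m₂.arr 6 s = m.arr 6 s := by rw [C2 s h.2, T1.other s hs]
      have e3 : m₃.arr 6 s = m.arr 6 s := by rw [T3.other s (by rwa [e2]), e2]
      rw [C4 s (by rw [e3]; exact h2 s), e3]
    · intro s hs
      rcases T1.one s hs with h | h
      · have e2 := C2 s (by omega)
        rcases T3.one s (by rw [e2, h]) with h' | h'
        · exact .inl (by rw [C4 s (by omega), h'])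
        · exact .inr (D4 s h')
      · have e2 := D2 s h
        have e3 := T3.other s (by omega)
        have e4 := C4 s (by omega)
        exact .inr (by omega)
  refine ⟨((S1.mono (by decide) (by decide)).trans S2).trans ((S3.mono (by decide) (by decide)).trans S4),
    hmoved, ?_, nb4, hS4, ?_, ?_⟩
  · rintro ⟨s, hs⟩
    have two : ∀ s' : Fin n, m₁.arr 6 s' = 2 → ∃ s : Fin n, m.arr 6 s = 1 ∧ m₄.arr 6 s = 3 := by
      intro s' h
      have e2 := D2 s' h
      have e3 := T3.other s' (by omega)
      have e4 := C4 s' (by omega)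
      exact ⟨s', t1 s' (.inr h), by omega⟩
    rcases T1.enough with h | h
    -- Since `S` is positive, a first group of total duration at least `S` is not empty.
    · by_contra hne
      have : I.tw (m₁.arr 6) 2 = 0 := Finset.sum_eq_zero fun s _ => if_neg fun h => hne (two s h)
      have := hB.S_pos
      omega
    · exact two s ((T1.one s hs).resolve_left (h s))
  · intro x
    rw [← b1]
    exact (mono2 x).trans ((b3 x).symm.le.trans (mono4 x))
  · intro x
    rw [dw]
    refine ⟨?_, ?_⟩
    · have := (I.wt_le_tw (m₁.arr 6) 2 x).trans T1.tw_le
      have := (I.wt_le_tw (m₃.arr 6) 2 x).trans T3.tw_le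
      linarith
    · have := layer_dichotomy (I := I) (q := q) (d := I.dmax) (v := v) (x := x) (l := I.left)
        (r := fun s => -I.right s) (st₁ := m₁.arr 6) (st₃ := m₃.arr 6)
        (kl := m.arr 0) (kr := m.arr 4)
        (b₁ := (boxes m₂ nb2 x : ℤ) - boxes m nb x) (b₃ := (boxes m₄ nb4 x : ℤ) - boxes m₂ nb2 x)
        (fun _ => rfl) (fun _ => rfl) hB.left_eq hB.negRight_eq (by exact_mod_cast hB.three_le) hd
        rfl rfl (fun s hs => h1 s (t1 s hs)) t3 T1.first
        (by
          have := T3.first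
          rwa [S2.2 4 (by decide), S1.2 4 (by decide)] at this)
        T1.enough T3.enough
        (by
          have := F2 x
          rwa [wt_move C2 D2, S1.2 4 (by decide), b1] at this)
        (by
          have := F4 x
          rwa [wt_move C4 D4, S3.2 0 (by decide), S2.2 0 (by decide), S1.2 0 (by decide), b3]
            at this)
      rcases this with h | h
      · refine .inl (h.trans (le_of_eq ?_))
        ring
      · exact .inr fun s hs => h s (t4 s hs)

end RSC

/-! ### Boxing all sensors that cross one line -/

namespace RSC

open RAM

variable {n : ℕ} {I : RSC n}

/-- Give state `1` to the sensors with state `0` that are live at `reg 19`. -/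
def mark : Prog :=
  forLt 17 0 <|
    .ifPos (.get 6 (.reg 17)) .skip <|
    .ifPos (.sub (.get 0 (.reg 17)) (.reg 19)) .skip <|
    .ifPos (.sub (.get 1 (.reg 17)) (.reg 19)) (.store 6 (.reg 17) (.const 1)) .skip

theorem ens_mark {q : ℕ} {m : Memory} {v : ℤ} (hB : I.Base q m) (hv : m.reg 19 = v)
    (h03 : ∀ s : Fin n, m.arr 6 s = 0 ∨ m.arr 6 s = 3) :
    Ens mark m (50 * (n + 1)) (fun m' => Same [17] [6] m m' ∧
      ∀ s : Fin n, m'.arr 6 s = if m.arr 6 s = 0 ∧ I.Live s v then 1 else m.arr 6 s) := by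
  refine (ens_forLt (t := 40) (n := n) (fun k m' => Same [17] [6] m m' ∧
    ∀ s : Fin n, m'.arr 6 s =
      if (s : ℕ) < k ∧ m.arr 6 s = 0 ∧ I.Live s v then 1 else m.arr 6 s) (by decide)
      ?_ ?_ hB.n_eq).mono (by omega) ?_
  · rintro k m1 hk ⟨h1, h2⟩ h17 h0
    obtain ⟨s, rfl⟩ : ∃ s : Fin n, (s : ℕ) = k := ⟨⟨k, hk⟩, rfl⟩
    have hB1 : I.Base q m1 := hB.same h1 (by decide) (by decide)
    refine Prog.LoopFree.ens (by simp [Prog.LoopFree]) (by simp [Prog.cost, Expr.cost]) ?_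
    have e19 : m1.reg 19 = v := by rw [h1.1 19 (by decide), hv]
    have e6 : m1.arr 6 s = m.arr 6 s := by rw [h2 s, if_neg (by omega)]
    simp only [Prog.exec, Expr.eval, h17, e19, hB1.left_eq, hB1.right_eq, e6]
    have old : ¬ (m.arr 6 s = 0 ∧ I.Live s v) → m1.reg 17 = (s : ℕ) ∧ m1.reg 0 = n ∧
        Same [17] [6] m (m1.setReg 17 ((s : ℕ) + 1)) ∧
        ∀ s' : Fin n, (m1.setReg 17 ((s : ℕ) + 1)).arr 6 s' =
          if (s' : ℕ) < s + 1 ∧ m.arr 6 s' = 0 ∧ I.Live s' v then 1 else m.arr 6 s' := by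
      refine fun hne => ⟨h17, h0, h1.setReg (by decide) _, fun s' => ?_⟩
      rw [Memory.setReg_arr, h2 s']
      by_cases e : s' = s
      · subst e; simp [hne]
      · have : (s' : ℕ) ≠ s := fun h => e (Fin.ext h)
        have : (s' : ℕ) < s + 1 ↔ (s' : ℕ) < s := by omega
        simp only [this]
    split_ifs with c1 c2 c3
    · exact old fun h => by omega
    · exact old fun h => by have := h.2.1; omega
    · refine ⟨by simpa using h17, by simpa using h0,
        (h1.setArr (by decide) _ _).setReg (by decide) _, fun s' => ?_⟩
      simp only [Memory.setReg_arr, Memory.setArr_arr, if_true]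
      rw [update_fin, h2 s']
      by_cases e : s' = s
      · subst e
        rw [if_pos rfl, if_pos ⟨by omega, by have := h03 s'; omega, by omega, by omega⟩]
      · have : (s' : ℕ) ≠ s := fun h => e (Fin.ext h)
        have : (s' : ℕ) < s + 1 ↔ (s' : ℕ) < s := by omega
        simp only [if_neg e, this]
    · exact old fun h => by have := h.2.2; omega
  · exact ⟨(Same.refl _ _ _).setReg (by decide) _, fun s => by simp⟩
  · rintro m' ⟨⟨h1, h2⟩, -⟩
    exact ⟨h1, fun s => by rw [h2 s]; simp [s.2]⟩

/-- Box all sensors with state `0` that are live at `reg 19`. -/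
def line : Prog :=
  .seq mark <| .seq (select 6 1 0 0 9) <|
    .whilePos (.add (.reg 9) (.const 1)) (.seq layer (select 6 1 0 0 9))

theorem Moved.numState_lt {st st' : ℤ → ℤ} (h : Moved st st' n)
    (hs : ∃ s : Fin n, st s = 1 ∧ st' s = 3) : numState st' 1 n < numState st 1 n := by
  obtain ⟨s, h1, h3⟩ := hs
  refine Finset.card_lt_card (Finset.ssubset_iff_subset_ne.mpr ⟨fun i hi => ?_, fun he => ?_⟩)
  · simp only [Finset.mem_filter, Finset.mem_range] at hi ⊢
    refine ⟨hi.1, ?_⟩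
    by_contra hne
    have := h.other ⟨i, hi.1⟩ hne
    exact hne (this.symm.trans hi.2)
  · have : (s : ℕ) ∈ (Finset.range n).filter fun i : ℕ => st i = 1 := by simp [h1]
    rw [← he] at this
    simp [h3] at this

/-- The progress that a sequence of layers has made at `x`. -/
def LineAt (I : RSC n) (q : ℕ) (st₁ st' : ℤ → ℤ) (db x : ℤ) : Prop :=
  (q - 3) * (I.wt st' 3 x - I.wt st₁ 3 x) ≤ q * (q * I.dmax + I.dmax) * db ∨
    ((q - 3) * (I.wt st' 3 x - I.wt st₁ 3 x) ≤ q * (q * I.dmax + I.dmax) * db +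
        q * (2 * (q * (q * I.dmax) + I.dmax)) ∧ ∀ s : Fin n, st' s = 1 → ¬ I.Live s x)

/-- The first layer that falls into the bad case of the dichotomy at `x` costs its whole weight, but
leaves no sensor of the line live at `x`. Later layers add no weight there, so this cost is incurred
only once. -/
theorem LineAt.step {q : ℕ} (hq : 3 ≤ q) {st₁ st' st'' : ℤ → ℤ} {b₀ b₁ b₂ x : ℤ}
    (h : I.LineAt q st₁ st' (b₁ - b₀) x) (hm : Moved st' st'' n) (hb : b₁ ≤ b₂)
    (h1 : I.wt st'' 3 x - I.wt st' 3 x ≤ 2 * (q * (q * I.dmax) + I.dmax))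
    (h2 : (q - 3) * (I.wt st'' 3 x - I.wt st' 3 x) ≤ q * (q * I.dmax + I.dmax) * (b₂ - b₁) ∨
          ∀ s : Fin n, st'' s = 1 → ¬ I.Live s x) :
    I.LineAt q st₁ st'' (b₂ - b₀) x := by
  have hb' : (0 : ℤ) ≤ q * (q * I.dmax + I.dmax) * (b₂ - b₁) := mul_nonneg (by positivity) (by omega)
  have hq' : (3 : ℤ) ≤ q := by exact_mod_cast hq
  rcases h with h | ⟨h, h'⟩
  · rcases h2 with h2 | h2
    · left; linarith
    · right
      refine ⟨?_, h2⟩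
      have e1 := mul_le_mul_of_nonneg_left h1 (show 0 ≤ (q : ℤ) - 3 by omega)
      -- The factor `q - 3` is relaxed to `q` to match the form of the loss term.
      have e2 : ((q : ℤ) - 3) * (2 * (q * (q * I.dmax) + I.dmax)) ≤
        q * (2 * (q * (q * I.dmax) + I.dmax)) := mul_le_mul_of_nonneg_right (by omega) (by positivity)
      linarith
  · right
    rw [hm.wt_eq h']
    refine ⟨by linarith, fun s hs hl => ?_⟩
    by_cases e : st' s = 1
    · exact h' s e hl
    · exact e (by rw [← hm.other s e, hs])

/-- The invariant is `LineAt` relative to the memory after marking. Every layer places at least one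
marked sensor, so there are at most `n` layers. -/
theorem ens_line {q : ℕ} {m : Memory} {nb : ℕ} {v : ℤ} (hB : I.Base q m)
    (hS : I.MStacks q m nb 0) (hv : m.reg 19 = v)
    (h03 : ∀ s : Fin n, m.arr 6 s = 0 ∨ m.arr 6 s = 3) :
    Ens line m (2000 * (n + 1) ^ 3) (fun m' =>
      Same [8, 9, 13, 14, 17] [6, 7, 8, 9, 10] m m' ∧
      (∀ s : Fin n, m'.arr 6 s = if I.Live s v then 3 else m.arr 6 s) ∧
      ∃ nb', I.MStacks q m' nb' 0 ∧ (∀ x, boxes m nb x ≤ boxes m' nb' x) ∧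
        ∀ x, (q - 3) * (I.wt (m'.arr 6) 3 x - I.wt (m.arr 6) 3 x) ≤
            q * (q * I.dmax + I.dmax) * ((boxes m' nb' x : ℤ) - boxes m nb x) +
            q * (2 * (q * (q * I.dmax) + I.dmax))) := by
  refine ((ens_mark hB hv h03).seq (t₂ := 60 * (n + 1) +
    (n + 1) * (3 + 1 + (800 * (n + 1) ^ 2 + 60 * (n + 1)))) (Q := _) ?_).mono (by nlinarith)
    fun m' hm' => hm'
  rintro m₁ ⟨S1, st1⟩
  have hB1 : I.Base q m₁ := hB.same S1 (by decide) (by decide)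
  have hS1 : I.MStacks q m₁ nb 0 := by
    refine ⟨by rw [S1.1 14 (by decide), hS.1], ?_⟩
    rw [S1.2 7 (by decide), S1.2 8 (by decide), S1.2 9 (by decide), S1.2 10 (by decide)]
    exact hS.2.congr_state fun s hs => by rw [st1 s, if_neg (by omega), hs]
  have h1v : ∀ s : Fin n, m₁.arr 6 s = 1 → I.Live s v := fun s hs => by
    rw [st1 s] at hs
    split_ifs at hs with h
    · exact h.2
    · have := h03 s; omega
  have h12 : ∀ s : Fin n, m₁.arr 6 s ≠ 2 := fun s hs => by
    have := h03 s
    rw [st1 s] at hs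
    split_ifs at hs <;> omega
  have b1 : ∀ x, boxes m₁ nb x = boxes m nb x := fun x => by
    unfold boxes; rw [S1.2 9 (by decide), S1.2 10 (by decide)]
  let J : Memory → Prop := fun m' => Same [8, 9, 13, 14, 17] [6, 7, 8, 9, 10] m₁ m' ∧
    Moved (m₁.arr 6) (m'.arr 6) n ∧ ∃ nb', I.MStacks q m' nb' 0 ∧
      (∀ x, boxes m nb x ≤ boxes m' nb' x) ∧
      ∀ x, I.LineAt q (m₁.arr 6) (m'.arr 6) ((boxes m' nb' x : ℤ) - boxes m nb x) x
  let J' : Memory → Prop := fun m' => J m' ∧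
    SelVal (m'.arr 6) 1 (m'.arr 0) n (m'.reg 9)
  have sel : ∀ m', J m' → Ens (select 6 1 0 0 9) m' (60 * (n + 1))
      (fun m'' => J' m'' ∧ m''.arr = m'.arr) := by
    rintro m' ⟨h1, h2, nb', h3, h4, h5⟩
    refine (ens_select (n := n) (by rw [h1.1 0 (by decide), hB1.n_eq]) (by decide) (by decide)
      (by decide)).mono le_rfl ?_
    rintro m'' ⟨hA, hs⟩
    refine ⟨⟨⟨h1.trans (hA.same (by decide) (by decide)), by rwa [hA.1], nb', ?_, ?_, ?_⟩,
      by rwa [hA.1]⟩, hA.1⟩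
    · refine ⟨by rw [hA.2 14 (by decide) (by decide), h3.1], by rw [hA.1]; exact h3.2⟩
    · unfold boxes; rw [hA.1]; exact h4
    · unfold boxes; rw [hA.1]; exact h5
  have hJ1 : J m₁ := by
    refine ⟨Same.refl _ _ _, ⟨fun _ _ => rfl, fun s h => .inl h⟩, nb, hS1, fun x => (b1 x).ge,
      fun x => .inl ?_⟩
    simp [b1]
  refine (sel m₁ hJ1).seq ?_
  rintro m₂ ⟨hJ2, -⟩
  refine (Ens.whilePos (N := n) (t := 800 * (n + 1) ^ 2 + 60 * (n + 1)) J'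
    (fun m' => numState (m'.arr 6) 1 n) ?_ hJ2 (numState_le _ _ _)).mono le_rfl ?_
  · rintro m' ⟨⟨h1, h2, nb', h3, h4, h5⟩, hs⟩ hpos
    have hB' : I.Base q m' := hB1.same h1 (by decide) (by decide)
    have h22 : ∀ s : Fin n, m'.arr 6 s ≠ 2 := fun s hs => by
      by_cases h : m₁.arr 6 s = 1
      · have := h2.one s h; omega
      · exact h12 s (by rw [← h2.other s h, hs])
    have h2v : ∀ s : Fin n, m'.arr 6 s = 1 → I.Live s v := fun s hs => by
      by_cases h : m₁.arr 6 s = 1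
      · exact h1v s h
      · exact absurd (by rw [← h2.other s h, hs]) h
    refine (ens_layer hB' h3 h22 h2v).seq ?_
    rintro m'' ⟨g1, g2, g3, nb'', g4, g5, g6⟩
    refine (sel m'' ⟨h1.trans (g1.mono (by decide) (by decide)), h2.trans g2, nb'', g4,
      fun x => (h4 x).trans (g5 x), fun x => ?_⟩).mono le_rfl ?_
    · exact (h5 x).step hB.three_le g2 (by exact_mod_cast g5 x) (g6 x).1 (g6 x).2
    · rintro m3 ⟨hJ3, harr⟩
      refine ⟨hJ3, ?_⟩
      rw [harr]
      refine g2.numState_lt (g3 ?_)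
      rcases hs with ⟨hs, -⟩ | ⟨i, -, hi, hi1, -⟩
      · simp [Expr.eval, hs] at hpos
      · exact ⟨⟨i, hi⟩, hi1⟩
  · rintro m' ⟨⟨⟨h1, h2, nb', h3, h4, h5⟩, hs⟩, hneg⟩
    have none : ∀ s : Fin n, m'.arr 6 s ≠ 1 := by
      rcases hs with ⟨-, hs⟩ | ⟨i, hi, -⟩
      · exact fun s => hs s s.2
      · simp only [Expr.eval, hi] at hneg
        omega
    refine ⟨(S1.mono (by decide) (by decide)).trans h1, fun s => ?_, nb', h3, h4, fun x => ?_⟩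
    · have := h03 s
      by_cases hl : I.Live s v
      · rw [if_pos hl]
        by_cases h0 : m.arr 6 s = 0
        · exact (h2.one s (by rw [st1 s, if_pos ⟨h0, hl⟩])).resolve_left (none s)
        · have e : m₁.arr 6 s = m.arr 6 s := by rw [st1 s, if_neg (by tauto)]
          rw [h2.other s (by omega)]
          omega
      · have e : m₁.arr 6 s = m.arr 6 s := by rw [st1 s, if_neg (by tauto)]
        rw [if_neg hl, h2.other s (by omega), e]
    · have e : I.wt (m₁.arr 6) 3 x = I.wt (m.arr 6) 3 x := wt_congr fun s _ => by
        rw [st1 s]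
        split_ifs with h
        · constructor <;> omega
        · rfl
      rw [← e]
      rcases h5 x with h | h
      · exact h.trans (le_add_of_nonneg_right (by positivity))
      · exact h.1

end RSC

/-! ### The vertical lines and the levels -/

namespace RSC

open RAM

variable {n : ℕ} {I : RSC n}

/-- The values `loc 1 ≤ … ≤ loc n` are the left ends of the sensors. -/
structure Lines (I : RSC n) (loc : ℤ → ℤ) : Prop where
  mono : ∀ i j : ℕ, 1 ≤ i → i ≤ j → j ≤ n → loc i ≤ loc j
  all : ∀ s, ∃ i : ℕ, 1 ≤ i ∧ i ≤ n ∧ loc i = I.left s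

/-- Write the sorted left ends of the sensors into the cells `1, …, n` of array 5. -/
def sortLines : Prog :=
  .seq (.assign 10 (.const 0)) <|
  forSel 17 0 0 0 (.const 1) <|
    .seq (.assign 10 (.add (.reg 10) (.const 1))) <|
    .seq (.store 5 (.reg 10) (.get 0 (.reg 9))) (.store 17 (.reg 9) (.const 1))

/-- The values `loc 1 ≤ … ≤ loc p` are the `p` least left ends of sensors. -/
structure PartLines (I : RSC n) (loc st : ℤ → ℤ) (p : ℕ) : Prop where
  mono : ∀ i j : ℕ, 1 ≤ i → i ≤ j → j ≤ p → loc i ≤ loc j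
  left_end : ∀ i : ℕ, 1 ≤ i → i ≤ p → ∃ s, loc i = I.left s
  all : ∀ s : Fin n, st s ≠ 0 → ∃ i : ℕ, 1 ≤ i ∧ i ≤ p ∧ loc i = I.left s
  least : ∀ s : Fin n, st s = 0 → ∀ i : ℕ, 1 ≤ i → i ≤ p → loc i ≤ I.left s

/-- Selection sort: the new entry is the least remaining left end, and `least` puts it above all
earlier entries. -/
theorem PartLines.push {loc st : ℤ → ℤ} {p : ℕ} (h : I.PartLines loc st p) {s : Fin n}
    (hs : st s = 0) (hmin : ∀ s' : Fin n, st s' = 0 → I.left s ≤ I.left s') :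
    I.PartLines (Function.update loc (p + 1 : ℕ) (I.left s)) (Function.update st s 1) (p + 1) := by
  have old : ∀ i : ℕ, i ≤ p → Function.update loc (p + 1 : ℕ) (I.left s) i = loc i := fun i hi =>
    Function.update_of_ne (by omega) _ _
  have new : Function.update loc (p + 1 : ℕ) (I.left s) (p + 1 : ℕ) = I.left s :=
    Function.update_self _ _ _
  constructor
  · intro i j hi hij hj
    rcases Nat.le_succ_iff.mp hj with hj | rfl
    · rw [old i (hij.trans hj), old j hj]; exact h.mono i j hi hij hj
    · rw [new]
      rcases Nat.le_succ_iff.mp hij with hij | rfl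
      · rw [old i hij]; exact h.least s hs i hi hij
      · rw [new]
  · intro i hi hip
    rcases Nat.le_succ_iff.mp hip with hip | rfl
    · rw [old i hip]; exact h.left_end i hi hip
    · exact ⟨s, new⟩
  · intro s' hs'
    by_cases e : s' = s
    · subst e; exact ⟨p + 1, by omega, le_rfl, new⟩
    · rw [update_fin, if_neg e] at hs'
      obtain ⟨i, h1, h2, h3⟩ := h.all s' hs'
      exact ⟨i, h1, by omega, by rw [old i h2, h3]⟩
  · intro s' hs' i hi hip
    rw [update_fin] at hs'
    split_ifs at hs' with e
    · omega
    rcases Nat.le_succ_iff.mp hip with hip | rfl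
    · rw [old i hip]; exact h.least s' hs' i hi hip
    · rw [new]; exact hmin s' hs'

theorem ens_sortLines {q : ℕ} {m : Memory} (hB : I.Base q m) (h0 : ∀ s : Fin n, m.arr 17 s = 0) :
    Ens sortLines m (200 * (n + 1) ^ 2) (fun m' => Same [8, 9, 10] [5, 17] m m' ∧
      I.Lines (m'.arr 5)) := by
  refine (Ens.seq (Ens.assign (x := 10) (e := .const 0) rfl)
    (t₂ := 60 * (n + 1) + (n + 1) * (11 + 1 + 5 + 60 * (n + 1))) (Q := _) ?_).mono
    (by simp [Expr.cost]; nlinarith) fun m' hm' => hm'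
  rintro m1 rfl
  refine (ens_forSel (t := 11) (n := n) (fun m' => Same [8, 9, 10] [5, 17] m m' ∧ ∃ p : ℕ,
      m'.reg 10 = p ∧ p + numState (m'.arr 17) 0 n = n ∧ I.PartLines (m'.arr 5) (m'.arr 17) p)
    ?_ (by decide) (by decide) ?_ ?_ ?_ ?_ (by simp [Expr.eval])).mono le_rfl ?_
  · rintro m' ⟨h, -⟩
    rw [h.1 0 (by decide), hB.n_eq]
  · rintro m1 m2 hA ⟨h1, p, h2, h3, h4⟩
    exact ⟨h1.trans (hA.same (by decide) (by decide)), p,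
      by rw [hA.2 10 (by decide) (by decide), h2], by rwa [hA.1], by rwa [hA.1]⟩
  · rintro m1 m2 hA; rfl
  · rintro m1 i ⟨h1, p, h2, h3, h4⟩ - hi ⟨hin, hi1, himin⟩
    obtain ⟨s, rfl⟩ : ∃ s : Fin n, (s : ℕ) = i := ⟨⟨i, hin⟩, rfl⟩
    have hB1 : I.Base q m1 := hB.same h1 (by decide) (by decide)
    refine Prog.LoopFree.ens (by simp [Prog.LoopFree]) (by simp [Prog.cost, Expr.cost]) ?_
    simp only [Prog.exec]
    refine ⟨⟨((h1.setReg (by decide) _).setArr (by decide) _ _).setArr (by decide) _ _,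
      p + 1, by simp [Expr.eval, h2], ?_, ?_⟩, 1, by decide, by simp [Expr.eval, hi]⟩
    · have := numState_update (v := 1) hin hi1 (by decide)
      simp only [Expr.eval, Memory.setArr_arr, Memory.setReg_arr, Memory.setArr_reg,
        Memory.setReg_reg, Nat.reduceEqDiff, if_false, if_true, hi]
      omega
    · have := h4.push hi1 fun s' hs' => by
        rw [← hB1.left_eq, ← hB1.left_eq]; exact himin s' s'.2 hs'
      simpa [Expr.eval, hi, h2, hB1.left_eq] using this
  · refine ⟨(Same.refl _ _ _).setReg (by decide) _, 0, by simp [Expr.eval], ?_, ?_⟩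
    · simp only [Memory.setReg_arr, zero_add]
      unfold numState
      rw [Finset.filter_true_of_mem, Finset.card_range]
      intro i hi
      exact h0 ⟨i, Finset.mem_range.mp hi⟩
    · exact ⟨fun i j h1 h2 h3 => by omega, fun i h1 h2 => by omega, fun s hs => absurd (h0 s) hs,
        fun s _ i h1 h2 => by omega⟩
  · rintro m' ⟨⟨h1, p, h2, h3, h4⟩, h5⟩
    have h5' : ∀ j : ℕ, j < n → m'.arr 17 j ≠ 0 := by simpa [Expr.eval] using h5
    have : numState (m'.arr 17) 0 n = 0 := by
      unfold numState
      rw [Finset.card_eq_zero, Finset.filter_eq_empty_iff]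
      exact fun i hi => h5' i (Finset.mem_range.mp hi)
    obtain rfl : p = n := by omega
    exact ⟨h1, h4.mono, fun s => h4.all s (h5' s s.2)⟩

/-- The boxes account for the sensors at `x`, except for a loss of `g` units. -/
def Level (I : RSC n) (q : ℕ) (st : ℤ → ℤ) (b g : ℕ) (x : ℤ) : Prop :=
  (q - 3) * I.wt st 3 x ≤ q * (q * I.dmax + I.dmax) * b +
    g * (q * (2 * (q * (q * I.dmax) + I.dmax)))

/-- Two sensors that cross different multiples of a step and share a point do not both avoid the
multiples of the double step. -/
theorem Lines.cross {loc : ℤ → ℤ} (h : I.Lines loc) {σ k k' : ℕ} (hk : 1 ≤ k) (hkk : k < k')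
    (hσ : 0 < σ) (hn : σ * k' ≤ n) {s s' : Fin n} {x : ℤ} (hs : I.Live s (loc (σ * k : ℕ)))
    (hs' : I.Live s' (loc (σ * k' : ℕ))) (hx : I.Live s x) (hx' : I.Live s' x) :
    ∃ i, 1 ≤ i ∧ 2 * σ * i ≤ n ∧
      (I.Live s (loc (2 * σ * i : ℕ)) ∨ I.Live s' (loc (2 * σ * i : ℕ))) := by
  -- Between two different integers, ends included, there is an even one; the corresponding line
  -- belongs to the coarser grid.
  obtain ⟨i, hi1, hi2⟩ : ∃ i, k ≤ 2 * i ∧ 2 * i ≤ k' := ⟨(k + 1) / 2, by omega, by omega⟩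
  have e : 2 * σ * i = σ * (2 * i) := by ring
  have l1 : σ * k ≤ 2 * σ * i := e ▸ Nat.mul_le_mul_left σ hi1
  have l2 : 2 * σ * i ≤ σ * k' := e ▸ Nat.mul_le_mul_left σ hi2
  have l0 : 1 ≤ σ * k := Nat.mul_pos hσ hk
  have m1 := h.mono _ _ l0 l1 (l2.trans hn)
  have m2 := h.mono _ _ (l0.trans l1) l2 hn
  refine ⟨i, by omega, l2.trans hn, ?_⟩
  -- This line lies between the lines of `s` and `s'`. According to the side of `x` on which it
  -- falls, it separates `x` from the line of `s` or from that of `s'`, and that sensor crosses it.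
  rcases le_or_gt (loc (2 * σ * i : ℕ)) x with hle | hlt
  · exact .inl ⟨hs.1.trans m1, hle.trans_lt hx.2⟩
  · exact .inr ⟨hx'.1.trans hlt.le, m2.trans_lt hs'.2⟩

/-- Box the sensors at the lines whose number is a multiple of `reg 12`. -/
def level : Prog :=
  .seq (.assign 10 (.reg 12)) <|
  .whilePos (.add (.sub (.reg 0) (.reg 10)) (.const 1)) <|
    .seq (.assign 19 (.get 5 (.reg 10))) <| .seq line (.assign 10 (.add (.reg 10) (.reg 12)))

/-- By `h3` the coarser lines have been dealt with, so at each `x` only one line of this level can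
place new sensors, and the loss grows by one unit only. -/
theorem ens_level {q : ℕ} {m : Memory} {nb g σ : ℕ} (hB : I.Base q m) (hL : I.Lines (m.arr 5))
    (hS : I.MStacks q m nb 0) (h03 : ∀ s : Fin n, m.arr 6 s = 0 ∨ m.arr 6 s = 3)
    (hσ : 0 < σ) (h12 : m.reg 12 = σ)
    (h3 : ∀ i, 1 ≤ i → 2 * σ * i ≤ n → ∀ s, I.Live s (m.arr 5 (2 * σ * i : ℕ)) → m.arr 6 s = 3)
    (hg : ∀ x, I.Level q (m.arr 6) (boxes m nb x) g x) :
    Ens level m (3000 * (n + 1) ^ 4) (fun m' =>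
      Same [8, 9, 10, 13, 14, 17, 19] [6, 7, 8, 9, 10] m m' ∧
      (∀ s : Fin n, m'.arr 6 s = 0 ∨ m'.arr 6 s = 3) ∧
      (∀ i, 1 ≤ i → σ * i ≤ n → ∀ s, I.Live s (m.arr 5 (σ * i : ℕ)) → m'.arr 6 s = 3) ∧
      ∃ nb', I.MStacks q m' nb' 0 ∧ ∀ x, I.Level q (m'.arr 6) (boxes m' nb' x) (g + 1) x) := by
  have hX : 1 ≤ (n + 1) ^ 3 := Nat.one_le_pow _ _ (by omega)
  refine (Ens.seq (Ens.assign (x := 10) (e := .reg 12) rfl)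
    (t₂ := (n + 1) * (5 + 1 + (3 + (2000 * (n + 1) ^ 3 + 4)))) (Q := _) ?_).mono
    (by simp only [Expr.cost]; nlinarith) fun m' hm' => hm'
  rintro m1 rfl
  -- The invariant remembers for each `x` whether the unit of this level is still unspent; once
  -- spent, a sensor live at `x` that was unplaced before the level and crosses an earlier line is
  -- kept as a witness.
  let J : Memory → Prop := fun m' =>
    Same [8, 9, 10, 13, 14, 17, 19] [6, 7, 8, 9, 10] m m' ∧
      (∀ s : Fin n, m'.arr 6 s = 0 ∨ m'.arr 6 s = 3) ∧
      (∀ s : Fin n, m.arr 6 s = 3 → m'.arr 6 s = 3) ∧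
      ∃ k nb' : ℕ, 1 ≤ k ∧ m'.reg 10 = (σ * k : ℕ) ∧ I.MStacks q m' nb' 0 ∧
        (∀ i, 1 ≤ i → i < k → ∀ s, I.Live s (m.arr 5 (σ * i : ℕ)) → m'.arr 6 s = 3) ∧
        ∀ x, I.Level q (m'.arr 6) (boxes m' nb' x) (g + 1) x ∧
          (I.Level q (m'.arr 6) (boxes m' nb' x) g x ∨ ∃ i s, 1 ≤ i ∧ i < k ∧
            I.Live s x ∧ I.Live s (m.arr 5 (σ * i : ℕ)) ∧ m.arr 6 s = 0)
  have hmono : ∀ st b x, I.Level q st b g x → I.Level q st b (g + 1) x := by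
    intro st b x h
    unfold Level at h ⊢
    refine h.trans ?_
    gcongr
    simp
  refine (Ens.whilePos (N := n) (t := 3 + (2000 * (n + 1) ^ 3 + 4)) J
    (fun m' => (n + 1 - m'.reg 10).toNat) ?_ ?_ ?_).mono le_rfl ?_
  · rintro m1 ⟨h1, h2, h4, k, nb', hk, h10, hS1, h5, h6⟩ hpos
    have hB1 : I.Base q m1 := hB.same h1 (by decide) (by decide)
    simp only [Expr.eval, hB1.n_eq, h10] at hpos
    have hkn : σ * k ≤ n := by omega
    have e5 : m1.arr 5 = m.arr 5 := h1.2 5 (by decide)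
    refine (Ens.assign (x := 19) (e := .get 5 (.reg 10)) rfl).seq ?_
    rintro m2 rfl
    have S2 : Same [8, 9, 10, 13, 14, 17, 19] [6, 7, 8, 9, 10] m
        (m1.setReg 19 (Expr.eval m1 (.get 5 (.reg 10)))) := h1.setReg (by decide) _
    refine (ens_line (v := m.arr 5 (σ * k : ℕ)) (hB.same S2 (by decide) (by decide))
      (nb := nb') ⟨by simpa using hS1.1, hS1.2⟩ (by simp [Expr.eval, h10, e5]) h2).seq ?_
    rintro m3 ⟨S3, st3, nb3, hS3, mono3, F3⟩
    have S3' := S2.trans (S3.mono (by decide) (by decide))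
    simp only [Memory.setReg_arr] at st3 F3
    have mono3' : ∀ x, boxes m1 nb' x ≤ boxes m3 nb3 x := mono3
    have F3' : ∀ x, (q - 3) * (I.wt (m3.arr 6) 3 x - I.wt (m1.arr 6) 3 x) ≤
            q * (q * I.dmax + I.dmax) * ((boxes m3 nb3 x : ℤ) - boxes m1 nb' x) +
            q * (2 * (q * (q * I.dmax) + I.dmax)) := F3
    have e10 : m3.reg 10 = (σ * k : ℕ) := by rw [S3.1 10 (by decide)]; simpa using h10
    have e12 : m3.reg 12 = σ := by rw [S3'.1 12 (by decide), h12]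
    refine Ens.assign ⟨⟨S3'.setReg (by decide) _, ?_, ?_, k + 1, nb3, by omega, ?_, ?_, ?_, ?_⟩, ?_⟩
    · intro s
      rw [Memory.setReg_arr, st3 s]
      split_ifs
      exacts [.inr rfl, h2 s]
    · intro s hs
      rw [Memory.setReg_arr, st3 s, h4 s hs]; simp
    · simp [Expr.eval, e10, e12]; ring
    · exact ⟨by simpa using hS3.1, hS3.2⟩
    · intro i hi hik s hs
      rw [Memory.setReg_arr, st3 s]
      rcases Nat.lt_succ_iff_lt_or_eq.mp hik with hik | rfl
      · rw [h5 i hi hik s hs]; simp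
      · rw [if_pos hs]
    · intro x
      have hbx : boxes (m3.setReg 10 (Expr.eval m3 (.add (.reg 10) (.reg 12)))) nb3 x =
        boxes m3 nb3 x := rfl
      rw [hbx, Memory.setReg_arr]
      have hm : (boxes m1 nb' x : ℤ) ≤ boxes m3 nb3 x := by exact_mod_cast mono3' x
      by_cases hnew : ∃ s : Fin n, m1.arr 6 s = 0 ∧ I.Live s (m.arr 5 (σ * k : ℕ)) ∧ I.Live s x
      · obtain ⟨s, hs0, hsv, hsx⟩ := hnew
        have hs0' : m.arr 6 s = 0 := (h03 s).resolve_right fun h => by have := h4 s h; omega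
        have hgx : I.Level q (m1.arr 6) (boxes m1 nb' x) g x := by
          refine (h6 x).2.resolve_right ?_
          -- A witness from an earlier line and the new sensor share `x`, so one of them crosses a
          -- coarser line and was placed before this level.
          rintro ⟨i, s', hi, hik, hx', hv', hs'⟩
          obtain ⟨j, hj1, hj2, hj⟩ := hL.cross hi hik hσ hkn hv' hsv hx' hsx
          rcases hj with hj | hj
          · have := h3 j hj1 hj2 s' hj; omega
          · have := h3 j hj1 hj2 s hj; omega
        refine ⟨?_, .inr ⟨k, s, hk, by omega, hsx, hsv, hs0'⟩⟩
        have := F3' x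
        unfold Level at hgx ⊢
        push_cast
        linarith
      · have ew : I.wt (m3.arr 6) 3 x = I.wt (m1.arr 6) 3 x := by
          refine wt_congr fun s hs => ?_
          rw [st3 s]
          split_ifs with h
          · have := (h2 s).resolve_left fun h0 => hnew ⟨s, h0, h, hs⟩
            tauto
          · rfl
        have up : ∀ g, I.Level q (m1.arr 6) (boxes m1 nb' x) g x →
            I.Level q (m3.arr 6) (boxes m3 nb3 x) g x := by
          intro g h
          unfold Level at h ⊢
          rw [ew]
          refine h.trans ?_
          gcongr
        refine ⟨up _ (h6 x).1, (h6 x).2.imp (up _) ?_⟩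
        rintro ⟨i, s, hi, hik, h⟩
        exact ⟨i, s, hi, by omega, h⟩
    · simp only [Expr.eval, Memory.setReg_reg, if_true, e10, e12, h10]
      omega
  · refine ⟨(Same.refl _ _ _).setReg (by decide) _, h03, fun _ h => h, 1, nb, le_rfl,
      by simp [Expr.eval, h12], ⟨by simpa using hS.1, hS.2⟩, fun i h1 h2 => by omega, fun x => ?_⟩
    exact ⟨hmono _ _ _ (hg x), .inl (hg x)⟩
  · simp [Expr.eval, h12]; omega
  · rintro m' ⟨⟨h1, h2, h4, k, nb', hk, h10, hS1, h5, h6⟩, hneg⟩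
    simp only [Expr.eval, h1.1 0 (by decide), hB.n_eq, h10] at hneg
    refine ⟨h1, h2, fun i hi hin s hs => h5 i hi ?_ s hs, nb', hS1, fun x => (h6 x).1⟩
    refine lt_of_mul_lt_mul_left (a := σ) ?_ (by omega)
    omega

/-- Compute the powers of two up to the first one that exceeds `n`. -/
def powers : Prog :=
  .seq (.store 16 (.const 0) (.const 1)) <| .seq (.assign 11 (.const 0)) <|
  .whilePos (.add (.sub (.reg 0) (.get 16 (.reg 11))) (.const 1)) <|
    .seq (.store 16 (.add (.reg 11) (.const 1))
      (.add (.get 16 (.reg 11)) (.get 16 (.reg 11))))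
    (.assign 11 (.add (.reg 11) (.const 1)))

/-- The machine cannot halve, so the powers are tabulated and later read in descending order. -/
theorem ens_powers {q : ℕ} {m : Memory} (hB : I.Base q m) (hn : 0 < n) :
    Ens powers m (50 * (n + 1)) (fun m' => Same [11] [16] m m' ∧
      ∃ G : ℕ, m'.reg 11 = G ∧ n < 2 ^ G ∧ G ≤ Nat.log 2 n + 1 ∧
        ∀ i : ℕ, i ≤ G → m'.arr 16 i = 2 ^ i) := by
  refine (Ens.seq (R := fun m' => m' = m.setArr 16 0 1) (t₁ := 3)
    (t₂ := 2 + (n + 1) * (6 + 1 + 13)) (Q := _)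
    (Prog.LoopFree.ens (by exact trivial) (by simp [Prog.cost, Expr.cost]) (by simp [Prog.exec, Expr.eval])) ?_).mono (by omega)
    fun m' hm' => hm'
  rintro m1 rfl
  refine Ens.seq (t₁ := 2) (Ens.assign (x := 11) (e := .const 0) rfl) ?_
  rintro m1 rfl
  refine (Ens.whilePos (N := n) (t := 13) (fun m' => Same [11] [16] m m' ∧
      ∃ G : ℕ, m'.reg 11 = G ∧ G ≤ Nat.log 2 n + 1 ∧ ∀ i : ℕ, i ≤ G → m'.arr 16 i = 2 ^ i)
    (fun m' => (n + 1 - m'.arr 16 (m'.reg 11)).toNat) ?_ ?_ ?_).mono le_rfl ?_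
  · rintro m1 ⟨h1, G, h2, h3, h4⟩ hpos
    have hG := h4 G le_rfl
    simp only [Expr.eval, h2, hG, h1.1 0 (by decide), hB.n_eq] at hpos
    have hle : 2 ^ G ≤ n := by
      have : (2 : ℤ) ^ G ≤ n := by omega
      exact_mod_cast this
    refine Prog.LoopFree.ens (by simp [Prog.LoopFree]) (by simp [Prog.cost, Expr.cost]) ?_
    simp only [Prog.exec]
    refine ⟨⟨(h1.setArr (by decide) _ _).setReg (by decide) _, G + 1, by simp [Expr.eval, h2],
      ?_, ?_⟩, ?_⟩
    · have := Nat.le_log_of_pow_le (by decide) hle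
      omega
    · intro i hi
      simp only [Expr.eval, h2, hG, Memory.setReg_arr, Memory.setArr_arr, if_true]
      rcases Nat.le_succ_iff.mp hi with hi | rfl
      · rw [Function.update_of_ne (by omega), h4 i hi]
      · rw [← Nat.cast_succ, Function.update_self, pow_succ]; ring
    · simp [Expr.eval, h2, hG]
      have : (0 : ℤ) < 2 ^ G := by positivity
      omega
  · refine ⟨((Same.refl _ _ _).setArr (by decide) _ _).setReg (by decide) _, 0,
      by simp [Expr.eval], by omega, fun i hi => ?_⟩
    obtain rfl : i = 0 := by omega
    simp
  · simp [Expr.eval]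
  · rintro m' ⟨⟨h1, G, h2, h3, h4⟩, hneg⟩
    simp only [Expr.eval, h2, h4 G le_rfl, h1.1 0 (by decide), hB.n_eq] at hneg
    refine ⟨h1, G, h2, ?_, h3, h4⟩
    have : (n : ℤ) < 2 ^ G := by omega
    exact_mod_cast this

/-- Put all sensors into boxes. -/
def levels : Prog :=
  .seq powers <| .whilePos (.reg 11) <|
    .seq (.assign 11 (.sub (.reg 11) (.const 1))) <| .seq (.assign 12 (.get 16 (.reg 11))) level

/-- Level `G` is vacuous because `2 ^ G` exceeds `n`. At level 0 every sensor crosses the line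
through its own left end, so all are placed after `G` levels, each of which costs one unit. -/
theorem ens_levels {q : ℕ} {m : Memory} (hn : 0 < n) (hB : I.Base q m) (hL : I.Lines (m.arr 5))
    (hS : I.MStacks q m 0 0) (h0 : ∀ s : Fin n, m.arr 6 s = 0) :
    Ens levels m (4000 * (n + 1) ^ 5) (fun m' =>
      Same [8, 9, 10, 11, 12, 13, 14, 17, 19] [6, 7, 8, 9, 10, 16] m m' ∧
      (∀ s : Fin n, m'.arr 6 s = 3) ∧
      ∃ nb' G, I.MStacks q m' nb' 0 ∧ G ≤ Nat.log 2 n + 1 ∧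
        ∀ x, I.Level q (m'.arr 6) (boxes m' nb' x) G x) := by
  have hX : 1 ≤ (n + 1) ^ 4 := Nat.one_le_pow _ _ (by omega)
  have hX' : (n + 1) ≤ (n + 1) ^ 5 := Nat.le_self_pow (by decide) _
  refine ((ens_powers hB hn).seq (t₂ := (n + 1) * (1 + 1 + (4 + (3 + 3000 * (n + 1) ^ 4))))
    (Q := _) ?_).mono (by nlinarith) fun m' hm' => hm'
  rintro m1 ⟨S1, G, h11, hnG, hG, hpw⟩
  have hGn : G ≤ n := by
    have := Nat.log_lt_self 2 (show n ≠ 0 by omega)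
    omega
  let J : Memory → Prop := fun m' =>
    Same [8, 9, 10, 11, 12, 13, 14, 17, 19] [6, 7, 8, 9, 10, 16] m m' ∧
      (∀ i : ℕ, i ≤ G → m'.arr 16 i = 2 ^ i) ∧
      (∀ s : Fin n, m'.arr 6 s = 0 ∨ m'.arr 6 s = 3) ∧
      ∃ j nb' : ℕ, j ≤ G ∧ m'.reg 11 = j ∧ I.MStacks q m' nb' 0 ∧
        (∀ i, 1 ≤ i → 2 ^ j * i ≤ n → ∀ s, I.Live s (m.arr 5 (2 ^ j * i : ℕ)) → m'.arr 6 s = 3) ∧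
        ∀ x, I.Level q (m'.arr 6) (boxes m' nb' x) (G - j) x
  refine (Ens.whilePos (N := n) (t := 4 + (3 + 3000 * (n + 1) ^ 4)) J
    (fun m' => (m'.reg 11).toNat) ?_ ?_ ?_).mono le_rfl ?_
  · rintro m' ⟨h1, h2, h3, j, nb', hj, h4, h5, h6, h7⟩ hpos
    simp only [Expr.eval, h4] at hpos
    obtain ⟨j, rfl⟩ : ∃ i, j = i + 1 := ⟨j - 1, by omega⟩
    refine Ens.seq (t₁ := 4) (Ens.assign (x := 11) (e := .sub (.reg 11) (.const 1)) rfl) ?_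
    rintro m2 rfl
    have e11 : Expr.eval m' (.sub (.reg 11) (.const 1)) = j := by simp [Expr.eval, h4]
    rw [e11]
    refine Ens.seq (t₁ := 3) (Ens.assign (x := 12) (e := .get 16 (.reg 11)) rfl) ?_
    rintro m2 rfl
    have e12 : Expr.eval (m'.setReg 11 j) (.get 16 (.reg 11)) = (2 ^ j : ℕ) := by
      simp [Expr.eval, h2 j (by omega)]
    rw [e12]
    have S2 : Same [8, 9, 10, 11, 12, 13, 14, 17, 19] [6, 7, 8, 9, 10, 16] m
        ((m'.setReg 11 j).setReg 12 (2 ^ j : ℕ)) :=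
      (h1.setReg (by decide) _).setReg (by decide) _
    have e5 : m'.arr 5 = m.arr 5 := h1.2 5 (by decide)
    refine (ens_level (σ := 2 ^ j) (nb := nb') (g := G - (j + 1))
      (hB.same S2 (by decide) (by decide)) (by simpa [e5] using hL)
      ⟨by simpa using h5.1, h5.2⟩ h3 (by positivity) (by simp) ?_ h7).mono le_rfl ?_
    · intro i hi hin s hs
      have e : 2 ^ (j + 1) * i = 2 * 2 ^ j * i := by ring
      refine h6 i hi (by rwa [e]) s ?_
      rw [e]
      simpa [e5] using hs
    · rintro m3 ⟨S3, g3, g4, nb3, g5, g6⟩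
      have r11 : m3.reg 11 = j := by rw [S3.1 11 (by decide)]; simp
      refine ⟨⟨S2.trans (S3.mono (by decide) (by decide)), ?_, g3, j, nb3, by omega,
        r11, g5, ?_, ?_⟩, ?_⟩
      · rw [S3.2 16 (by decide)]; exact h2
      · intro i hi hin s hs
        exact g4 i hi hin s (by simpa [e5] using hs)
      · have e : G - j = G - (j + 1) + 1 := by omega
        rw [e]; exact g6
      · rw [r11, h4]; simp
  · have e6 : m1.arr 6 = m.arr 6 := S1.2 6 (by decide)
    refine ⟨S1.mono (by decide) (by decide), hpw, fun s => .inl (by rw [e6, h0]), G, 0, le_rfl, h11,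
      ?_, ?_, ?_⟩
    · refine ⟨by rw [S1.1 14 (by decide), hS.1], ?_⟩
      rw [e6, S1.2 7 (by decide), S1.2 8 (by decide), S1.2 9 (by decide), S1.2 10 (by decide)]
      exact hS.2
    · intro i hi hin
      have : 2 ^ G * 1 ≤ 2 ^ G * i := Nat.mul_le_mul_left _ hi
      omega
    · intro x
      have : I.wt (m1.arr 6) 3 x = 0 := Finset.sum_eq_zero fun s _ => by simp [e6, h0]
      unfold Level
      rw [this]
      simp
      positivity
  · simp [h11, hGn]
  · rintro m' ⟨⟨h1, h2, h3, j, nb', hj, h4, h5, h6, h7⟩, hneg⟩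
    simp only [Expr.eval, h4] at hneg
    obtain rfl : j = 0 := by omega
    refine ⟨h1, fun s => ?_, nb', G, h5, hG, by simpa using h7⟩
    obtain ⟨i, hi, hin, hil⟩ := hL.all s
    refine h6 i hi (by simpa using hin) s ?_
    simp only [pow_zero, one_mul, hil]
    exact ⟨le_rfl, I.left_lt_right s⟩

end RSC

/-! ### The least number of boxes at a point -/

namespace RSC

open RAM

variable {n : ℕ} {I : RSC n}

/-- Count the indices `i < N` with `lo i ≤ reg 19 < hi i`. -/
def count (lo hi N out : ℕ) : Prog :=
  .seq (.assign out (.const 0)) <| forLt 8 N <|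
    .ifPos (.sub (.get lo (.reg 8)) (.reg 19)) .skip <|
    .ifPos (.sub (.get hi (.reg 8)) (.reg 19)) (.assign out (.add (.reg out) (.const 1))) .skip

theorem ens_count {lo hi N out k : ℕ} {m : Memory} (hN : m.reg N = k) (h8 : out ≠ 8)
    (h19 : out ≠ 19) (hN8 : N ≠ 8) (hNo : N ≠ out) :
    Ens (count lo hi N out) m (40 * (k + 1)) (fun m' => Agree out m m' ∧
      m'.reg out = cnt (m.arr lo) (m.arr hi) k (m.reg 19)) := by
  refine (Ens.seq (Ens.assign (x := out) (e := .const 0) rfl) (t₂ := 2 + (k + 1) * (20 + 8))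
    (Q := _) ?_).mono (by simp [Expr.cost]; omega) fun m' hm' => hm'
  rintro m1 rfl
  refine (ens_forLt (fun i m' => Agree out m m' ∧
    m'.reg out = cnt (m.arr lo) (m.arr hi) i (m.reg 19)) hN8 ?_ ?_ ?_).mono le_rfl
    fun m' hm' => hm'.1
  · rintro i m1 hik ⟨hA, hs⟩ h1 h2
    refine Prog.LoopFree.ens (by simp [Prog.LoopFree]) (by simp [Prog.cost, Expr.cost]) ?_
    have e19 : m1.reg 19 = m.reg 19 := hA.2 19 (by decide) h19.symm
    have old : ¬ (m.arr lo i ≤ m.reg 19 ∧ m.reg 19 < m.arr hi i) →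
        m1.reg 8 = i ∧ m1.reg N = k ∧ Agree out m (m1.setReg 8 (i + 1)) ∧
        (m1.setReg 8 (i + 1)).reg out = cnt (m.arr lo) (m.arr hi) (i + 1) (m.reg 19) := by
      refine fun h => ⟨h1, h2, hA.setReg (.inl rfl) _, ?_⟩
      rw [cnt_succ, if_neg h]
      simp [h8, hs]
    simp only [Prog.exec, Expr.eval, h1, hA.1, e19]
    split_ifs with c1 c2
    · exact old (by omega)
    · refine ⟨by simp [h8.symm, h1], by simp [hNo, h2],
        (hA.setReg (.inr rfl) _).setReg (.inl rfl) _, ?_⟩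
      rw [cnt_succ, if_pos (by omega)]
      simp [h8, hs]
    · exact old (by omega)
  · exact ⟨⟨rfl, fun y hy hy' => by simp [hy, hy']⟩, by simp [h8, Expr.eval, cnt]⟩
  · simp [hNo, hN]

/-- If `reg 19` lies in the target, lower `reg 15` to the number of boxes there. -/
def probe : Prog :=
  .seq (count 0 1 0 16) <| .seq (count 9 10 14 18) <|
    .ifPos (.reg 16) (.ifPos (.sub (.reg 15) (.reg 18)) (.assign 15 (.reg 18)) .skip) .skip

/-- An end of a sensor need not lie in the target, so the number of sensors there is counted as well
and the minimum is updated only if it is positive. -/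
theorem ens_probe {q nb kk : ℕ} {m : Memory} {v : ℤ} (hB : I.Base q m) (hnb : m.reg 14 = nb)
    (hn : nb ≤ n) (hv : m.reg 19 = v) (hk : m.reg 15 = kk) :
    Ens probe m (100 * (n + 1)) (fun m' => Same [8, 15, 16, 18] [] m m' ∧ ∃ kk' : ℕ,
      m'.reg 15 = kk' ∧ kk' ≤ kk ∧ ((∃ s, I.Live s v) → kk' ≤ boxes m nb v) ∧
        (kk' = kk ∨ (∃ s, I.Live s v) ∧ boxes m nb v = kk')) := by
  refine ((ens_count hB.n_eq (by decide) (by decide) (by decide) (by decide)).seq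
    (t₂ := 40 * (nb + 1) + 10) (Q := _) ?_).mono (by omega) fun m' hm' => hm'
  rintro m1 ⟨A1, c1⟩
  refine (ens_count (k := nb) (by rw [A1.2 14 (by decide) (by decide), hnb]) (by decide) (by decide)
    (by decide) (by decide)).seq (Q := _) ?_
  rintro m2 ⟨A2, c2⟩
  refine Prog.LoopFree.ens (by simp [Prog.LoopFree]) (by simp [Prog.cost, Expr.cost]) ?_
  have S2 : Same [8, 15, 16, 18] [] m m2 :=
    (A1.same (by decide) (by decide)).trans (A2.same (by decide) (by decide))
  have e16 : m2.reg 16 = cnt (m.arr 0) (m.arr 1) n v := by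
    rw [A2.2 16 (by decide) (by decide), c1, hv]
  have e18 : m2.reg 18 = boxes m nb v := by
    rw [c2, A1.1, A1.2 19 (by decide) (by decide), hv]; rfl
  have e15 : m2.reg 15 = kk := by
    rw [A2.2 15 (by decide) (by decide), A1.2 15 (by decide) (by decide), hk]
  have hlive : 0 < cnt (m.arr 0) (m.arr 1) n v ↔ ∃ s, I.Live s v := by
    unfold cnt
    rw [Finset.card_pos]
    constructor
    · rintro ⟨i, hi⟩
      simp only [Finset.mem_filter, Finset.mem_range] at hi
      have h1 := hB.left_eq ⟨i, hi.1⟩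
      have h2 := hB.right_eq ⟨i, hi.1⟩
      exact ⟨⟨i, hi.1⟩, h1 ▸ hi.2.1, h2 ▸ hi.2.2⟩
    · rintro ⟨s, hs⟩
      refine ⟨s, ?_⟩
      simp only [Finset.mem_filter, Finset.mem_range, s.2, true_and, hB.left_eq, hB.right_eq]
      exact hs
  simp only [Prog.exec, Expr.eval, e15, e16, e18]
  split_ifs with h1 h2
  · have h := hlive.1 (by exact_mod_cast h1)
    refine ⟨S2.setReg (by decide) _, boxes m nb v, by simp, by omega, fun _ => le_rfl, .inr ⟨h, rfl⟩⟩
  · exact ⟨S2, kk, e15, le_rfl, fun _ => by omega, .inl rfl⟩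
  · refine ⟨S2, kk, e15, le_rfl, fun h => ?_, .inl rfl⟩
    have := hlive.2 h
    omega

/-- Set `reg 15` to the least number of boxes at a point of the target. -/
def minBoxes : Prog :=
  .seq (.assign 15 (.reg 14)) <| forLt 17 0 <|
    .seq (.assign 19 (.get 0 (.reg 17))) <| .seq probe <|
    .seq (.assign 19 (.get 1 (.reg 17))) probe

/-- The number of boxes at `x` is the number at the last end of a sensor before `x`. -/
theorem exists_end {q nb : ℕ} {m : Memory} (hS : I.MStacks q m nb 0) {x : ℤ}
    (hx : ∃ s, I.Live s x) : ∃ v, (∃ s, v = I.left s ∨ v = I.right s) ∧ (∃ s, I.Live s v) ∧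
      boxes m nb v = boxes m nb x := by
  obtain ⟨s, hs⟩ := hx
  -- Both the boxes and the sensors have ends among the sensor ends, so nothing changes between the
  -- last such end `v ≤ x` and `x`.
  let E : Finset ℤ := (Finset.univ.image I.left ∪ Finset.univ.image I.right).filter (· ≤ x)
  have hE : E.Nonempty := ⟨I.left s, by simp [E, hs.1]⟩
  have hv := E.max'_mem hE
  set v := E.max' hE with hvdef
  simp only [E, Finset.mem_filter, Finset.mem_union, Finset.mem_image, Finset.mem_univ,
    true_and] at hv
  have key : ∀ y, (∃ s, y = I.left s ∨ y = I.right s) → (y ≤ x ↔ y ≤ v) := by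
    rintro y ⟨s', hs'⟩
    refine ⟨fun h => E.le_max' y ?_, fun h => h.trans hv.2⟩
    simp only [E, Finset.mem_filter, Finset.mem_union, Finset.mem_image, Finset.mem_univ,
      true_and]
    exact ⟨hs'.imp (fun h => ⟨s', h.symm⟩) fun h => ⟨s', h.symm⟩, h⟩
  refine ⟨v, ?_, ⟨s, (key _ ⟨s, .inl rfl⟩).1 hs.1, ?_⟩, ?_⟩
  · rcases hv.1 with ⟨s', h⟩ | ⟨s', h⟩
    exacts [⟨s', .inl h.symm⟩, ⟨s', .inr h.symm⟩]
  · exact not_le.mp fun h => absurd ((key _ ⟨s, .inr rfl⟩).2 h) (not_le.mpr hs.2)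
  · unfold boxes cnt
    congr 1
    refine Finset.filter_congr fun k hk => ?_
    rw [Finset.mem_range] at hk
    obtain ⟨a, ha⟩ := hS.2.left_end k hk
    obtain ⟨b, hb⟩ := hS.2.right_end k hk
    rw [← not_le (a := m.arr 10 k), ← not_le (a := m.arr 10 k), ha, hb, key _ ⟨a, .inl rfl⟩,
      key _ ⟨b, .inr rfl⟩]

/-- Probing sensor ends suffices by `exists_end`. The initial value is the number of all boxes; if
it is never replaced, the last claim holds because no point lies in more boxes than there are. -/
theorem ens_minBoxes {q nb : ℕ} {m : Memory} (hn : 0 < n) (hB : I.Base q m)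
    (hS : I.MStacks q m nb 0) : Ens minBoxes m (300 * (n + 1) ^ 2) (fun m' =>
      Same [8, 15, 16, 17, 18, 19] [] m m' ∧ ∃ kk : ℕ, m'.reg 15 = kk ∧ kk ≤ n ∧
        (∀ x, (∃ s, I.Live s x) → kk ≤ boxes m nb x) ∧
        ∃ x, (∃ s, I.Live s x) ∧ boxes m nb x ≤ kk) := by
  have hnb := hS.2.nb_le
  refine (Ens.seq (Ens.assign (x := 15) (e := .reg 14) rfl)
    (t₂ := 2 + (n + 1) * (3 + (100 * (n + 1) + (3 + 100 * (n + 1))) + 8))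
    (Q := _) ?_).mono (by simp [Expr.cost]; nlinarith) fun m' hm' => hm'
  rintro m1 rfl
  refine (ens_forLt (n := n) (t := 3 + (100 * (n + 1) + (3 + 100 * (n + 1)))) (fun i m' =>
    Same [8, 15, 16, 17, 18, 19] [] m m' ∧ ∃ kk : ℕ, m'.reg 15 = kk ∧ kk ≤ nb ∧
      (kk = nb ∨ ∃ x, (∃ s, I.Live s x) ∧ boxes m nb x = kk) ∧
      ∀ s : Fin n, (s : ℕ) < i → ∀ v, (v = I.left s ∨ v = I.right s) → (∃ s, I.Live s v) →
        kk ≤ boxes m nb v) (by decide) ?_ ?_ ?_).mono le_rfl ?_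
  · rintro i m1 hi ⟨S1, kk, h15, hkk, hmin, hall⟩ h17 h0
    obtain ⟨s, rfl⟩ : ∃ s : Fin n, (s : ℕ) = i := ⟨⟨i, hi⟩, rfl⟩
    have hB1 : I.Base q m1 := hB.same S1 (by decide) (by decide)
    refine (Ens.assign (x := 19) (e := .get 0 (.reg 17)) rfl).seq (t₁ := 3) ?_
    rintro m2 rfl
    have S2 := S1.setReg (x := 19) (by decide) (Expr.eval m1 (.get 0 (.reg 17)))
    have b2 : ∀ m2, Same [8, 15, 16, 17, 18, 19] [] m m2 → ∀ v, boxes m2 nb v = boxes m nb v :=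
      fun m2 h v => by unfold boxes; rw [h.2 9 (by decide), h.2 10 (by decide)]
    refine (ens_probe (v := I.left s) (hB.same S2 (by decide) (by decide))
      (by rw [S2.1 14 (by decide), hS.1]) hnb (by simp [Expr.eval, h17, hB1.left_eq])
      (by simpa using h15)).seq ?_
    rintro m3 ⟨S3, k3, r3, le3, live3, eq3⟩
    rw [b2 _ S2] at live3 eq3
    have S3' := S2.trans (S3.mono (by decide) (by decide))
    have r17 : m3.reg 17 = (s : ℕ) := by rw [S3.1 17 (by decide)]; simpa using h17
    have hB3 : I.Base q m3 := hB.same S3' (by decide) (by decide)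
    refine (Ens.assign (x := 19) (e := .get 1 (.reg 17)) rfl).seq (t₁ := 3) ?_
    rintro m4 rfl
    have S4 := S3'.setReg (x := 19) (by decide) (Expr.eval m3 (.get 1 (.reg 17)))
    refine (ens_probe (v := I.right s) (hB.same S4 (by decide) (by decide))
      (by rw [S4.1 14 (by decide), hS.1]) hnb (by simp [Expr.eval, r17, hB3.right_eq])
      (by simpa using r3)).mono le_rfl ?_
    rintro m5 ⟨S5, k5, r5, le5, live5, eq5⟩
    rw [b2 _ S4] at live5 eq5
    have S5' := S4.trans (S5.mono (by decide) (by decide))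
    refine ⟨?_, ?_, S5'.setReg (by decide) _, k5, by simpa using r5, by omega, ?_, ?_⟩
    · rw [S5.1 17 (by decide)]; simpa using r17
    · rw [S5'.1 0 (by decide), hB.n_eq]
    · rcases eq5 with rfl | ⟨h, h'⟩
      · rcases eq3 with rfl | ⟨h, h'⟩
        · exact hmin
        · exact .inr ⟨_, h, h'⟩
      · exact .inr ⟨_, h, h'⟩
    · intro s' hs' v hv hlive
      by_cases e : s' = s
      · subst e
        rcases hv with rfl | rfl
        · exact le5.trans (live3 hlive)
        · exact live5 hlive
      · have : (s' : ℕ) ≠ s := fun h => e (Fin.ext h)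
        exact (le5.trans le3).trans (hall s' (by omega) v hv hlive)
  · exact ⟨((Same.refl _ _ _).setReg (by decide) _).setReg (by decide) _, nb,
      by simpa [Expr.eval] using hS.1, le_rfl, .inl rfl, fun s h => by omega⟩
  · simpa using hB.n_eq
  · rintro m' ⟨⟨S1, kk, h15, hkk, hmin, hall⟩, -⟩
    refine ⟨S1, kk, h15, hkk.trans hnb, fun x hx => ?_, ?_⟩
    · obtain ⟨v, ⟨s, hv⟩, hlive, e⟩ := exists_end hS hx
      rw [← e]
      exact hall s s.2 v hv hlive
    · rcases hmin with rfl | ⟨x, hx, h⟩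
      · have hlive : I.Live ⟨0, hn⟩ (I.left ⟨0, hn⟩) := ⟨le_rfl, I.left_lt_right _⟩
        refine ⟨_, ⟨_, hlive⟩, ?_⟩
        exact (Finset.card_filter_le _ _).trans (Finset.card_range _).le
      · exact ⟨x, hx, h.le⟩

end RSC

/-! ### Distributing the boxes to slots -/

namespace RSC

open RAM

variable {n : ℕ} {I : RSC n}

/-- Prepare `reg 15` slots of length `reg 5`, all with frontier `loc 1`. -/
def slots : Prog :=
  .seq (.assign 16 (.const 0)) <| forLt 17 15 <|
    .seq (.store 12 (.reg 17) (.reg 16)) <| .seq (.store 11 (.reg 17) (.get 5 (.const 1))) <|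
    .assign 16 (.add (.reg 16) (.reg 5))

theorem ens_slots {m : Memory} {kk : ℕ} {D : ℤ} (hk : m.reg 15 = kk) (hD : m.reg 5 = D) :
    Ens slots m (40 * (kk + 1)) (fun m' => Same [16, 17] [11, 12] m m' ∧
      ∀ c : ℕ, c < kk → m'.arr 12 c = c * D ∧ m'.arr 11 c = m.arr 5 1) := by
  refine (Ens.seq (Ens.assign (x := 16) (e := .const 0) rfl) (t₂ := 2 + (kk + 1) * (20 + 8))
    (Q := _) ?_).mono (by simp [Expr.cost]; omega) fun m' hm' => hm'
  rintro m1 rfl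
  refine (ens_forLt (n := kk) (t := 20) (fun i m' => Same [16, 17] [11, 12] m m' ∧
    m'.reg 16 = i * D ∧ ∀ c : ℕ, c < i → m'.arr 12 c = c * D ∧ m'.arr 11 c = m.arr 5 1)
    (by decide) ?_ ?_ ?_).mono le_rfl fun m' hm' => ⟨hm'.1.1, hm'.1.2.2⟩
  · rintro i m1 hi ⟨h1, h2, h3⟩ h17 h15
    have e5 : m1.arr 5 = m.arr 5 := h1.2 5 (by decide)
    refine Prog.LoopFree.ens (by simp [Prog.LoopFree]) (by simp [Prog.cost, Expr.cost]) ?_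
    simp only [Prog.exec]
    refine ⟨by simpa using h17, by simpa using h15, (((h1.setArr (by decide) _ _).setArr
      (by decide) _ _).setReg (by decide) _).setReg (by decide) _, ?_, ?_⟩
    · simp [Expr.eval, h2, h1.1 5 (by decide), hD]; ring
    · intro c hc
      rcases Nat.lt_succ_iff_lt_or_eq.mp hc with hc | rfl
      · have : ((c : ℕ) : ℤ) ≠ i := by omega
        simpa [Expr.eval, h17, Function.update_of_ne this] using h3 c hc
      · simp [Expr.eval, h17, h2, e5]
  · exact ⟨((Same.refl _ _ _).setReg (by decide) _).setReg (by decide) _, by simp [Expr.eval],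
      by omega⟩
  · simpa using hk

/-- The boxes with `st k ≠ 0` have been distributed to `kk` slots of length `D`, in the order of
their left ends, each to the slot with the least frontier. -/
structure Greedy (BL BR st time fr : ℤ → ℤ) (nb kk : ℕ) (D x₀ : ℤ) : Prop where
  order : ∀ k < nb, ∀ k' < nb, st k ≠ 0 → st k' = 0 → BL k ≤ BL k'
  slot : ∀ k < nb, st k ≠ 0 → ∃ c < kk, time k = c * D ∧ BR k ≤ fr c
  front : ∀ c < kk, fr c = x₀ ∨ ∃ k < nb, st k ≠ 0 ∧ time k = c * D ∧ BR k = fr c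
  inj : ∀ x, x₀ ≤ x →
    (∃ c < kk, ∀ k < nb, st k ≠ 0 → time k = c * D → ¬ (BL k ≤ x ∧ x < BR k)) →
    ∀ k < nb, ∀ k' < nb, st k ≠ 0 → st k' ≠ 0 → BL k ≤ x ∧ x < BR k → BL k' ≤ x ∧ x < BR k' →
      time k = time k' → k = k'

theorem update_nat (f : ℤ → ℤ) (i : ℕ) (v : ℤ) (j : ℕ) :
    Function.update f (i : ℤ) v (j : ℤ) = if j = i then v else f j := by
  by_cases h : j = i
  · subst h; simp
  · simp [h]

/-- The point is `inj`: wherever some slot leaves `x` uncovered, no two boxes at `x` share a slot. A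
box is added to a slot that already covers `x` only if all frontiers exceed `x`; then every slot has
a box reaching beyond `x`, and that box starts no later than the new one, so it contains `x`. -/
theorem Greedy.push {BL BR st time fr : ℤ → ℤ} {nb kk : ℕ} {D x₀ : ℤ}
    (h : Greedy BL BR st time fr nb kk D x₀) (hD : 0 < D) {k c : ℕ} (hk : k < nb) (hs : st k = 0)
    (hmin : ∀ k' < nb, st k' = 0 → BL k ≤ BL k') (hc : c < kk) (hfr : ∀ c' < kk, fr c ≤ fr c') :
    Greedy BL BR (Function.update st k 1) (Function.update time k (c * D))
      (Function.update fr c (max (fr c) (BR k))) nb kk D x₀ := by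
  have cinj : ∀ c' : ℕ, (c : ℤ) * D = c' * D → c' = c := fun c' h => by
    have := mul_right_cancel₀ hD.ne' h
    exact_mod_cast this.symm
  have hold : ∀ k', st k' ≠ 0 → k' ≠ (k : ℤ) := fun k' h' e => h' (e ▸ hs)
  constructor
  · intro k₁ h₁ k₂ h₂ hs₁ hs₂
    rw [update_nat] at hs₁ hs₂
    split_ifs at hs₂ with e₂
    · omega
    split_ifs at hs₁ with e₁
    · rw [e₁]; exact hmin k₂ h₂ hs₂
    · exact h.order k₁ h₁ k₂ h₂ hs₁ hs₂
  · intro k₁ h₁ hs₁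
    by_cases e₁ : k₁ = k
    · subst e₁
      exact ⟨c, hc, by simp, by simp⟩
    · rw [update_nat, if_neg e₁] at hs₁
      obtain ⟨c', hc', ht, hb⟩ := h.slot k₁ h₁ hs₁
      refine ⟨c', hc', by rw [update_nat, if_neg e₁, ht], ?_⟩
      rw [update_nat]
      split_ifs with e
      · subst e; exact hb.trans (le_max_left _ _)
      · exact hb
  · intro c' hc'
    have lift : (fr c' = x₀ ∨ ∃ k < nb, st k ≠ 0 ∧ time k = c' * D ∧ BR k = fr c') →
        fr c' = x₀ ∨ ∃ k₁ < nb, Function.update st k 1 k₁ ≠ 0 ∧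
          Function.update time k (c * D) k₁ = c' * D ∧ BR k₁ = fr c' := by
      refine Or.imp_right ?_
      rintro ⟨k₁, h₁, hs₁, ht₁, hb₁⟩
      have e₁ : k₁ ≠ k := fun e => hs₁ (e ▸ hs)
      exact ⟨k₁, h₁, by rwa [update_nat, if_neg e₁], by rwa [update_nat, if_neg e₁], hb₁⟩
    by_cases e : c' = c
    · subst e
      rw [Function.update_self]
      rcases max_choice (fr c') (BR k) with hm | hm
      · rw [hm]; exact lift (h.front c' hc')
      · rw [hm]; exact .inr ⟨k, hk, by simp, by simp, rfl⟩
    · rw [update_nat, if_neg e]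
      exact lift (h.front c' hc')
  · rintro x hx ⟨c', hc', hun⟩
    have hun' : ∀ k < nb, st k ≠ 0 → time k = c' * D → ¬ (BL k ≤ x ∧ x < BR k) := by
      intro k₁ h₁ hs₁ ht₁
      have e₁ : k₁ ≠ k := fun e => hs₁ (e ▸ hs)
      exact hun k₁ h₁ (by rwa [update_nat, if_neg e₁]) (by rwa [update_nat, if_neg e₁])
    -- No earlier box at `x` sits in slot `c` if the new box contains `x`: otherwise the frontier of
    -- the uncovered slot `c'` would exceed `x`, and the box attaining it would cover `x`.
    have main : ∀ k₁ < nb, st k₁ ≠ 0 → BL k₁ ≤ x ∧ x < BR k₁ → BL k ≤ x ∧ x < BR k →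
        time k₁ ≠ c * D := by
      intro k₁ h₁ hs₁ hx₁ hxk ht
      obtain ⟨c₁, hc₁, ht₁, hb₁⟩ := h.slot k₁ h₁ hs₁
      obtain rfl : c₁ = c := cinj c₁ (ht.symm.trans ht₁)
      have hlt : x < fr c' := hx₁.2.trans_le (hb₁.trans (hfr c' hc'))
      rcases h.front c' hc' with he | ⟨k₂, h₂, hs₂, ht₂, hb₂⟩
      · omega
      · exact hun' k₂ h₂ hs₂ ht₂ ⟨(h.order k₂ h₂ k hk hs₂ hs).trans hxk.1, by omega⟩
    intro k₁ h₁ k₂ h₂ hs₁ hs₂ hx₁ hx₂ ht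
    rw [update_nat] at hs₁ hs₂
    rw [update_nat, update_nat] at ht
    by_cases e₁ : k₁ = k <;> by_cases e₂ : k₂ = k
    · rw [e₁, e₂]
    · rw [if_pos e₁, if_neg e₂] at ht
      rw [if_neg e₂] at hs₂
      subst e₁
      exact absurd ht.symm (main k₂ h₂ hs₂ hx₂ hx₁)
    · rw [if_neg e₁, if_pos e₂] at ht
      rw [if_neg e₁] at hs₁
      subst e₂
      exact absurd ht (main k₁ h₁ hs₁ hx₁ hx₂)
    · rw [if_neg e₁, if_neg e₂] at ht
      rw [if_neg e₁] at hs₁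
      rw [if_neg e₂] at hs₂
      exact h.inj x hx ⟨c', hc', hun'⟩ k₁ h₁ k₂ h₂ hs₁ hs₂ hx₁ hx₂ ht

/-- Once all boxes have been distributed, every slot covers every point with enough boxes. -/
theorem Greedy.covers {BL BR st time fr : ℤ → ℤ} {nb kk : ℕ} {D x₀ : ℤ}
    (h : Greedy BL BR st time fr nb kk D x₀) (hall : ∀ k < nb, st (k : ℕ) ≠ 0) {x : ℤ}
    (hx : x₀ ≤ x) (hk : kk ≤ cnt BL BR nb x) {c : ℕ} (hc : c < kk) :
    ∃ k < nb, time (k : ℕ) = c * D ∧ BL k ≤ x ∧ x < BR k := by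
  by_contra hne
  have hun : ∀ k < nb, st (k : ℕ) ≠ 0 → time k = c * D → ¬ (BL k ≤ x ∧ x < BR k) :=
    fun k hk _ ht hx => hne ⟨k, hk, ht, hx⟩
  have hslot : ∀ k < nb, ∃ c < kk, time (k : ℕ) = (c : ℕ) * D := fun k hk => by
    obtain ⟨c, h1, h2, -⟩ := h.slot k hk (hall k hk)
    exact ⟨c, h1, h2⟩
  choose! f hf1 hf2 using hslot
  -- Pigeonhole: at least `kk` boxes at `x` go to the `kk - 1` slots other than `c`, so two share a
  -- slot although slot `c` leaves `x` uncovered.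
  have hmaps : ∀ k ∈ (Finset.range nb).filter (fun k : ℕ => BL k ≤ x ∧ x < BR k),
      f k ∈ (Finset.range kk).erase c := by
    intro k hk
    simp only [Finset.mem_filter, Finset.mem_range] at hk
    refine Finset.mem_erase.mpr ⟨fun e => ?_, Finset.mem_range.mpr (hf1 k hk.1)⟩
    exact hun k hk.1 (hall k hk.1) (by rw [hf2 k hk.1, e]) hk.2
  obtain ⟨k, hk1, k', hk1', hkk, he⟩ := Finset.exists_ne_map_eq_of_card_lt_of_maps_to
    (s := (Finset.range nb).filter (fun k : ℕ => BL k ≤ x ∧ x < BR k)) (by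
      rw [Finset.card_erase_of_mem (Finset.mem_range.mpr hc), Finset.card_range]
      unfold cnt at hk
      omega) hmaps
  simp only [Finset.mem_filter, Finset.mem_range] at hk1 hk1'
  exact hkk (h.inj x hx ⟨c, hc, hun⟩ k hk1.1 k' hk1'.1 (hall k hk1.1) (hall k' hk1'.1) hk1.2 hk1'.2
    (by rw [hf2 k hk1.1, hf2 k' hk1'.1, he]))

/-- Distribute the boxes to the slots. -/
def greedy : Prog :=
  forSel 14 0 9 14 (.const 1) <|
    .seq (select 13 0 11 15 20) <|
    .seq (.store 15 (.reg 9) (.get 12 (.reg 20))) <|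
    .seq (.ifPos (.sub (.get 10 (.reg 9)) (.get 11 (.reg 20)))
      (.store 11 (.reg 20) (.get 10 (.reg 9))) .skip) <|
    .store 14 (.reg 9) (.const 1)

/-- Array 13 stays zero, so the selection of the least frontier ranges over all slots. Array 15 is
kept nonnegative in every cell, including those that belong to no closed box. -/
theorem ens_greedy {m : Memory} {nb kk N : ℕ} {D x₀ : ℤ} (hnb : m.reg 14 = nb)
    (hkk : m.reg 15 = kk) (hN : nb ≤ N) (hN' : kk ≤ N) (hk0 : 0 < kk) (hD : 0 < D)
    (h13 : ∀ i : ℕ, i < kk → m.arr 13 i = 0) (h14 : ∀ i : ℕ, i < nb → m.arr 14 i = 0)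
    (h15 : ∀ i, 0 ≤ m.arr 15 i)
    (hsl : ∀ c : ℕ, c < kk → m.arr 12 c = c * D ∧ m.arr 11 c = x₀) :
    Ens greedy m (300 * (N + 1) ^ 2) (fun m' => Same [8, 9, 20] [11, 14, 15] m m' ∧
      (∀ i, 0 ≤ m'.arr 15 i) ∧
      ∀ x, x₀ ≤ x → kk ≤ boxes m nb x → ∀ c : ℕ, c < kk →
        ∃ k < nb, m'.arr 15 (k : ℕ) = c * D ∧ m.arr 9 k ≤ x ∧ x < m.arr 10 k) := by
  refine (ens_forSel (t := 60 * (kk + 1) + 30) (n := nb) (fun m' =>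
    Same [8, 9, 20] [11, 14, 15] m m' ∧ (∀ i, 0 ≤ m'.arr 15 i) ∧
      Greedy (m.arr 9) (m.arr 10) (m'.arr 14) (m'.arr 15) (m'.arr 11) nb kk D x₀)
    ?_ (by decide) (by decide) ?_ ?_ ?_ ?_ (by simp [Expr.eval])).mono ?_ ?_
  · rintro m' ⟨h, -⟩
    rw [h.1 14 (by decide), hnb]
  · rintro m1 m2 hA ⟨h1, h2, h3⟩
    exact ⟨h1.trans (hA.same (by decide) (by decide)), by rwa [hA.1], by rwa [hA.1]⟩
  · rintro m1 m2 hA; rfl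
  · rintro m1 i ⟨h1, h2, h3⟩ - hi ⟨hin, hi1, himin⟩
    refine (ens_select (n := kk) (by rw [h1.1 15 (by decide), hkk]) (by decide) (by decide)
      (by decide)).seq ?_
    rintro m2 ⟨hA, hs⟩
    have S2 := h1.trans (hA.same (rs := [8, 9, 20]) (as := [11, 14, 15]) (by decide) (by decide))
    rw [h1.2 13 (by decide)] at hs
    obtain ⟨c, hc9, hc, -, hcmin⟩ := hs.resolve_left fun h => h.2 0 hk0 (h13 0 hk0)
    refine Prog.LoopFree.ens (by simp [Prog.LoopFree]) (by simp [Prog.cost, Expr.cost]) ?_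
    have e9 : m2.reg 9 = i := by rw [hA.2 9 (by decide) (by decide), hi]
    have e12 : m2.arr 12 c = c * D := by rw [S2.2 12 (by decide), (hsl c hc).1]
    have e10 : m2.arr 10 = m.arr 10 := S2.2 10 (by decide)
    rw [h1.2 9 (by decide)] at himin
    have push := h3.push hD hin hi1 (fun k' hk' => himin k' hk') hc
      (fun c' hc' => hcmin c' hc' (h13 c' hc'))
    simp only [← hA.1] at push h2
    have fin : ∀ m3 : Memory, m3 = ((m2.setArr 15 i (c * D)).setArr 11 c
        (max (m2.arr 11 c) (m.arr 10 i))).setArr 14 i 1 →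
        (Same [8, 9, 20] [11, 14, 15] m m3 ∧ (∀ i, 0 ≤ m3.arr 15 i) ∧
          Greedy (m.arr 9) (m.arr 10) (m3.arr 14) (m3.arr 15) (m3.arr 11) nb kk D x₀) ∧
        ∃ v, v ≠ 0 ∧ m3.arr 14 = Function.update (m1.arr 14) i v := by
      rintro m3 rfl
      refine ⟨⟨((S2.setArr (by decide) _ _).setArr (by decide) _ _).setArr (by decide) _ _,
        fun j => ?_, by simpa using push⟩, 1, by decide, by simp [hA.1]⟩
      simp only [Memory.setArr_arr, Nat.reduceEqDiff, if_false, if_true, Function.update_apply]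
      split_ifs
      exacts [mul_nonneg (by positivity) hD.le, h2 j]
    simp only [Prog.exec, Expr.eval, e9, hc9, e12, e10, Memory.setArr_arr, Memory.setArr_reg,
      Nat.reduceEqDiff, if_false]
    apply fin
    split_ifs with hlt
    · simp only [Memory.setArr_reg, e9]
      rw [max_eq_right (by omega)]
    · simp only [Memory.setArr_reg, e9]
      rw [max_eq_left (by omega)]
      -- When the frontier is not raised, writing the maximum rewrites the old value.
      congr 1
      conv_lhs => rw [← Memory.setArr_self (m2.setArr 15 i (c * D)) 11 c]
      simp
  · refine ⟨Same.refl _ _ _, h15, ?_⟩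
    refine ⟨fun k hk k' _ h => absurd (h14 k hk) h, fun k hk h => absurd (h14 k hk) h,
      fun c hc => .inl (hsl c hc).2, fun x _ _ k hk k' _ h => absurd (h14 k hk) h⟩
  · simp only [Expr.cost]; nlinarith
  · rintro m' ⟨⟨h1, h2, h3⟩, h5⟩
    have h5' : ∀ j : ℕ, j < nb → m'.arr 14 j ≠ 0 := by simpa [Expr.eval] using h5
    exact ⟨h1, h2, fun x hx hb c hc => h3.covers h5' hx hb hc⟩

/-- Write the start times. -/
def output : Prog :=
  forLt 17 0 <| .store 3 (.reg 17) (.add (.get 15 (.get 7 (.reg 17))) (.get 8 (.reg 17)))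

theorem ens_output {m : Memory} (h0 : m.reg 0 = n) :
    Ens output m (30 * (n + 1)) (fun m' =>
      ∀ s : Fin n, m'.arr 3 s = m.arr 15 (m.arr 7 s) + m.arr 8 s) := by
  refine (ens_forLt (n := n) (t := 10) (fun i m' => Same [17] [3] m m' ∧
    ∀ s : Fin n, (s : ℕ) < i → m'.arr 3 s = m.arr 15 (m.arr 7 s) + m.arr 8 s)
    (by decide) ?_ ?_ h0).mono (by omega) fun m' hm' s => hm'.1.2 s s.2
  · rintro i m1 hi ⟨h1, h2⟩ h17 h0
    obtain ⟨s, rfl⟩ : ∃ s : Fin n, (s : ℕ) = i := ⟨⟨i, hi⟩, rfl⟩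
    refine Prog.LoopFree.ens (by simp [Prog.LoopFree]) (by simp [Prog.cost, Expr.cost]) ?_
    simp only [Prog.exec, Expr.eval, h17]
    refine ⟨by simpa using h17, by simpa using h0, (h1.setArr (by decide) _ _).setReg
      (by decide) _, fun s' hs' => ?_⟩
    simp only [Memory.setReg_arr, Memory.setArr_arr, if_true, update_fin]
    by_cases e : s' = s
    · rw [if_pos e, e, h1.2 15 (by decide), h1.2 7 (by decide), h1.2 8 (by decide)]
    · have : (s' : ℕ) ≠ s := fun h => e (Fin.ext h)
      rw [if_neg e, h2 s' (by omega)]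
  · exact ⟨(Same.refl _ _ _).setReg (by decide) _, by omega⟩

end RSC

/-! ### The whole program -/

namespace RSC

open RAM

variable {n : ℕ} {I : RSC n}

/-- Compute the largest duration, and negate the right ends. -/
def setupMax : Prog :=
  forLt 17 0 <|
    .seq (.ifPos (.sub (.get 2 (.reg 17)) (.reg 3)) (.assign 3 (.get 2 (.reg 17))) .skip)
      (.store 4 (.reg 17) (.sub (.const 0) (.get 1 (.reg 17))))

/-- Compute the least `q` with `7 b ≤ q a`, and `q dmax`. -/
def setupQuot : Prog :=
  .seq (.assign 7 (.add (.reg 2) (.add (.reg 2) (.add (.reg 2) (.add (.reg 2) (.add (.reg 2)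
    (.add (.reg 2) (.reg 2)))))))) <|
  .whilePos (.reg 7) <|
    .seq (.assign 7 (.sub (.reg 7) (.reg 1))) <| .seq (.assign 4 (.add (.reg 4) (.const 1))) <|
    .assign 5 (.add (.reg 5) (.reg 3))

/-- Compute `q (q dmax)`. -/
def setupSize : Prog := forLt 17 4 <| .assign 6 (.add (.reg 6) (.reg 5))

theorem listed_fin (f : Fin n → ℤ) (s : Fin n) : listed f (s : ℕ) = f s := by
  simp [listed]

theorem ens_setupMax (a b : ℕ) :
    Ens setupMax (I.input a b) (50 * (n + 1)) (fun m' =>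
      Same [3, 17] [4] (I.input a b) m' ∧ m'.reg 3 = I.dmax ∧
        ∀ s : Fin n, m'.arr 4 s = -I.right s) := by
  refine (ens_forLt (n := n) (t := 30) (fun i m' => Same [3, 17] [4] (I.input a b) m' ∧
    m'.reg 3 = ((Finset.univ.filter fun s : Fin n => (s : ℕ) < i).sup I.dur : ℕ) ∧
    ∀ s : Fin n, (s : ℕ) < i → m'.arr 4 s = -I.right s)
    (by decide) ?_ ?_ (by simp [input])).mono (by omega) ?_
  · rintro i m1 hi ⟨h1, h2, h3⟩ h17 h0
    obtain ⟨s, rfl⟩ : ∃ s : Fin n, (s : ℕ) = i := ⟨⟨i, hi⟩, rfl⟩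
    have e1 : m1.arr 1 s = I.right s := by
      rw [h1.2 1 (by decide)]; simp [input, listed_fin]
    have e2 : m1.arr 2 s = I.dur s := by
      rw [h1.2 2 (by decide)]; simp [input, listed_fin]
    have hsup : (Finset.univ.filter fun s' : Fin n => (s' : ℕ) < s + 1).sup I.dur =
        max (I.dur s) ((Finset.univ.filter fun s' : Fin n => (s' : ℕ) < s).sup I.dur) := by
      have : (Finset.univ.filter fun s' : Fin n => (s' : ℕ) < s + 1) =
          insert s (Finset.univ.filter fun s' : Fin n => (s' : ℕ) < s) := by
        ext s'
        simp only [Finset.mem_filter, Finset.mem_univ, true_and, Finset.mem_insert, Fin.ext_iff]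
        omega
      rw [this, Finset.sup_insert]
    refine Prog.LoopFree.ens (by simp [Prog.LoopFree]) (by simp [Prog.cost, Expr.cost]) ?_
    have fin : ∀ m2 : Memory, Same [3, 17] [4] (I.input a b) m2 → m2.arr = m1.arr →
        m2.reg 17 = (s : ℕ) → m2.reg 0 = n → m2.reg 3 =
          (max (I.dur s) ((Finset.univ.filter fun s' : Fin n => (s' : ℕ) < s).sup I.dur) : ℕ) →
        (fun m' : Memory => m'.reg 17 = (s : ℕ) ∧ m'.reg 0 = n ∧
          Same [3, 17] [4] (I.input a b) (m'.setReg 17 ((s : ℕ) + 1)) ∧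
          (m'.setReg 17 ((s : ℕ) + 1)).reg 3 =
            ((Finset.univ.filter fun s' : Fin n => (s' : ℕ) < s + 1).sup I.dur : ℕ) ∧
          ∀ s' : Fin n, (s' : ℕ) < s + 1 →
            (m'.setReg 17 ((s : ℕ) + 1)).arr 4 s' = -I.right s')
          (m2.setArr 4 (m2.reg 17) (0 - m2.arr 1 (m2.reg 17))) := by
      intro m2 hS harr h17' h0' h3'
      refine ⟨by simpa using h17', by simpa using h0',
        (hS.setArr (by decide) _ _).setReg (by decide) _, 
        by simp only [Memory.setReg_reg, Memory.setArr_reg, Nat.reduceEqDiff, if_false, h3', hsup], fun s' hs' => ?_⟩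
      simp only [Memory.setReg_arr, Memory.setArr_arr, if_true, h17', update_fin, harr, e1]
      by_cases e : s' = s
      · rw [if_pos e, e]; simp
      · have : (s' : ℕ) ≠ s := fun h => e (Fin.ext h)
        rw [if_neg e, h3 s' (by omega)]
    have c : (0 < Expr.eval m1 (.sub (.get 2 (.reg 17)) (.reg 3))) ↔
        (Finset.univ.filter fun s' : Fin n => (s' : ℕ) < s).sup I.dur < I.dur s := by
      simp only [Expr.eval, h17, e2, h2]; omega
    simp only [Prog.exec, c]
    split_ifs with c
    · refine fin (m1.setReg 3 (Expr.eval m1 (.get 2 (.reg 17)))) (h1.setReg (by decide) _) rfl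
        (by simpa using h17) (by simpa using h0) ?_
      rw [max_eq_left c.le]; simp [Expr.eval, h17, e2]
    · refine fin m1 h1 rfl h17 h0 ?_
      rw [max_eq_right (by omega), h2]
  · exact ⟨(Same.refl _ _ _).setReg (by decide) _, by simp [input], by omega⟩
  · rintro m' ⟨⟨h1, h2, h3⟩, -⟩
    refine ⟨h1, ?_, fun s => h3 s s.2⟩
    rw [h2, Finset.filter_true_of_mem fun s _ => s.2]
    rfl

/-- Division by repeated subtraction. It takes `O(b / a)` rounds, which is `O(1/ε)` for the given
fraction, and the same rounds accumulate `q * dmax`. -/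
theorem ens_setupQuot {m : Memory} {a b Q : ℕ} (hQ : 7 * b / a = Q) (ha : 0 < a) (h1 : m.reg 1 = a) (h2 : m.reg 2 = b)
    (h4 : m.reg 4 = 0) (h5 : m.reg 5 = 0) :
    Ens setupQuot m (50 * (Q + 2)) (fun m' => Same [4, 5, 7] [] m m' ∧
      ∃ q : ℕ, m'.reg 4 = q ∧ m'.reg 5 = q * m.reg 3 ∧ 7 * b ≤ q * a ∧ q ≤ Q + 1) := by
  refine (Ens.seq (Ens.assign rfl) (t₂ := (Q + 1 + 1) * (1 + 1 + 12)) (Q := _) ?_).mono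
    (by simp [Expr.cost]; omega) fun m' hm' => hm'
  rintro m1 rfl
  refine (Ens.whilePos (N := Q + 1) (t := 12) (fun m' => Same [4, 5, 7] [] m m' ∧
    ∃ q : ℕ, m'.reg 4 = q ∧ m'.reg 5 = q * m.reg 3 ∧ m'.reg 7 = 7 * b - q * a ∧
      q ≤ Q + 1) (fun m' => (Q + 1 - m'.reg 4).toNat) ?_ ?_ ?_).mono le_rfl ?_
  · rintro m' ⟨hS, q, r4, r5, r7, hq⟩ hpos
    simp only [Expr.eval, r7] at hpos
    have hlt : q * a < 7 * b := by
      have : (q : ℤ) * a < 7 * b := by omega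
      exact_mod_cast this
    have hq' : q ≤ Q := hQ ▸ (Nat.le_div_iff_mul_le ha).mpr hlt.le
    refine Prog.LoopFree.ens (by simp [Prog.LoopFree]) (by simp [Prog.cost, Expr.cost]) ?_
    simp only [Prog.exec]
    refine ⟨⟨((hS.setReg (by decide) _).setReg (by decide) _).setReg (by decide) _, q + 1,
      by simp [Expr.eval, r4], ?_, ?_, by omega⟩, ?_⟩
    · simp [Expr.eval, r5, hS.1 3 (by decide)]; ring
    · simp [Expr.eval, r7, hS.1 1 (by decide), h1]; ring
    · simp only [Expr.eval, Memory.setReg_reg, Nat.reduceEqDiff, if_false, if_true, r4]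
      omega
  · exact ⟨(Same.refl _ _ _).setReg (by decide) _, 0, by simpa using h4, by simpa using h5,
      by simp [Expr.eval, h2]; ring, by omega⟩
  · simp [h4]
  · rintro m' ⟨⟨hS, q, r4, r5, r7, hq⟩, hneg⟩
    simp only [Expr.eval, r7] at hneg
    refine ⟨hS, q, r4, r5, ?_, hq⟩
    have : (7 : ℤ) * b ≤ q * a := by omega
    exact_mod_cast this

theorem ens_setupSize {m : Memory} {q : ℕ} (h4 : m.reg 4 = q) (h6 : m.reg 6 = 0) :
    Ens setupSize m (20 * (q + 1)) (fun m' => Same [6, 17] [] m m' ∧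
      m'.reg 6 = q * m.reg 5) := by
  refine (ens_forLt (n := q) (t := 4) (fun i m' => Same [6, 17] [] m m' ∧
    m'.reg 6 = i * m.reg 5) (by decide) ?_ ?_ h4).mono (by omega) fun m' hm' => hm'.1
  · rintro i m1 hi ⟨h1, h2⟩ h17 h4
    refine Ens.assign ⟨by simpa using h17, by simpa using h4,
      (h1.setReg (by decide) _).setReg (by decide) _, ?_⟩
    simp [Expr.eval, h2, h1.1 5 (by decide)]; ring
  · exact ⟨(Same.refl _ _ _).setReg (by decide) _, by simpa using h6⟩

/-- Prepare the arrays and constants that the main part uses. -/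
def setup : Prog := .seq setupMax (.seq setupQuot setupSize)

theorem ens_setup {a b Q : ℕ} (hQ : 7 * b / a = Q) (hn : 0 < n) (ha : 0 < a) (hab : a ≤ b) :
    Ens setup (I.input a b) (200 * (n + 1 + (Q + 1))) (fun m' =>
      Same [3, 4, 5, 6, 7, 17] [4] (I.input a b) m' ∧ ∃ q : ℕ, I.Base q m' ∧ 7 * b ≤ q * a ∧
        q ≤ Q + 1) := by
  refine ((ens_setupMax a b).seq (t₂ := 50 * (Q + 2) + 20 * (Q + 1 + 1))
    (Q := _) ?_).mono (by omega) fun m' hm' => hm'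
  rintro m1 ⟨S1, r3, a4⟩
  have S1' := S1.mono (rs' := [3, 4, 5, 6, 7, 17]) (as' := [4]) (by decide) (by decide)
  refine (ens_setupQuot hQ (a := a) (b := b) ha (by rw [S1.1 1 (by decide)]; simp [input])
    (by rw [S1.1 2 (by decide)]; simp [input]) (by rw [S1.1 4 (by decide)]; simp [input])
    (by rw [S1.1 5 (by decide)]; simp [input])).seq ?_
  rintro m2 ⟨S2, q, r4, r5, hq, hq'⟩
  have S2' := S1'.trans (S2.mono (rs' := [3, 4, 5, 6, 7, 17]) (as' := [4]) (by decide) (by decide))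
  refine (ens_setupSize r4 (by rw [S2.1 6 (by decide), S1.1 6 (by decide)]; simp [input])).mono
    (by omega) ?_
  rintro m3 ⟨S3, r6⟩
  have S3' := S2'.trans (S3.mono (rs' := [3, 4, 5, 6, 7, 17]) (as' := [4]) (by decide) (by decide))
  refine ⟨S3', q, ?_, hq, hq'⟩
  -- From `a ≤ b` and `7 b ≤ q a`.
  have q7 : 7 ≤ q := by
    by_contra h
    have : q * a ≤ 6 * a := Nat.mul_le_mul_right _ (by omega)
    omega
  constructor
  · rw [S3'.1 0 (by decide)]; simp [input]
  · rw [S3.1 3 (by decide), S2.1 3 (by decide), r3]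
  · rw [S3.1 4 (by decide), r4]
  · rw [S3.1 5 (by decide), r5, r3]
  · rw [r6, r5, r3]
  · intro s; rw [S3'.2 0 (by decide)]; simp [input, listed_fin]
  · intro s; rw [S3'.2 1 (by decide)]; simp [input, listed_fin]
  · intro s; rw [S3'.2 2 (by decide)]; simp [input, listed_fin]
  · intro s; rw [S3.2 4 (by decide), S2.2 4 (by decide), a4]
  · omega
  · exact (I.dur_pos ⟨0, hn⟩).trans_le (I.dur_le_dmax _)

/-- The program for at least two sensors. -/
def solve : Prog :=
  .seq setup <| .seq sortLines <| .seq levels <| .seq minBoxes <|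
    .seq (.ifPos (.reg 15) (.seq slots greedy) .skip) output

/-- The same point `x` carries the final estimate: it attains the minimum `kk`, so the box bound
there limits the live weight, and thus the load, in terms of `kk`. -/
theorem ens_solve {a b Q : ℕ} (hQ : 7 * b / a = Q) (hn : 0 < n) (ha : 0 < a) (hab : a ≤ b) :
    Ens solve (I.input a b) (10000 * (n + 1 + (Q + 1)) ^ 5) (fun m' =>
      ∃ q kk G : ℕ, 7 * b ≤ q * a ∧ q ≤ Q + 1 ∧ G ≤ Nat.log 2 n + 1 ∧
        (∀ s : Fin n, 0 ≤ m'.arr 3 s) ∧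
        (∀ x, (∃ s, I.Live s x) → ∀ y : ℤ, 0 ≤ y → y < kk * (q * I.dmax) →
          ∃ s : Fin n, I.Live s x ∧ m'.arr 3 s ≤ y ∧ y < m'.arr 3 s + I.dur s) ∧
        ∃ x, (∃ s, I.Live s x) ∧
          ((q : ℤ) - 3) * (∑ s, if I.Live s x then (I.dur s : ℤ) else 0) ≤
            q * (q * I.dmax + I.dmax) * kk + G * (q * (2 * (q * (q * I.dmax) + I.dmax)))) := by
  set Y := n + 1 + (Q + 1) with hY
  have hnY : n + 1 ≤ Y := by omega
  have p2 : (n + 1) ^ 2 ≤ Y ^ 5 :=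
    (Nat.pow_le_pow_left hnY 2).trans (Nat.pow_le_pow_right (by omega) (by decide))
  have p5 : (n + 1) ^ 5 ≤ Y ^ 5 := Nat.pow_le_pow_left hnY 5
  have p1 : Y ≤ Y ^ 5 := Nat.le_self_pow (by decide) _
  refine ((ens_setup hQ hn ha hab).seq (t₂ := 200 * (n + 1) ^ 2 + (4000 * (n + 1) ^ 5 +
    (300 * (n + 1) ^ 2 + ((1 + 1 + (40 * (n + 1) + 300 * (n + 1) ^ 2)) + 30 * (n + 1)))))
    (Q := _) ?_).mono (by omega) fun m' hm' => hm'
  rintro m1 ⟨S1, q, hB, hq, hq'⟩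
  have z1 : ∀ A, A ∉ [0, 1, 2, 4] → ∀ i, m1.arr A i = 0 := fun A hA i => by
    simp only [List.mem_cons, List.not_mem_nil, or_false, not_or] at hA
    rw [S1.2 A (by simp [hA])]
    simp [input, hA]
  refine (ens_sortLines hB fun s => z1 17 (by decide) s).seq ?_
  rintro m2 ⟨S2, hL⟩
  have hB2 : I.Base q m2 := hB.same S2 (by decide) (by decide)
  have z2 : ∀ A, A ∉ [0, 1, 2, 4, 5, 17] → ∀ i, m2.arr A i = 0 := fun A hA i => by
    simp only [List.mem_cons, List.not_mem_nil, or_false, not_or] at hA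
    rw [S2.2 A (by simp [hA]), z1 A (by simp [hA])]
  have hS2 : I.MStacks q m2 0 0 := by
    refine ⟨?_, fun k hk => by omega, fun k hk => by omega, fun k hk => by omega,
      fun x y _ _ h1 h2 => by omega, fun h => by omega, fun h => by omega, fun k hk => by omega,
      fun h => by omega, fun s => by rw [z2 8 (by decide)], le_rfl⟩
    rw [S2.1 14 (by decide), S1.1 14 (by decide)]
    simp [input]
  refine (ens_levels hn hB2 hL hS2 fun s => z2 6 (by decide) s).seq ?_
  rintro m3 ⟨S3, st3, nb, G, hS3, hG, hlev⟩
  have hB3 : I.Base q m3 := hB2.same S3 (by decide) (by decide)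
  refine (ens_minBoxes hn hB3 hS3).seq ?_
  rintro m4 ⟨S4, kk, r15, hkn, hkk, x, hx, hxk⟩
  have S34 : Same [8, 9, 10, 11, 12, 13, 14, 15, 16, 17, 18, 19] [6, 7, 8, 9, 10, 16] m2 m4 :=
    (S3.mono (by decide) (by decide)).trans (S4.mono (by decide) (by decide))
  have z4 : ∀ A, A ∉ [0, 1, 2, 4, 5, 6, 7, 8, 9, 10, 16, 17] → ∀ i, m4.arr A i = 0 :=
    fun A hA i => by
      simp only [List.mem_cons, List.not_mem_nil, or_false, not_or] at hA
      rw [S34.2 A (by simp [hA]), z2 A (by simp [hA])]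
  have r5 : m4.reg 5 = q * I.dmax := by rw [S34.1 5 (by decide), hB2.D_eq]
  have b4 : ∀ x, boxes m4 nb x = boxes m3 nb x := fun x => by
    unfold boxes; rw [S4.2 9 (by decide), S4.2 10 (by decide)]
  have dist : Ens (.ifPos (.reg 15) (.seq slots greedy) .skip) m4
      (1 + 1 + (40 * (n + 1) + 300 * (n + 1) ^ 2)) (fun m' =>
        m'.reg 0 = n ∧ (∀ i, 0 ≤ m'.arr 15 i) ∧ m'.arr 7 = m3.arr 7 ∧ m'.arr 8 = m3.arr 8 ∧
        ∀ x, (∃ s, I.Live s x) → ∀ c : ℕ, c < kk → ∃ k < nb,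
          m'.arr 15 (k : ℕ) = c * (q * I.dmax) ∧ m3.arr 9 k ≤ x ∧ x < m3.arr 10 k) := by
    refine Ens.ifPos (fun hpos => ?_) (fun hneg => ?_)
    · simp only [Expr.eval, r15] at hpos
      refine ((ens_slots r15 r5).mono (Nat.mul_le_mul_left 40 (by omega)) fun _ h => h).seq ?_
      rintro m5 ⟨S5, hsl⟩
      have z5 : ∀ A, A ∈ [13, 14, 15] → ∀ i, m5.arr A i = 0 := fun A hA i => by
        simp only [List.mem_cons, List.not_mem_nil, or_false] at hA
        rw [S5.2 A (by rcases hA with rfl | rfl | rfl <;> decide),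
          z4 A (by rcases hA with rfl | rfl | rfl <;> decide)]
      refine (ens_greedy (nb := nb) (kk := kk) (N := n)
        (by rw [S5.1 14 (by decide), S4.1 14 (by decide), hS3.1])
        (by rw [S5.1 15 (by decide), r15]) hS3.2.nb_le hkn (by omega) hB.D_pos
        (fun i _ => z5 13 (by decide) i) (fun i _ => z5 14 (by decide) i)
        (fun i => (z5 15 (by decide) i).ge) hsl).mono le_rfl ?_
      rintro m6 ⟨S6, h15, hcov⟩
      refine ⟨?_, h15, ?_, ?_, fun x hx c hc => ?_⟩
      · rw [S6.1 0 (by decide), S5.1 0 (by decide), S34.1 0 (by decide), hB2.n_eq]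
      · rw [S6.2 7 (by decide), S5.2 7 (by decide), S4.2 7 (by decide)]
      · rw [S6.2 8 (by decide), S5.2 8 (by decide), S4.2 8 (by decide)]
      · have b5 : boxes m5 nb x = boxes m3 nb x := by
          unfold boxes
          rw [S5.2 9 (by decide), S5.2 10 (by decide), S4.2 9 (by decide), S4.2 10 (by decide)]
        have h := hcov x ?_ (by rw [b5]; exact hkk x hx) c hc
        · rwa [S5.2 9 (by decide), S5.2 10 (by decide), S4.2 9 (by decide), S4.2 10 (by decide)]
            at h
        · obtain ⟨s, hs⟩ := hx
          obtain ⟨i, hi, hin, hil⟩ := hL.all s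
          rw [S34.2 5 (by decide)]
          -- The initial frontier is the least left end, so it lies to the left of every point of
          -- the target.
          exact (hL.mono 1 i le_rfl hi hin).trans (hil.le.trans hs.1)
    · simp only [Expr.eval, r15] at hneg
      refine (Ens.skip ?_).mono (by omega) fun _ h => h
      refine ⟨by rw [S34.1 0 (by decide), hB2.n_eq], fun i => (z4 15 (by decide) i).ge,
        S4.2 7 (by decide), S4.2 8 (by decide), fun x _ c hc => by omega⟩
  refine dist.seq ?_
  rintro m5 ⟨r0, h15, a7, a8, hcov⟩
  refine (ens_output r0).mono le_rfl ?_
  intro m6 h3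
  refine ⟨q, kk, G, hq, by omega, hG, fun s => ?_, fun x hx y hy0 hy => ?_, x, hx, ?_⟩
  · rw [h3 s, a8]
    -- The box number of a sensor in an abandoned box may exceed those of the closed boxes, so
    -- nonnegativity is needed in all cells.
    exact add_nonneg (h15 _) (hS3.2.off_nonneg s)
  · have hD := hB.D_pos
    -- Write `y = c D + r` with `0 ≤ r < D`: the box that slot `c` has at `x` contains a sensor
    -- covering height `r`.
    have hc0 : 0 ≤ y / (q * I.dmax) := Int.ediv_nonneg hy0 hD.le
    have hck : y / (q * I.dmax) < kk := Int.ediv_lt_of_lt_mul hD hy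
    obtain ⟨k, hk, ht, hl, hr⟩ := hcov x hx (y / (q * I.dmax)).toNat (by omega)
    obtain ⟨s, -, hbx, h4, h5, hlive⟩ := hS3.2.full k hk x (y % (q * I.dmax)) hl hr
      (Int.emod_nonneg _ hD.ne') (Int.emod_lt_of_pos _ hD)
    have e : m6.arr 3 s = y / (q * I.dmax) * (q * I.dmax) + m3.arr 8 s := by
      rw [h3 s, a7, a8, hbx, ht, Int.toNat_of_nonneg hc0]
    have := Int.mul_ediv_add_emod y (q * I.dmax)
    rw [mul_comm] at this
    exact ⟨s, hlive, by omega, by omega⟩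
  · have h := hlev x
    unfold Level at h
    have e : I.wt (m3.arr 6) 3 x = ∑ s, if I.Live s x then (I.dur s : ℤ) else 0 := by
      unfold wt
      simp [st3]
    rw [e] at h
    refine h.trans ?_
    gcongr

end RSC

/-! ### Passage to real points, the numerical bound and the conclusion -/

namespace RSC

open RAM

variable {n : ℕ} {I : RSC n}

theorem mem_region_iff {s : Fin n} {x : ℝ} : x ∈ I.region s ↔ I.Live s ⌊x⌋ := by
  simp only [region, Set.mem_Ico, Live, Int.le_floor, Int.floor_lt]

theorem mem_target_iff {x : ℝ} : x ∈ I.target ↔ ∃ s, I.Live s ⌊x⌋ := by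
  simp only [target, Set.mem_iUnion, mem_region_iff]

theorem load_le_of_live {x : ℤ} (hx : ∃ s, I.Live s x) :
    (I.load : ℤ) ≤ ∑ s, if I.Live s x then (I.dur s : ℤ) else 0 := by
  have h : I.load ≤ I.loadAt (x : ℝ) :=
    Nat.sInf_le ⟨x, mem_target_iff.2 (by rwa [Int.floor_intCast]), rfl⟩
  have e : (I.loadAt (x : ℝ) : ℤ) = ∑ s, if I.Live s x then (I.dur s : ℤ) else 0 := by
    classical
    rw [loadAt, Finset.sum_filter]
    push_cast
    refine Finset.sum_congr rfl fun s _ => ?_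
    simp only [mem_region_iff, Int.floor_intCast]
  rw [← e]
  exact_mod_cast h

/-- All data are integers, so a point in space or time is covered exactly when its floor is. -/
theorem isSchedule_of_int {t : Fin n → ℤ} {T : ℤ} (h0 : ∀ s, 0 ≤ t s)
    (h : ∀ x, (∃ s, I.Live s x) → ∀ y, 0 ≤ y → y < T →
      ∃ s, I.Live s x ∧ t s ≤ y ∧ y < t s + I.dur s) :
    I.IsSchedule (fun s => (t s : ℝ)) T := by
  refine ⟨fun s => Int.cast_nonneg (h0 s), fun x hx y hy0 hyT => ?_⟩
  obtain ⟨s, hs, h1, h2⟩ := h ⌊x⌋ (mem_target_iff.1 hx) ⌊y⌋ (Int.floor_nonneg.2 hy0)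
    (Int.floor_lt.2 hyT)
  refine ⟨s, mem_region_iff.2 hs, Int.le_floor.1 h1, ?_⟩
  have := Int.floor_lt.1 h2
  push_cast at this
  exact this

/-- Since `q (q d + d) k = (q + 1) (k q d)`, dividing by `q + 1` leaves the duration and a loss of
at most `2 (q² + 1) d G`. As `q` is of order `1/ε`, this loss has order `d G / ε²`, which is relaxed
to `1 / ε ^ 4`. The constant is `1356 = 2 * 226 * 3`, with `226 = 15² + 1`. -/
theorem duration_bound {ε q W L d k G l : ℝ} (hε : 0 < ε) (hε1 : ε ≤ 1) (hq : 7 ≤ q * ε)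
    (hq' : q * ε ≤ 15) (hL0 : 0 ≤ L) (hLW : L ≤ W) (hd : 0 ≤ d) (hG0 : 0 ≤ G) (hG : G ≤ 3 * l)
    (h : (q - 3) * W ≤ q * (q * d + d) * k + G * (q * (2 * (q * (q * d) + d)))) :
    L / (1 + ε) - 1356 * (d * l * (1 / ε ^ 4)) ≤ k * (q * d) := by
  have hq7 : 7 ≤ q := by
    by_contra hc
    nlinarith
  obtain ⟨w, hw⟩ : ∃ w, w = L / (1 + ε) := ⟨_, rfl⟩
  have hw0 : 0 ≤ w := hw ▸ by positivity
  have hLw : L = (1 + ε) * w := by rw [hw]; field_simp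
  -- This fixes the constant 7: `(q - 3) (1 + ε) ≥ q + 1` amounts to `q ε - 3 ε ≥ 4`, which holds
  -- for `7 ≤ q ε` and `ε ≤ 1`.
  have h1 : (q + 1) * w ≤ (q - 3) * L := by
    rw [hLw, ← mul_assoc]
    exact mul_le_mul_of_nonneg_right (by nlinarith) hw0
  have h2 : (q - 3) * L ≤ (q - 3) * W := mul_le_mul_of_nonneg_left hLW (by linarith)
  have hdG : 0 ≤ (q ^ 2 + 1) * (d * G) := by positivity
  have h3 : (q + 1) * w ≤ (q + 1) * (k * (q * d) + 2 * ((q ^ 2 + 1) * (d * G))) := by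
    nlinarith
  have h4 : w ≤ k * (q * d) + 2 * ((q ^ 2 + 1) * (d * G)) :=
    le_of_mul_le_mul_left h3 (by linarith)
  have h5 : q ^ 2 + 1 ≤ 226 * (1 / ε ^ 4) := by
    rw [mul_one_div, le_div_iff₀ (by positivity)]
    have e2 : ε ^ 2 ≤ 1 := by nlinarith
    have e4 : ε ^ 4 ≤ 1 := by nlinarith
    have : (q * ε) ^ 2 ≤ 15 ^ 2 := by gcongr
    nlinarith [sq_nonneg (q * ε)]
  have h6 : (q ^ 2 + 1) * (d * G) ≤ 226 * (1 / ε ^ 4) * (d * (3 * l)) := by gcongr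
  rw [← hw]
  nlinarith

/-- Both terms on the left are at most `log n / log 2`, and `2 / log 2 < 3`. -/
theorem natLog_two_add_one_le {n : ℕ} (hn : 2 ≤ n) :
    ((Nat.log 2 n : ℕ) : ℝ) + 1 ≤ 3 * Real.log n := by
  have h2 := Real.log_two_gt_d9
  have h : Real.log 2 ≤ Real.log n := Real.log_le_log (by norm_num) (by exact_mod_cast hn)
  have h' : (Nat.log 2 n : ℝ) * Real.log 2 ≤ Real.log n := by
    rw [← Real.log_pow]
    refine Real.log_le_log (by positivity) ?_
    exact_mod_cast Nat.pow_log_le_self 2 (by omega)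
  nlinarith [Nat.cast_nonneg (α := ℝ) (Nat.log 2 n)]

/-- The complete algorithm: it does nothing if there is only one sensor. -/
def schedule : Prog := .ifPos (.sub (.reg 0) (.const 1)) solve .skip

theorem runs_schedule_one (I : RSC 1) (a b : ℕ) :
    Runs schedule (I.input a b) (I.input a b) 5 :=
  .ifPos_nonpos solve (by simp [Expr.eval, input]) (.skip _)

theorem load_le_dur_one (I : RSC 1) : I.load ≤ I.dur 0 := by
  have h := load_le_of_live (I := I) (x := I.left 0) ⟨0, le_rfl, I.left_lt_right 0⟩
  have : I.Live 0 (I.left 0) := ⟨le_rfl, I.left_lt_right 0⟩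
  simp only [Finset.univ_unique, Fin.default_eq_zero, Finset.sum_singleton, this, if_true] at h
  exact_mod_cast h

theorem isSchedule_one (I : RSC 1) (a b : ℕ) :
    I.IsSchedule (I.input a b).startTimes (I.dur 0 : ℝ) := by
  have e : (I.input a b).startTimes = fun _ : Fin 1 => ((0 : ℤ) : ℝ) := by
    funext s
    simp [Memory.startTimes, input]
  rw [e]
  refine isSchedule_of_int (T := I.dur 0) (fun _ => le_rfl) fun x ⟨s, hs⟩ y h0 h1 => ?_
  rw [Subsingleton.elim s 0] at hs
  exact ⟨0, hs, h0, by omega⟩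

end RSC

open RSC in
theorem mainTheorem8 :
    ∃ (P : RAM.Prog) (ε₀ C : ℝ) (K : ℕ), 0 < ε₀ ∧
      ∀ ε : ℝ, 0 < ε → ε ≤ ε₀ →
      -- the fraction through which the program is told `ε`
      ∀ a b : ℕ, 0 < b → ε / 2 ≤ (a : ℝ) / b → (a : ℝ) / b ≤ ε →
      ∀ n : ℕ, 0 < n → ∀ I : RSC n,
        ∃ (m : RAM.Memory) (steps : ℕ),
          RAM.Runs P (I.input a b) m steps ∧
          (steps : ℝ) ≤ K * ((n : ℝ) + 1 / ε) ^ K ∧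
          ∃ T : ℝ, 0 ≤ T ∧
            (I.load : ℝ) / (1 + ε) - C * (I.dmax * Real.log n * (1 / ε ^ 4)) ≤ T ∧
            I.IsSchedule m.startTimes T := by
  -- `K` serves as factor and as exponent. The factor comes from `10000 (15 X) ^ 5`; the additional
  -- 5 pays for the initial test and for the run with a single sensor.
  obtain ⟨K, hK⟩ : ∃ K : ℕ, K = 10000 * 15 ^ 5 + 5 := ⟨_, rfl⟩
  have hK5 : 5 ≤ K := by omega
  have hKr : (K : ℝ) = 10000 * 15 ^ 5 + 5 := by rw [hK]; norm_num
  clear hK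
  refine ⟨schedule, 1, 1356, K, one_pos, fun ε hε hε1 a b hb hεa haε n hn I => ?_⟩
  have hbr : (0 : ℝ) < b := by exact_mod_cast hb
  have hinv : 1 ≤ 1 / ε := by rw [le_div_iff₀ hε]; linarith
  obtain ⟨X, hX⟩ : ∃ X, X = (n : ℝ) + 1 / ε := ⟨_, rfl⟩
  have hnr : (1 : ℝ) ≤ n := by exact_mod_cast hn
  have hX1 : 1 ≤ X := by linarith
  have hX5 : X ^ 5 ≤ X ^ K := pow_le_pow_right₀ hX1 hK5
  have hX51 : 1 ≤ X ^ 5 := one_le_pow₀ hX1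
  rw [← hX]
  -- For `n = 1` the logarithm vanishes and no loss is allowed, so the single sensor is started at
  -- time 0.
  rcases Nat.lt_or_ge 1 n with hn2 | hn1
  · have ha : 0 < a := by
      rcases Nat.eq_zero_or_pos a with rfl | h
      · simp only [Nat.cast_zero, zero_div] at hεa
        linarith
      · exact h
    have har : (0 : ℝ) < a := by exact_mod_cast ha
    rw [div_le_iff₀ hbr] at haε
    rw [le_div_iff₀ hbr] at hεa
    have hab : a ≤ b := by
      have : (a : ℝ) ≤ b := by nlinarith
      exact_mod_cast this
    obtain ⟨m, S, hrun, hS, q, kk, G, hq, hqQ, hG, h0, hcov, x, hx, hW⟩ :=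
      ens_solve (I := I) (Q := 7 * b / a) rfl hn ha hab
    -- From `ε / 2 ≤ a / b`; the other half of the assumption, `a / b ≤ ε`, yields `7 ≤ q ε`.
    have hQ : ((7 * b / a : ℕ) : ℝ) ≤ 14 / ε := by
      refine Nat.cast_div_le.trans ?_
      push_cast
      rw [div_le_div_iff₀ har hε]
      nlinarith
    have hqr : 7 * (b : ℝ) ≤ q * a := by exact_mod_cast hq
    have hq7 : 7 ≤ q * ε := by
      have h : 7 * (b : ℝ) ≤ q * ε * b :=
        hqr.trans (by rw [mul_assoc]; exact mul_le_mul_of_nonneg_left haε (Nat.cast_nonneg q))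
      exact le_of_mul_le_mul_right h hbr
    have hqQr : (q : ℝ) ≤ 14 / ε + 1 := by
      have : (q : ℝ) ≤ ((7 * b / a : ℕ) : ℝ) + 1 := by exact_mod_cast hqQ
      linarith
    have hq15 : q * ε ≤ 15 := by
      have := mul_le_mul_of_nonneg_right hqQr hε.le
      rw [add_mul, div_mul_cancel₀ _ hε.ne'] at this
      linarith
    refine ⟨m, 4 + S, .ifPos_pos _ (by simpa [RAM.Expr.eval, RSC.input] using hn2) hrun, ?_,
      ((kk * (q * I.dmax) : ℤ) : ℝ), by positivity, ?_, isSchedule_of_int h0 hcov⟩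
    · have hbase : (n : ℝ) + 1 + (((7 * b / a : ℕ) : ℝ) + 1) ≤ 15 * X := by
        have : 14 / ε = 14 * (1 / ε) := by ring
        linarith
      have hSr : (S : ℝ) ≤ 10000 * ((n : ℝ) + 1 + (((7 * b / a : ℕ) : ℝ) + 1)) ^ 5 := by
        exact_mod_cast hS
      have : ((n : ℝ) + 1 + (((7 * b / a : ℕ) : ℝ) + 1)) ^ 5 ≤ (15 * X) ^ 5 := by gcongr
      rw [mul_pow] at this
      rw [hKr]
      push_cast
      linarith
    · push_cast
      refine duration_bound (W := ((∑ s, if I.Live s x then (I.dur s : ℤ) else 0 : ℤ) : ℝ))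
        (G := G) hε hε1 hq7 hq15 (Nat.cast_nonneg _) (by exact_mod_cast load_le_of_live hx)
        (Nat.cast_nonneg _) (Nat.cast_nonneg _) ?_ (by exact_mod_cast hW)
      refine le_trans ?_ (natLog_two_add_one_le hn2)
      exact_mod_cast hG
  · obtain rfl : n = 1 := by omega
    refine ⟨_, _, runs_schedule_one I a b, ?_, I.dur 0, Nat.cast_nonneg _, ?_,
      isSchedule_one I a b⟩
    · rw [hKr]
      push_cast
      linarith
    · simp only [Nat.cast_one, Real.log_one, mul_zero, zero_mul, sub_zero]
      refine (div_le_self (Nat.cast_nonneg _) (by linarith)).trans ?_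
      exact_mod_cast load_le_dur_one I
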